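/- Let $d\ge 1$, let $j\in\{1,2\}$, and let $Q(\xi)=|\xi|^{2j}$ on $\mathbb R^d$. Let $V=V_1+V_2$, where $V_1,V_2:\mathbb R^d\to\mathbb R$ are bounded, $V_1$ is smooth, $V_2$ is measurable, and $V(x)\to 0$ as $|x|\to\infty$. Suppose that for some $\delta>0$, as $|x|\to\infty$, $$V_2(x)=O\big(|x|^{-\delta-j/2}\big)\quad\text{and}\quad \partial^\alpha V_1(x)=O\big(|x|^{-(\delta+j+|\alpha|)/2}\big)\ \text{ for all multi-indices } \alpha \text{ with } 1\le|\alpha|\le j.$$ Let $H=Q(p)+V(x)$, $p=-\mathrm i\nabla$, on $L^2(\mathbb R^d)$, that is, $H=(-\Delta)^j+V$ with domain the Sobolev space $H^{2j}(\mathbb R^d)$. Let $\lambda\in\mathbb R$, and let $\phi\in L^2(\mathbb R^d)$ satisfy $(H-\lambda)\phi=0$. Put $$\sigma_{\mathrm c}=\sup\{\sigma\ge 0 : e^{\sigma|x|}\phi\in L^2(\mathbb R^d)\}\in[0,\infty].$$ Then $\sigma_{\mathrm c}<\infty$ unless $\phi=0$. -/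

import Mathlib

open MeasureTheory Filter Asymptotics FourierTransform Bornology
open scoped ENNReal NNReal ContDiff

noncomputable section

/-- The Euclidean space `ℝ^d`. -/
abbrev RSpace (d : ℕ) : Type := EuclideanSpace ℝ (Fin d)

/-- The complex Hilbert space `L²(ℝ^d)` (Lebesgue measure). -/
abbrev L2 (d : ℕ) : Type := Lp (α := RSpace d) ℂ 2 (volume : Measure (RSpace d))

/-- The function `ξ ↦ Q(2πξ) (𝓕 φ)(ξ)`, which represents `Q(p) φ`, `p = -i∇`, on the Fourier
side: Mathlib's Fourier transform has the kernel `exp (-2πi x·ξ)`, so that `p` becomes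
multiplication by `2πξ`. -/
def symbolMul {d : ℕ} (Q : RSpace d → ℝ) (φ : L2 d) (ξ : RSpace d) : ℂ :=
  (Q ((2 * Real.pi) • ξ) : ℂ) * (𝓕 φ : L2 d) ξ

theorem symbolMul_add {d : ℕ} (Q : RSpace d → ℝ) (φ ψ : L2 d) :
    symbolMul Q (φ + ψ) =ᵐ[volume] symbolMul Q φ + symbolMul Q ψ := by
  unfold symbolMul
  rw [FourierTransform.fourier_add]
  filter_upwards [Lp.coeFn_add (𝓕 φ : L2 d) (𝓕 ψ : L2 d)] with ξ h
  rw [h]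
  simp [mul_add]

theorem symbolMul_smul {d : ℕ} (Q : RSpace d → ℝ) (c : ℂ) (φ : L2 d) :
    symbolMul Q (c • φ) =ᵐ[volume] c • symbolMul Q φ := by
  unfold symbolMul
  rw [FourierTransform.fourier_smul]
  filter_upwards [Lp.coeFn_smul c (𝓕 φ : L2 d)] with ξ h
  rw [h]
  simp [mul_left_comm]

/-- The maximal domain of `Q(p)`: all `φ ∈ L²` with `Q(p) φ ∈ L²`. -/
def symbolDomain {d : ℕ} (Q : RSpace d → ℝ) : Submodule ℂ (L2 d) where
  carrier := {φ | MemLp (symbolMul Q φ) 2 volume}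
  add_mem' := fun {φ ψ} hφ hψ => (memLp_congr_ae (symbolMul_add Q φ ψ)).mpr (hφ.add hψ)
  zero_mem' := by
    have h := symbolMul_smul Q 0 (0 : L2 d)
    rw [zero_smul, zero_smul] at h
    exact (memLp_congr_ae h).mpr MemLp.zero
  smul_mem' := fun c φ hφ => (memLp_congr_ae (symbolMul_smul Q c φ)).mpr (hφ.const_smul c)

/-- The element `ξ ↦ Q(2πξ) (𝓕 φ)(ξ)` of `L²`, for `φ` in the domain of `Q(p)`. -/
def symbolMulLp {d : ℕ} (Q : RSpace d → ℝ) (φ : symbolDomain Q) : L2 d :=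
  MemLp.toLp (symbolMul Q φ) φ.2

/-- The operator `Q(p)`, `p = -i∇`, on `L²(ℝ^d)` with its maximal domain:
`Q(p) φ = 𝓕⁻¹ (Q(2π·) 𝓕 φ)`. For an elliptic polynomial `Q` of degree `q` the domain is the
Sobolev space `H^q`. -/
def symbolOp {d : ℕ} (Q : RSpace d → ℝ) : L2 d →ₗ.[ℂ] L2 d where
  domain := symbolDomain Q
  toFun :=
    { toFun := fun φ => 𝓕⁻ (symbolMulLp Q φ)
      map_add' := by
        intro φ ψ
        rw [← FourierTransform.fourierInv_add]
        congr 1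
        exact (MemLp.toLp_congr (φ + ψ).2 (φ.2.add ψ.2) (symbolMul_add Q φ ψ)).trans
          (MemLp.toLp_add φ.2 ψ.2)
      map_smul' := by
        intro c φ
        rw [RingHom.id_apply, ← FourierTransform.fourierInv_smul]
        congr 1
        exact (MemLp.toLp_congr (c • φ).2 (φ.2.const_smul c) (symbolMul_smul Q c φ)).trans
          (MemLp.toLp_const_smul c φ.2) }

/-- `(H - lam) φ = 0` for `H = Q(p) + V` on `L²(ℝ^d)`, `V` bounded: `φ` lies in the domain of
`Q(p)` and `Q(p) φ + V φ = lam φ` as elements of `L²`. -/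
def IsEigensolution {d : ℕ} (Q V : RSpace d → ℝ) (lam : ℝ) (φ : L2 d) : Prop :=
  ∃ h : φ ∈ (symbolOp Q).domain,
    ∀ᵐ x : RSpace d, (symbolOp Q ⟨φ, h⟩ : L2 d) x + (V x : ℂ) * φ x = (lam : ℂ) * φ x

/-- The critical decay rate `σ_c = sup {σ ≥ 0 | exp (σ|x|) φ ∈ L²}`, with values in `[0, ∞]`. -/
def criticalDecayRate {d : ℕ} (φ : L2 d) : ℝ≥0∞ :=
  sSup {s : ℝ≥0∞ | ∃ σ : ℝ≥0, s = σ ∧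
    MemLp (fun x : RSpace d => (Real.exp (σ * ‖x‖) : ℂ) * φ x) 2 volume}

/-- The iterated partial derivative `∂_{J 0} ⋯ ∂_{J (k-1)} V`; these are exactly the `∂^α V`
with `|α| = k`. -/
def iteratedPartial {d k : ℕ} (J : Fin k → Fin d) (V : RSpace d → ℝ) (x : RSpace d) : ℝ :=
  iteratedFDeriv ℝ k V x (fun i => EuclideanSpace.single (J i) (1 : ℝ))

end

open MeasureTheory Filter Asymptotics FourierTransform Bornology
open scoped ENNReal NNReal ContDiff

noncomputable section

/-! ### Partial derivatives -/

section PartialDerivatives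

variable {d : ℕ} {F : Type*} [NormedAddCommGroup F] [NormedSpace ℝ F]

/-! The proof is by contradiction. If `σ_c = ∞`, then `e^{σ|x|} φ` lies in `L¹ ∩ L²` for every `σ`,
and a Carleman inequality with an exponential weight of arbitrarily large rate forces `φ = 0`.

The weight is `e^{τ g}` with `g(x) = h(x_{i₀})` a function of one coordinate, where `h'' = w`, `w(s)
= (1 + s²)^{-a}`, and `a` is slightly above `1/2`. Integrability of `w` keeps `h'` between two
positive constants. Hence `g` is Lipschitz and `e^{τ g} φ` is square integrable for every `τ`, while
the strict convexity of `h` gives a positive commutator. With `m(x) = w(x_{i₀})` the inequality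
reads `τ ∫ m^j e^{2τg} |u|² ≤ C ∫ e^{2τg} |((-Δ)^j - Z) u|²` for all large `τ`, where `Z`
approximates `λ - V` so well that `|λ - V - Z|² ≤ C m^j` (`exists_carleman_potential`). For `u = φ`
the right side is at most `C²` times the integral on the left, so a large `τ` makes that integral
vanish; since `m > 0`, `φ = 0`.

For `j = 1`, `Z = λ - V₁`. The operator `-Δ - Z` is conjugated by the weight and split into a
symmetric part `S` and an antisymmetric part `T`. In `‖(S + T)v‖² = ‖S v‖² + ‖T v‖² + 2⟨S v, T v⟩`
the cross term is, up to divergences, a quadratic form that the convexity of `h` makes positive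
(`carleman_pointwise`, `carleman_estimate`).

For `j = 2` the operator is factored as `(-Δ - W)(-Δ + W)` up to first-order errors, and the
second-order estimate is applied to each factor (`carlemanInequality_two`). A root of `λ - V₁` need
not be smooth where `λ - V₁` vanishes, so `W² = Z = λ - V₁ + iθ` with a small positive decaying `θ`.
This is why the second-order estimate must allow complex potentials.

The inequality is proved for test functions. Cutoffs extend it to smooth functions whose derivatives
decay superexponentially (`CarlemanInequality.of_decay`). Since `φ` solves the equation only weakly,
it is mollified, and the mollification is removed by Fatou's lemma
(`eq_zero_of_superexponential_decay`). -/

/-- The partial derivative `∂_k f`. -/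
def pd (k : Fin d) (f : RSpace d → F) (x : RSpace d) : F :=
  fderiv ℝ f x (EuclideanSpace.single k (1 : ℝ))

/-- The Laplacian as the sum of the second partial derivatives. -/
def lap (f : RSpace d → F) (x : RSpace d) : F := ∑ k, pd k (pd k f) x

theorem ContDiff.pd {f : RSpace d → F} (hf : ContDiff ℝ ∞ f) (k : Fin d) :
    ContDiff ℝ ∞ (pd k f) :=
  (hf.fderiv_right (m := ∞) (by simp)).clm_apply contDiff_const

theorem ContDiff.lap {f : RSpace d → F} (hf : ContDiff ℝ ∞ f) : ContDiff ℝ ∞ (lap f) :=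
  ContDiff.sum fun k _ => (hf.pd k).pd k

theorem HasCompactSupport.pd {f : RSpace d → F} (hf : HasCompactSupport f) (k : Fin d) :
    HasCompactSupport (pd k f) :=
  hf.fderiv_apply (𝕜 := ℝ) _

theorem HasCompactSupport.lap {f : RSpace d → F} (hf : HasCompactSupport f) :
    HasCompactSupport (lap f) := by
  refine hf.mono' fun x hx => ?_
  by_contra hxs
  refine hx (Finset.sum_eq_zero fun k _ => ?_)
  have h1 : tsupport (_root_.pd k (_root_.pd k f)) ⊆ tsupport f :=
    (tsupport_fderiv_apply_subset ℝ _).trans (tsupport_fderiv_apply_subset ℝ _)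
  exact image_eq_zero_of_notMem_tsupport fun h => hxs (h1 h)

theorem pd_const (k : Fin d) (c : F) : pd k (fun _ => c) = 0 := by
  ext x; simp [pd]

theorem pd_add {f g : RSpace d → F} {x : RSpace d} (k : Fin d)
    (hf : DifferentiableAt ℝ f x) (hg : DifferentiableAt ℝ g x) :
    pd k (fun x => f x + g x) x = pd k f x + pd k g x := by
  simp [pd, fderiv_fun_add hf hg]

theorem pd_sub {f g : RSpace d → F} {x : RSpace d} (k : Fin d)
    (hf : DifferentiableAt ℝ f x) (hg : DifferentiableAt ℝ g x) :
    pd k (fun x => f x - g x) x = pd k f x - pd k g x := by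
  simp [pd, fderiv_fun_sub hf hg]

theorem pd_neg {f : RSpace d → F} {x : RSpace d} (k : Fin d) :
    pd k (fun x => - f x) x = - pd k f x := by
  simp [pd, fderiv_fun_neg]

theorem pd_mul {R : Type*} [NormedCommRing R] [NormedAlgebra ℝ R] {f g : RSpace d → R}
    {x : RSpace d} (k : Fin d) (hf : DifferentiableAt ℝ f x) (hg : DifferentiableAt ℝ g x) :
    pd k (fun x => f x * g x) x = f x * pd k g x + g x * pd k f x := by
  simp [pd, fderiv_fun_mul hf hg]

theorem pd_const_mul {R : Type*} [NormedCommRing R] [NormedAlgebra ℝ R] {f : RSpace d → R}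
    {x : RSpace d} (k : Fin d) (c : R) (hf : DifferentiableAt ℝ f x) :
    pd k (fun x => c * f x) x = c * pd k f x := by
  simp [pd, fderiv_const_mul hf]

theorem pd_pow {f : RSpace d → ℝ} {x : RSpace d} (k : Fin d) (n : ℕ)
    (hf : DifferentiableAt ℝ f x) :
    pd k (fun x => f x ^ n) x = n * f x ^ (n - 1) * pd k f x := by
  simp [pd, fderiv_fun_pow n hf]

theorem pd_sum {ι : Type*} (s : Finset ι) {f : ι → RSpace d → F} {x : RSpace d} (k : Fin d)
    (hf : ∀ i ∈ s, DifferentiableAt ℝ (f i) x) :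
    pd k (fun x => ∑ i ∈ s, f i x) x = ∑ i ∈ s, pd k (f i) x := by
  simp [pd, fderiv_fun_sum hf]

theorem pd_exp {f : RSpace d → ℝ} {x : RSpace d} (k : Fin d) (hf : DifferentiableAt ℝ f x) :
    pd k (fun x => Real.exp (f x)) x = Real.exp (f x) * pd k f x := by
  simp [pd, fderiv_exp hf]

theorem pd_clm_comp {G : Type*} [NormedAddCommGroup G] [NormedSpace ℝ G] (L : F →L[ℝ] G)
    {f : RSpace d → F} {x : RSpace d} (k : Fin d) (hf : DifferentiableAt ℝ f x) :
    pd k (fun x => L (f x)) x = L (pd k f x) := by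
  have h := (L.hasFDerivAt.comp x hf.hasFDerivAt).fderiv
  simp only [pd]
  change fderiv ℝ (L ∘ f) x _ = _
  rw [h]; rfl

theorem pd_comm {f : RSpace d → F} (hf : ContDiff ℝ ∞ f) (k l : Fin d) :
    pd k (pd l f) = pd l (pd k f) := by
  ext1 x
  have hsymm : IsSymmSndFDerivAt ℝ f x :=
    hf.contDiffAt.isSymmSndFDerivAt (by simpa using (WithTop.coe_le_coe.2 (le_top : (2 : ℕ∞) ≤ ⊤)))
  have hd : DifferentiableAt ℝ (fderiv ℝ f) x :=
    ((hf.fderiv_right (m := ∞) (by simp)).differentiable (by simp)) x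
  have key : ∀ k l : Fin d, pd k (pd l f) x
      = fderiv ℝ (fderiv ℝ f) x (EuclideanSpace.single k 1) (EuclideanSpace.single l 1) := by
    intro k l
    have := pd_clm_comp (ContinuousLinearMap.apply ℝ F (EuclideanSpace.single l (1 : ℝ)))
      (f := fderiv ℝ f) k hd
    exact this
  rw [key, key]
  exact hsymm _ _

/-- The integral of a partial derivative of a compactly supported function vanishes. -/
theorem integral_pd_eq_zero {f : RSpace d → ℝ} (hf : ContDiff ℝ ∞ f)
    (hc : HasCompactSupport f) (k : Fin d) : ∫ x, pd k f x = 0 := by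
  have hint : Integrable (pd k f) (volume : Measure (RSpace d)) :=
    (hf.pd k).continuous.integrable_of_hasCompactSupport (hc.pd k)
  have h := integral_mul_fderiv_eq_neg_fderiv_mul_of_integrable (𝕜 := ℝ)
    (μ := (volume : Measure (RSpace d)))
    (f := fun _ => (1 : ℝ)) (g := f) (v := EuclideanSpace.single k (1 : ℝ))
    (by simp)
    (by simp only [one_mul]; exact hint)
    (by simpa using hf.continuous.integrable_of_hasCompactSupport hc)
    (fun x _ => differentiableAt_const _) (fun x _ => hf.differentiable (by simp) x)
  simpa [pd] using h

end PartialDerivatives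

/-! ### The Carleman estimate for `-Δ - W` -/

section Carleman

variable {d : ℕ}

/-- The commutator identity in pointwise form. Here `S v = -Δv - p² v - A v` and `T v = 2p ∂v + q v`
are the symmetric and antisymmetric parts of the conjugated operator. The product `2 (S v)(T v)` is
a divergence plus a quadratic form with principal terms `4q (∂v)² + 4p²q v²`, positive when `q > 0`.
-/
theorem carleman_divergence {v p q r A : RSpace d → ℝ} (i₀ : Fin d)
    (hv : ContDiff ℝ ∞ v) (hp : ContDiff ℝ ∞ p) (hq : ContDiff ℝ ∞ q) (hA : ContDiff ℝ ∞ A)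
    (hpd : ∀ k x, pd k p x = if k = i₀ then q x else 0)
    (hqd : ∀ k x, pd k q x = if k = i₀ then r x else 0) (x : RSpace d) :
    ∑ k, pd k (fun x => -2 * (pd k v x * (2 * (p x * pd i₀ v x) + q x * v x))) x
      + pd i₀ (fun x => 2 * (p x * ∑ k, pd k v x ^ 2) - 2 * (p x ^ 3 * v x ^ 2)
          - 2 * (A x * p x * v x ^ 2)) x
      = 2 * ((-lap v x - p x ^ 2 * v x - A x * v x) * (2 * p x * pd i₀ v x + q x * v x))
        - (4 * q x * pd i₀ v x ^ 2 + 2 * r x * (v x * pd i₀ v x)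
          + 4 * p x ^ 2 * q x * v x ^ 2 + 2 * p x * pd i₀ A x * v x ^ 2) := by
  have hv' : Differentiable ℝ v := hv.differentiable (by simp)
  have hp' : Differentiable ℝ p := hp.differentiable (by simp)
  have hq' : Differentiable ℝ q := hq.differentiable (by simp)
  have hA' : Differentiable ℝ A := hA.differentiable (by simp)
  have hvk : ∀ k, Differentiable ℝ (pd k v) := fun k => (hv.pd k).differentiable (by simp)
  have e1 : ∀ k, pd k (fun x => -2 * (pd k v x * (2 * (p x * pd i₀ v x) + q x * v x))) x
      = -2 * (pd k (pd k v) x * (2 * (p x * pd i₀ v x) + q x * v x))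
        + (-4 * p x * (pd k v x * pd i₀ (pd k v) x) - 2 * q x * pd k v x ^ 2)
        + if k = i₀ then -2 * pd k v x * (2 * pd i₀ v x * q x + v x * r x) else 0 := by
    intro k
    have hvk' := hvk k
    have hvi := hvk i₀
    rw [pd_const_mul k _ (by fun_prop), pd_mul k (by fun_prop) (by fun_prop),
      pd_add k (by fun_prop) (by fun_prop), pd_const_mul k _ (by fun_prop),
      pd_mul k (by fun_prop) (by fun_prop), pd_mul k (by fun_prop) (by fun_prop), hpd, hqd,
      pd_comm hv k i₀]
    split_ifs <;> ring
  have e2 : pd i₀ (fun x => 2 * (p x * ∑ k, pd k v x ^ 2) - 2 * (p x ^ 3 * v x ^ 2)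
          - 2 * (A x * p x * v x ^ 2)) x
      = ∑ k, (4 * p x * (pd k v x * pd i₀ (pd k v) x) + 2 * q x * pd k v x ^ 2)
        - 2 * (p x ^ 3 * (2 * v x * pd i₀ v x) + v x ^ 2 * (3 * p x ^ 2 * q x))
        - 2 * (A x * p x * (2 * v x * pd i₀ v x) + v x ^ 2 * (A x * q x + p x * pd i₀ A x)) := by
    have hs : Differentiable ℝ (fun x => ∑ k, pd k v x ^ 2) := by fun_prop
    rw [pd_sub i₀ (by fun_prop) (by fun_prop), pd_sub i₀ (by fun_prop) (by fun_prop),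
      pd_const_mul i₀ _ (by fun_prop), pd_const_mul i₀ _ (by fun_prop),
      pd_const_mul i₀ _ (by fun_prop),
      pd_mul i₀ (by fun_prop) (by fun_prop), pd_mul i₀ (by fun_prop) (by fun_prop),
      pd_mul i₀ (by fun_prop) (by fun_prop), pd_mul i₀ (by fun_prop) (by fun_prop),
      pd_sum _ i₀ (fun k _ => by have := hvk k; fun_prop),
      pd_pow i₀ 3 (by fun_prop), pd_pow i₀ 2 (by fun_prop), hpd, if_pos rfl]
    have : ∀ k, pd i₀ (fun x => pd k v x ^ 2) x = 2 * (pd k v x * pd i₀ (pd k v) x) := by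
      intro k
      rw [pd_pow i₀ 2 (hvk k x)]
      push_cast; ring
    simp only [this, Finset.sum_add_distrib, ← Finset.mul_sum]
    push_cast
    ring
  simp only [e1, e2, lap, Finset.sum_add_distrib, Finset.sum_sub_distrib, ← Finset.mul_sum,
    ← Finset.sum_mul, Finset.sum_ite_eq', Finset.mem_univ, if_true]
  ring

/-- This handles the imaginary part `iB` of the potential, which is antisymmetric and couples real
and imaginary parts. Its commutator with `-Δ` costs only first derivatives of `B`, and the
zeroth-order parts of `S` cancel against each other. -/
theorem carleman_cross_divergence {v₁ v₂ B : RSpace d → ℝ}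
    (hv₁ : ContDiff ℝ ∞ v₁) (hv₂ : ContDiff ℝ ∞ v₂) (hB : ContDiff ℝ ∞ B) (x : RSpace d) :
    ∑ k, pd k (fun x => 2 * (B x * (v₁ x * pd k v₂ x - v₂ x * pd k v₁ x))) x
      = 2 * (B x * (v₁ x * lap v₂ x - v₂ x * lap v₁ x))
        + ∑ k, 2 * (pd k B x * (v₁ x * pd k v₂ x - v₂ x * pd k v₁ x)) := by
  have h₁ : Differentiable ℝ v₁ := hv₁.differentiable (by simp)
  have h₂ : Differentiable ℝ v₂ := hv₂.differentiable (by simp)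
  have hB' : Differentiable ℝ B := hB.differentiable (by simp)
  have h₁k : ∀ k, Differentiable ℝ (pd k v₁) := fun k => (hv₁.pd k).differentiable (by simp)
  have h₂k : ∀ k, Differentiable ℝ (pd k v₂) := fun k => (hv₂.pd k).differentiable (by simp)
  simp only [lap, Finset.mul_sum, ← Finset.sum_sub_distrib, ← Finset.sum_add_distrib]
  refine Finset.sum_congr rfl fun k _ => ?_
  have h3 := h₁k k
  have h4 := h₂k k
  rw [pd_const_mul k _ (by fun_prop), pd_mul k (by fun_prop) (by fun_prop),
    pd_sub k (by fun_prop) (by fun_prop), pd_mul k (by fun_prop) (by fun_prop),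
    pd_mul k (by fun_prop) (by fun_prop)]
  ring

/-- The commutator controls only the derivative along `i₀`. Pairing `S v` with `w v` recovers the
whole gradient, needed both for the `∇B` terms and for the errors of the fourth-order factorization.
-/
theorem gradient_divergence {v w w' : RSpace d → ℝ} (i₀ : Fin d)
    (hv : ContDiff ℝ ∞ v) (hw : ContDiff ℝ ∞ w)
    (hwd : ∀ k x, pd k w x = if k = i₀ then w' x else 0) (x : RSpace d) :
    ∑ k, pd k (fun x => -(w x * (v x * pd k v x))) x
      = -(w x * v x * lap v x) - w x * ∑ k, pd k v x ^ 2 - w' x * (v x * pd i₀ v x) := by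
  have h₁ : Differentiable ℝ v := hv.differentiable (by simp)
  have hw' : Differentiable ℝ w := hw.differentiable (by simp)
  have h₁k : ∀ k, Differentiable ℝ (pd k v) := fun k => (hv.pd k).differentiable (by simp)
  have : ∀ k, pd k (fun x => -(w x * (v x * pd k v x))) x
      = -(w x * v x * pd k (pd k v) x) - w x * pd k v x ^ 2
        + if k = i₀ then -(v x * pd k v x) * w' x else 0 := by
    intro k
    have h3 := h₁k k
    rw [pd_neg, pd_mul k (by fun_prop) (by fun_prop), pd_mul k (by fun_prop) (by fun_prop), hwd]
    split_ifs <;> ring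
  simp only [this, lap, Finset.sum_add_distrib, Finset.sum_sub_distrib, Finset.sum_neg_distrib,
    ← Finset.mul_sum, Finset.sum_ite_eq', Finset.mem_univ, if_true]
  ring

/-- A weight `Ψ` depending on the coordinate `i₀` only, with derivatives `p`, `q`, `r`, whose
convexity is measured by `τ w`. -/
structure CarlemanWeight (i₀ : Fin d) (K τ : ℝ) (Ψ p q r w w' : RSpace d → ℝ) : Prop where
  smooth : ContDiff ℝ ∞ Ψ
  smooth_fst : ContDiff ℝ ∞ p
  smooth_snd : ContDiff ℝ ∞ q
  smooth_conv : ContDiff ℝ ∞ w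
  pd_eq : ∀ k x, pd k Ψ x = if k = i₀ then p x else 0
  pd_fst : ∀ k x, pd k p x = if k = i₀ then q x else 0
  pd_snd : ∀ k x, pd k q x = if k = i₀ then r x else 0
  pd_conv : ∀ k x, pd k w x = if k = i₀ then w' x else 0
  conv_pos : ∀ x, 0 < w x
  conv_le_one : ∀ x, w x ≤ 1
  le_fst : ∀ x, τ / 2 ≤ p x
  fst_le : ∀ x, p x ≤ K * τ
  le_snd : ∀ x, τ * w x / 2 ≤ q x
  abs_third_le : ∀ x, |r x| ≤ K * τ * w x
  abs_pd_conv_le : ∀ x, |w' x| ≤ K * w x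

set_option maxHeartbeats 1000000 in
-- The algebraic core of the estimate. The subtracted expressions are the divergences of the three
-- preceding identities. What remains is `S² + T²`, the commutator form, and `τ / (8K²)` times the
-- gradient identity. `N` and `Y` below stand for `|v|²` and `|∂_{i₀} v|²`; the `τ³ N` and `τ Y`
-- terms of the commutator absorb all errors once `τ` is large.
theorem carleman_pointwise {K τ n w w' p q r A A' v₁ v₂ D₁ D₂ S₁ S₂ T₁ T₂ G X : ℝ}
    (hK : 1 ≤ K) (hn : 0 ≤ n) (hτ : 1000 * K ^ 3 + 10 * n * K ≤ τ) (hw : 0 < w) (hw1 : w ≤ 1)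
    (hp : τ / 2 ≤ p) (hp' : p ≤ K * τ) (hq : τ * w / 2 ≤ q) (hr : |r| ≤ K * τ * w)
    (hw' : |w'| ≤ K * w) (hA : |A| ≤ K) (hA' : |A'| ≤ K * w) (hG : 0 ≤ G)
    (hX : |X| ≤ K * w * (n * (v₁ ^ 2 + v₂ ^ 2) + G)) :
    w * (τ / (16 * K ^ 2) * G + τ ^ 3 / 8 * (v₁ ^ 2 + v₂ ^ 2))
      ≤ (S₁ + T₁) ^ 2 + (S₂ + T₂) ^ 2
        - (2 * (S₁ * T₁ + S₂ * T₂)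
          - (4 * q * (D₁ ^ 2 + D₂ ^ 2) + 2 * r * (v₁ * D₁ + v₂ * D₂)
            + 4 * p ^ 2 * q * (v₁ ^ 2 + v₂ ^ 2) + 2 * p * A' * (v₁ ^ 2 + v₂ ^ 2) - X))
        - τ / (8 * K ^ 2) * (w * (S₁ * v₁ + S₂ * v₂)
          - (w * G + w' * (v₁ * D₁ + v₂ * D₂) - w * (p ^ 2 + A) * (v₁ ^ 2 + v₂ ^ 2))) := by
  set N := v₁ ^ 2 + v₂ ^ 2 with hN
  set Y := D₁ ^ 2 + D₂ ^ 2 with hY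
  set c := v₁ * D₁ + v₂ * D₂ with hc
  have hN0 : 0 ≤ N := by positivity
  have hY0 : 0 ≤ Y := by positivity
  have hK3 : K ≤ K ^ 3 := le_self_pow₀ hK three_ne_zero
  have hnK : 0 ≤ n * K := by positivity
  have hτ1 : 1000 ≤ τ := by linarith
  have hτ0 : 0 < τ := by linarith
  have hτw : 0 < τ * w := by positivity
  have hc1 : 2 * K * |c| ≤ Y + K ^ 2 * N := by
    have : ∀ s : ℝ, s ^ 2 = 1 → 2 * K * (s * c) ≤ Y + K ^ 2 * N := by
      intro s hs
      have : Y + K ^ 2 * N - 2 * K * (s * c)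
          = (K * v₁ - s * D₁) ^ 2 + (K * v₂ - s * D₂) ^ 2 + (1 - s ^ 2) * Y := by
        rw [hN, hY, hc]; ring
      rw [hs] at this
      nlinarith [sq_nonneg (K * v₁ - s * D₁), sq_nonneg (K * v₂ - s * D₂)]
    rcases abs_cases c with ⟨h, _⟩ | ⟨h, _⟩
    · rw [h]; simpa using this 1 (by norm_num)
    · rw [h]; simpa using this (-1) (by norm_num)
  have hc2 : 2 * |c| ≤ Y + N := by
    have : ∀ s : ℝ, s ^ 2 = 1 → 2 * (s * c) ≤ Y + N := by
      intro s hs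
      have : Y + N - 2 * (s * c)
          = (v₁ - s * D₁) ^ 2 + (v₂ - s * D₂) ^ 2 + (1 - s ^ 2) * Y := by
        rw [hN, hY, hc]; ring
      rw [hs] at this
      nlinarith [sq_nonneg (v₁ - s * D₁), sq_nonneg (v₂ - s * D₂)]
    rcases abs_cases c with ⟨h, _⟩ | ⟨h, _⟩
    · rw [h]; simpa using this 1 (by norm_num)
    · rw [h]; simpa using this (-1) (by norm_num)
  have f1 : 2 * (τ * w) * Y ≤ 4 * q * Y := by
    have := mul_le_mul_of_nonneg_right hq hY0
    linarith
  have f2 : -(τ * w * (Y + K ^ 2 * N)) ≤ 2 * r * c := by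
    have h1 : |2 * r * c| ≤ 2 * (K * τ * w) * |c| := by
      rw [abs_mul, abs_mul, abs_two]
      gcongr
    have h2 := mul_le_mul_of_nonneg_left hc1 hτw.le
    have h3 := neg_abs_le (2 * r * c)
    linarith
  have f3 : τ ^ 3 / 2 * w * N ≤ 4 * p ^ 2 * q * N := by
    have h1 : (τ / 2) ^ 2 ≤ p ^ 2 := by gcongr
    have h2 : (τ / 2) ^ 2 * (τ * w / 2) ≤ p ^ 2 * q := by gcongr
    have := mul_le_mul_of_nonneg_right h2 hN0
    linarith
  have f4 : -(2 * K ^ 2 * (τ * w) * N) ≤ 2 * p * A' * N := by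
    have hp0 : 0 ≤ p := by linarith
    have h1 : |2 * p * A' * N| ≤ 2 * (K * τ) * (K * w) * N := by
      rw [abs_mul, abs_mul, abs_mul, abs_two, abs_of_nonneg hN0, abs_of_nonneg hp0]
      gcongr
    have h3 := neg_abs_le (2 * p * A' * N)
    linarith
  have f5 : X ≤ K * w * (n * N + G) := (le_abs_self X).trans hX
  have hκ : 0 < 1 / (8 * K ^ 2) := by positivity
  -- Multiplying the gradient identity by `κτ` costs `κτ w p² N`, where `p ≤ Kτ`. The choice `κ K² =
  -- 1/8` keeps this below a quarter of the commutator's `τ³ w N / 2`.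
  set κ := 1 / (8 * K ^ 2) with hκdef
  have hκK : κ * K ^ 2 = 1 / 8 := by rw [hκdef]; field_simp
  have e1 : τ / (8 * K ^ 2) = κ * τ := by rw [hκdef]; ring
  have e2 : τ / (16 * K ^ 2) = κ * τ / 2 := by rw [hκdef]; field_simp; norm_num
  have hκK1 : κ * K ≤ 1 / 8 := by
    rw [← hκK]; have : K ≤ K ^ 2 := le_self_pow₀ hK two_ne_zero
    gcongr
  have hκ1 : κ ≤ 1 / 8 := (le_mul_of_one_le_right hκ.le hK).trans hκK1
  -- The pairing of `S v` with `w v` is paid for by the otherwise spare square `S²`; the square `T²`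
  -- is simply dropped at the end.
  have f6 : κ * τ * (w * (S₁ * v₁ + S₂ * v₂)) ≤ S₁ ^ 2 + S₂ ^ 2 + τ ^ 2 / 256 * w * N := by
    set m := κ * τ * w with hm
    have h1 : m * (S₁ * v₁ + S₂ * v₂) ≤ S₁ ^ 2 + S₂ ^ 2 + m ^ 2 / 4 * N := by
      rw [hN]; nlinarith [sq_nonneg (S₁ - m / 2 * v₁), sq_nonneg (S₂ - m / 2 * v₂)]
    have h2 : m ^ 2 / 4 ≤ τ ^ 2 / 256 * w := by
      have a1 : κ ^ 2 ≤ (1 / 8) ^ 2 := by gcongr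
      have a2 : w ^ 2 ≤ w := pow_le_of_le_one hw.le hw1 two_ne_zero
      have a3 : κ ^ 2 * w ^ 2 ≤ (1 / 8) ^ 2 * w := by gcongr
      have a4 := mul_le_mul_of_nonneg_left a3 (sq_nonneg τ)
      rw [hm]; linarith
    have := mul_le_mul_of_nonneg_right h2 hN0
    rw [hm] at h1 this
    linarith
  have f7 : -(τ * w * (Y + N) / 16) ≤ κ * τ * (w' * c) := by
    have h1 : |κ * τ * (w' * c)| ≤ κ * τ * (K * w * |c|) := by
      rw [abs_mul, abs_mul, abs_mul, abs_of_pos hκ, abs_of_pos hτ0]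
      gcongr
    have h2 : κ * τ * (K * w * |c|) ≤ τ * w * (Y + N) / 16 := by
      have a1 : κ * K * |c| ≤ 1 / 8 * |c| := by gcongr
      have := mul_le_mul_of_nonneg_left (a1.trans (by linarith : 1 / 8 * |c| ≤ (Y + N) / 16)) hτw.le
      linarith
    linarith [neg_abs_le (κ * τ * (w' * c))]
  have f8 : κ * τ * (w * (p ^ 2 + A) * N) ≤ (τ ^ 3 / 8 + τ / 8) * w * N := by
    have hp0 : 0 ≤ p := by linarith
    have h1 : p ^ 2 ≤ (K * τ) ^ 2 := by gcongr
    have h2 : p ^ 2 + A ≤ (K * τ) ^ 2 + K := by linarith [le_abs_self A]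
    have h3 : κ * (p ^ 2 + A) ≤ τ ^ 2 / 8 + 1 / 8 := by
      have := mul_le_mul_of_nonneg_left h2 hκ.le
      have e : κ * ((K * τ) ^ 2 + K) = (κ * K ^ 2) * τ ^ 2 + κ * K := by ring
      rw [e, hκK] at this
      linarith
    have h4 : κ * (p ^ 2 + A) * (τ * w * N) ≤ (τ ^ 2 / 8 + 1 / 8) * (τ * w * N) := by gcongr
    linarith
  -- Half of the gained gradient term absorbs the `∇B` error; the other half survives in the
  -- conclusion.
  have g1 : 0 ≤ (κ * τ / 2 - K) * (w * G) := by
    apply mul_nonneg _ (by positivity)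
    have : κ * (1000 * K ^ 3) ≤ κ * τ := by
      apply mul_le_mul_of_nonneg_left _ hκ.le; linarith
    have e : κ * (1000 * K ^ 3) = 1000 * (κ * K ^ 2) * K := by ring
    rw [e, hκK] at this
    linarith
  have g2 : 0 ≤ (τ ^ 3 / 4 - 3 * K ^ 2 * τ - K * n - τ ^ 2 / 256 - τ / 4) * (w * N) := by
    apply mul_nonneg _ (by positivity)
    have a0 : K ^ 2 ≤ K ^ 3 := pow_le_pow_right₀ hK (by norm_num)
    have a1 : 1000 * K ^ 2 * τ ≤ τ * τ := by
      apply mul_le_mul_of_nonneg_right _ hτ0.le; linarith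
    have a2 : 10 * (K * n) ≤ τ := by linarith [pow_pos (by linarith : (0:ℝ) < K) 3]
    have a3 : 1000 * τ ≤ τ * τ := by gcongr
    have a4 : 1000 * (τ * τ) ≤ τ * (τ * τ) := by gcongr
    nlinarith
  have g3 : 0 ≤ τ * w * Y := by positivity
  have g4 : 0 ≤ τ * w * N := by positivity
  rw [e1, e2]
  have sq1 := sq_nonneg T₁
  have sq2 := sq_nonneg T₂
  linarith

end Carleman

/-! ### The Carleman estimate in integrated form -/

section CarlemanIntegrated

variable {d : ℕ}

/-- Integrable functions of vanishing integral. -/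
def HasZeroIntegral (f : RSpace d → ℝ) : Prop := Integrable f ∧ ∫ x, f x = 0

theorem HasZeroIntegral.add {f g : RSpace d → ℝ} (hf : HasZeroIntegral f)
    (hg : HasZeroIntegral g) : HasZeroIntegral fun x => f x + g x :=
  ⟨hf.1.add hg.1, by rw [integral_add hf.1 hg.1, hf.2, hg.2, add_zero]⟩

theorem HasZeroIntegral.const_mul {f : RSpace d → ℝ} (hf : HasZeroIntegral f) (c : ℝ) :
    HasZeroIntegral fun x => c * f x :=
  ⟨hf.1.const_mul c, by rw [integral_const_mul, hf.2, mul_zero]⟩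

theorem HasZeroIntegral.sum {ι : Type*} (s : Finset ι) {f : ι → RSpace d → ℝ}
    (hf : ∀ i ∈ s, HasZeroIntegral (f i)) : HasZeroIntegral fun x => ∑ i ∈ s, f i x :=
  ⟨integrable_finsetSum s fun i hi => (hf i hi).1, by
    rw [integral_finsetSum s fun i hi => (hf i hi).1]
    exact Finset.sum_eq_zero fun i hi => (hf i hi).2⟩

theorem hasZeroIntegral_pd {f : RSpace d → ℝ} (hf : ContDiff ℝ ∞ f)
    (hc : HasCompactSupport f) (k : Fin d) : HasZeroIntegral (pd k f) :=
  ⟨(hf.pd k).continuous.integrable_of_hasCompactSupport (hc.pd k), integral_pd_eq_zero hf hc k⟩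

/-- The bound for `v = e^Ψ u` is kept pointwise, modulo a function `g` of zero integral collecting
the divergences. Undoing the conjugation can then be done under a single integral. -/
theorem carleman_estimate_conjugated {i₀ : Fin d} {K τ : ℝ} {Ψ p q r w w' A B : RSpace d → ℝ}
    (hK : 1 ≤ K) (hτ : 1000 * K ^ 3 + 10 * d * K ≤ τ) (hΨ : CarlemanWeight i₀ K τ Ψ p q r w w')
    (hA : ContDiff ℝ ∞ A) (hB : ContDiff ℝ ∞ B) (hAK : ∀ x, |A x| ≤ K)
    (hA' : ∀ k x, |pd k A x| ≤ K * w x) (hB' : ∀ k x, |pd k B x| ≤ K * w x)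
    {v₁ v₂ : RSpace d → ℝ} (hv₁ : ContDiff ℝ ∞ v₁) (hv₂ : ContDiff ℝ ∞ v₂)
    (hc₁ : HasCompactSupport v₁) (hc₂ : HasCompactSupport v₂) :
    ∃ g : RSpace d → ℝ, HasZeroIntegral g ∧ ∀ x,
      w x * (τ / (16 * K ^ 2) * (∑ k, (pd k v₁ x ^ 2 + pd k v₂ x ^ 2))
        + τ ^ 3 / 8 * (v₁ x ^ 2 + v₂ x ^ 2))
      ≤ ((-lap v₁ x - p x ^ 2 * v₁ x - A x * v₁ x)
            + (2 * p x * pd i₀ v₁ x + q x * v₁ x + B x * v₂ x)) ^ 2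
        + ((-lap v₂ x - p x ^ 2 * v₂ x - A x * v₂ x)
            + (2 * p x * pd i₀ v₂ x + q x * v₂ x - B x * v₁ x)) ^ 2 - g x := by
  have hp := hΨ.smooth_fst
  have hq := hΨ.smooth_snd
  have hw := hΨ.smooth_conv
  have hz1 : ∀ {v : RSpace d → ℝ}, ContDiff ℝ ∞ v → HasCompactSupport v →
      HasZeroIntegral fun x =>
        ∑ k, pd k (fun x => -2 * (pd k v x * (2 * (p x * pd i₀ v x) + q x * v x))) x
      + pd i₀ (fun x => 2 * (p x * ∑ k, pd k v x ^ 2) - 2 * (p x ^ 3 * v x ^ 2)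
          - 2 * (A x * p x * v x ^ 2)) x := by
    intro v hv hc
    have hvk := fun k => hv.pd k
    refine (HasZeroIntegral.sum _ fun k _ => ?_).add ?_
    · have := hvk k
      have := hvk i₀
      refine hasZeroIntegral_pd (by fun_prop) ?_ k
      refine (hc.pd k).mono fun x hx h => hx ?_
      simp [h]
    · refine hasZeroIntegral_pd (by fun_prop) ?_ i₀
      refine hc.mono' fun x hx => ?_
      by_contra h
      have hk : ∀ k, pd k v x = 0 := fun k =>
        image_eq_zero_of_notMem_tsupport fun h' => h (tsupport_fderiv_apply_subset ℝ _ h')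
      exact hx (by simp [hk, image_eq_zero_of_notMem_tsupport h])
  have hz2 : HasZeroIntegral fun x =>
      ∑ k, pd k (fun x => 2 * (B x * (v₁ x * pd k v₂ x - v₂ x * pd k v₁ x))) x := by
    refine HasZeroIntegral.sum _ fun k _ => ?_
    have h1 := hv₁.pd k
    have h2 := hv₂.pd k
    refine hasZeroIntegral_pd (by fun_prop) ?_ k
    exact ((hc₁.mul_right (f' := pd k v₂)).sub (hc₂.mul_right (f' := pd k v₁))).mul_left
      (f := B) |>.mul_left (f := fun _ => 2)
  have hz3 : ∀ {v : RSpace d → ℝ}, ContDiff ℝ ∞ v → HasCompactSupport v →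
      HasZeroIntegral fun x => ∑ k, pd k (fun x => -(w x * (v x * pd k v x))) x := by
    intro v hv hc
    refine HasZeroIntegral.sum _ fun k _ => ?_
    have := hv.pd k
    refine hasZeroIntegral_pd (by fun_prop) ?_ k
    refine hc.mono fun x hx h => hx ?_
    simp [h]
  refine ⟨_, (((hz1 hv₁ hc₁).add (hz1 hv₂ hc₂)).add hz2).add
    (((hz3 hv₁ hc₁).add (hz3 hv₂ hc₂)).const_mul (τ / (8 * K ^ 2))), fun x => ?_⟩
  rw [carleman_divergence i₀ hv₁ hp hq hA hΨ.pd_fst hΨ.pd_snd,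
    carleman_divergence i₀ hv₂ hp hq hA hΨ.pd_fst hΨ.pd_snd,
    carleman_cross_divergence hv₁ hv₂ hB, gradient_divergence i₀ hv₁ hw hΨ.pd_conv,
    gradient_divergence i₀ hv₂ hw hΨ.pd_conv]
  have hX : |∑ k, 2 * (pd k B x * (v₁ x * pd k v₂ x - v₂ x * pd k v₁ x))|
      ≤ K * w x * (d * (v₁ x ^ 2 + v₂ x ^ 2) + ∑ k, (pd k v₁ x ^ 2 + pd k v₂ x ^ 2)) := by
    have : (d : ℝ) * (v₁ x ^ 2 + v₂ x ^ 2) = ∑ _k : Fin d, (v₁ x ^ 2 + v₂ x ^ 2) := by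
      simp [mul_add]
    rw [this, ← Finset.sum_add_distrib, Finset.mul_sum]
    refine (Finset.abs_sum_le_sum_abs _ _).trans (Finset.sum_le_sum fun k _ => ?_)
    rw [abs_mul, abs_mul, abs_two]
    have h1 : 2 * |v₁ x * pd k v₂ x - v₂ x * pd k v₁ x|
        ≤ v₁ x ^ 2 + v₂ x ^ 2 + (pd k v₁ x ^ 2 + pd k v₂ x ^ 2) := by
      rcases abs_cases (v₁ x * pd k v₂ x - v₂ x * pd k v₁ x) with ⟨h, _⟩ | ⟨h, _⟩ <;> rw [h]
      · nlinarith [sq_nonneg (v₁ x - pd k v₂ x), sq_nonneg (v₂ x + pd k v₁ x)]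
      · nlinarith [sq_nonneg (v₁ x + pd k v₂ x), sq_nonneg (v₂ x - pd k v₁ x)]
    have h0 := (abs_nonneg (pd k B x)).trans (hB' k x)
    calc 2 * (|pd k B x| * |v₁ x * pd k v₂ x - v₂ x * pd k v₁ x|)
        = |pd k B x| * (2 * |v₁ x * pd k v₂ x - v₂ x * pd k v₁ x|) := by ring
      _ ≤ _ := mul_le_mul (hB' k x) h1 (by positivity) h0
  have key := carleman_pointwise (D₁ := pd i₀ v₁ x) (D₂ := pd i₀ v₂ x)
    (S₁ := -lap v₁ x - p x ^ 2 * v₁ x - A x * v₁ x)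
    (S₂ := -lap v₂ x - p x ^ 2 * v₂ x - A x * v₂ x)
    (T₁ := 2 * p x * pd i₀ v₁ x + q x * v₁ x + B x * v₂ x)
    (T₂ := 2 * p x * pd i₀ v₂ x + q x * v₂ x - B x * v₁ x)
    hK (Nat.cast_nonneg d) hτ (hΨ.conv_pos x) (hΨ.conv_le_one x) (hΨ.le_fst x) (hΨ.fst_le x)
    (hΨ.le_snd x) (hΨ.abs_third_le x) (hΨ.abs_pd_conv_le x) (hAK x) (hA' i₀ x)
    (Finset.sum_nonneg fun k _ => by positivity) hX
  refine key.trans (le_of_eq ?_)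
  rw [Finset.sum_add_distrib]
  ring

set_option maxHeartbeats 1000000 in
/-- The Carleman estimate for `-Δ - (A + i B)` with the weight `e ^ Ψ`. -/
theorem carleman_estimate {i₀ : Fin d} {K τ : ℝ} {Ψ p q r w w' A B : RSpace d → ℝ}
    (hK : 1 ≤ K) (hτ : 1000 * K ^ 3 + 10 * d * K ≤ τ) (hΨ : CarlemanWeight i₀ K τ Ψ p q r w w')
    (hA : ContDiff ℝ ∞ A) (hB : ContDiff ℝ ∞ B) (hAK : ∀ x, |A x| ≤ K)
    (hA' : ∀ k x, |pd k A x| ≤ K * w x) (hB' : ∀ k x, |pd k B x| ≤ K * w x)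
    {u : RSpace d → ℂ} (hu : ContDiff ℝ ∞ u) (hc : HasCompactSupport u) :
    1 / (32 * K ^ 2) * ∫ x, w x * Real.exp (Ψ x) ^ 2 *
        (τ ^ 3 * ‖u x‖ ^ 2 + τ * ∑ k, ‖pd k u x‖ ^ 2)
      ≤ ∫ x, Real.exp (Ψ x) ^ 2 * ‖-lap u x - (A x + B x * Complex.I) * u x‖ ^ 2 := by
  set u₁ : RSpace d → ℝ := fun x => (u x).re with hu₁def
  set u₂ : RSpace d → ℝ := fun x => (u x).im with hu₂def
  have hu₁ : ContDiff ℝ ∞ u₁ := Complex.reCLM.contDiff.comp hu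
  have hu₂ : ContDiff ℝ ∞ u₂ := Complex.imCLM.contDiff.comp hu
  have hc₁ : HasCompactSupport u₁ := hc.comp_left (g := Complex.re) rfl
  have hc₂ : HasCompactSupport u₂ := hc.comp_left (g := Complex.im) rfl
  have pd₁ : ∀ k, pd k u₁ = fun x => (pd k u x).re := fun k => funext fun x =>
    pd_clm_comp Complex.reCLM k (hu.differentiable (by simp) x)
  have pd₂ : ∀ k, pd k u₂ = fun x => (pd k u x).im := fun k => funext fun x =>
    pd_clm_comp Complex.imCLM k (hu.differentiable (by simp) x)
  have lap₁ : ∀ x, lap u₁ x = (lap u x).re := by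
    intro x
    simp only [lap, Complex.re_sum]
    refine Finset.sum_congr rfl fun k _ => ?_
    rw [pd₁]
    exact pd_clm_comp Complex.reCLM k ((hu.pd k).differentiable (by simp) x)
  have lap₂ : ∀ x, lap u₂ x = (lap u x).im := by
    intro x
    simp only [lap, Complex.im_sum]
    refine Finset.sum_congr rfl fun k _ => ?_
    rw [pd₂]
    exact pd_clm_comp Complex.imCLM k ((hu.pd k).differentiable (by simp) x)
  have hΨs := hΨ.smooth
  have hps := hΨ.smooth_fst
  have hE : ContDiff ℝ ∞ fun x => Real.exp (Ψ x) := hΨs.exp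
  have hΨd : Differentiable ℝ Ψ := hΨs.differentiable (by simp)
  have hpdiff : Differentiable ℝ p := hps.differentiable (by simp)
  -- Substituting these into the conjugated estimate cancels the `p`, `q` terms of `S + T` and
  -- leaves `e^Ψ` times the original operator applied to `u`.
  have conj : ∀ {f : RSpace d → ℝ}, ContDiff ℝ ∞ f →
      (∀ k x, pd k (fun x => Real.exp (Ψ x) * f x) x
        = Real.exp (Ψ x) * (pd k f x + if k = i₀ then p x * f x else 0)) ∧
      ∀ x, lap (fun x => Real.exp (Ψ x) * f x) x
        = Real.exp (Ψ x) * (lap f x + 2 * p x * pd i₀ f x + q x * f x + p x ^ 2 * f x) := by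
    intro f hf
    have hfd : Differentiable ℝ f := hf.differentiable (by simp)
    have h1 : ∀ k x, pd k (fun x => Real.exp (Ψ x) * f x) x
        = Real.exp (Ψ x) * (pd k f x + if k = i₀ then p x * f x else 0) := by
      intro k x
      rw [pd_mul k (by fun_prop) (by fun_prop), pd_exp k (by fun_prop), hΨ.pd_eq]
      split_ifs <;> ring
    refine ⟨h1, fun x => ?_⟩
    have h2 : ∀ k, pd k (pd k (fun x => Real.exp (Ψ x) * f x)) x
        = Real.exp (Ψ x) * pd k (pd k f) x + if k = i₀ then
          Real.exp (Ψ x) * (2 * p x * pd i₀ f x + q x * f x + p x ^ 2 * f x) else 0 := by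
      intro k
      have hfk : Differentiable ℝ (pd k f) := (hf.pd k).differentiable (by simp)
      rw [funext (h1 k)]
      by_cases hk : k = i₀
      · subst hk
        simp only [if_true]
        rw [pd_mul k (by fun_prop) (by fun_prop), pd_exp k (by fun_prop),
          pd_add k (by fun_prop) (by fun_prop), pd_mul k (by fun_prop) (by fun_prop), hΨ.pd_eq,
          hΨ.pd_fst, if_pos rfl, if_pos rfl]
        ring
      · simp only [if_neg hk, add_zero]
        rw [pd_mul k (by fun_prop) (by fun_prop), pd_exp k (by fun_prop), hΨ.pd_eq, if_neg hk]
        ring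
    simp only [lap, h2, Finset.sum_add_distrib, ← Finset.mul_sum, Finset.sum_ite_eq',
      Finset.mem_univ, if_true]
    ring
  obtain ⟨g, hg, hle⟩ := carleman_estimate_conjugated hK hτ hΨ hA hB hAK hA' hB'
    (hE.mul hu₁) (hE.mul hu₂) hc₁.mul_left hc₂.mul_left
  have hK0 : 0 < K := by linarith
  have hτ0 : 0 ≤ τ := by
    have : 0 ≤ 1000 * K ^ 3 + 10 * d * K := by positivity
    linarith
  have hw := hΨ.smooth_conv
  have hpk := fun k => hu.pd k
  have hcl : HasCompactSupport fun x =>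
      Real.exp (Ψ x) ^ 2 * ‖-lap u x - (A x + B x * Complex.I) * u x‖ ^ 2 := by
    have h1 : HasCompactSupport fun x => -lap u x - (A x + B x * Complex.I) * u x :=
      hc.lap.neg.sub (hc.mul_left (f := fun x => (A x + B x * Complex.I : ℂ)))
    exact (h1.comp_left (g := fun z => ‖z‖ ^ 2) (by simp)).mul_left
  have hcont : Continuous fun x =>
      Real.exp (Ψ x) ^ 2 * ‖-lap u x - (A x + B x * Complex.I) * u x‖ ^ 2 := by
    have := hu.lap.continuous
    have := hu.continuous
    have := hA.continuous
    have := hB.continuous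
    have := hΨs.continuous
    fun_prop
  have hint := hcont.integrable_of_hasCompactSupport (μ := volume) hcl
  rw [← integral_const_mul]
  have hRHS : ∫ x, Real.exp (Ψ x) ^ 2 * ‖-lap u x - (A x + B x * Complex.I) * u x‖ ^ 2
      = ∫ x, (Real.exp (Ψ x) ^ 2 * ‖-lap u x - (A x + B x * Complex.I) * u x‖ ^ 2 - g x) := by
    rw [integral_sub hint hg.1, hg.2, sub_zero]
  rw [hRHS]
  refine integral_mono_of_nonneg (Eventually.of_forall fun x => ?_) (hint.sub hg.1)
    (Eventually.of_forall fun x => ?_)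
  · have := (hΨ.conv_pos x).le
    positivity
  have hx := hle x
  simp only [(conj hu₁).2, (conj hu₂).2, (conj hu₁).1, (conj hu₂).1, if_true, lap₁, lap₂, pd₁,
    pd₂] at hx
  simp only
  set e := Real.exp (Ψ x)
  have hnorm : ‖-lap u x - (A x + B x * Complex.I) * u x‖ ^ 2
      = (-(lap u x).re - A x * u₁ x + B x * u₂ x) ^ 2
        + (-(lap u x).im - A x * u₂ x - B x * u₁ x) ^ 2 := by
    rw [← Complex.normSq_eq_norm_sq, Complex.normSq_apply]
    simp [hu₁def, hu₂def]
    ring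
  have hnu : ∀ z : ℂ, ‖z‖ ^ 2 = z.re ^ 2 + z.im ^ 2 := fun z => by
    rw [← Complex.normSq_eq_norm_sq, Complex.normSq_apply]; ring
  have hpx : p x ^ 2 ≤ K ^ 2 * τ ^ 2 := by
    have := hΨ.le_fst x
    rw [← mul_pow]
    exact pow_le_pow_left₀ (by linarith) (hΨ.fst_le x) 2
  -- Returning from `∇v` to `∇u` costs `p² |v|²`, of size `K²τ² |v|²`. After multiplication by `τ /
  -- (32K²)` this is a fraction of the available `τ³ |v|²`.
  have hgrad : ∑ k, e ^ 2 * ‖pd k u x‖ ^ 2 ≤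
      2 * ∑ k, ((e * ((pd k u x).re + if k = i₀ then p x * u₁ x else 0)) ^ 2
        + (e * ((pd k u x).im + if k = i₀ then p x * u₂ x else 0)) ^ 2)
      + 2 * (K ^ 2 * τ ^ 2) * (e ^ 2 * (u₁ x ^ 2 + u₂ x ^ 2)) := by
    have hs : ∀ a b : ℝ, a ^ 2 ≤ 2 * (a + b) ^ 2 + 2 * b ^ 2 := fun a b => by
      nlinarith [sq_nonneg (a + 2 * b)]
    have h1 : ∀ k ∈ Finset.univ, e ^ 2 * ‖pd k u x‖ ^ 2 ≤
        2 * ((e * ((pd k u x).re + if k = i₀ then p x * u₁ x else 0)) ^ 2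
        + (e * ((pd k u x).im + if k = i₀ then p x * u₂ x else 0)) ^ 2)
        + if k = i₀ then 2 * p x ^ 2 * (e ^ 2 * (u₁ x ^ 2 + u₂ x ^ 2)) else 0 := by
      intro k _
      rw [hnu]
      have a1 := hs (pd k u x).re (if k = i₀ then p x * u₁ x else 0)
      have a2 := hs (pd k u x).im (if k = i₀ then p x * u₂ x else 0)
      have a3 := mul_le_mul_of_nonneg_left (add_le_add a1 a2) (sq_nonneg e)
      refine a3.trans (le_of_eq ?_)
      split_ifs <;> ring
    refine (Finset.sum_le_sum h1).trans ?_
    rw [Finset.sum_add_distrib, ← Finset.mul_sum, Finset.sum_ite_eq', if_pos (Finset.mem_univ _)]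
    have := mul_le_mul_of_nonneg_right hpx (by positivity : 0 ≤ e ^ 2 * (u₁ x ^ 2 + u₂ x ^ 2))
    linarith
  rw [hnorm]
  set G := ∑ k, ((e * ((pd k u x).re + if k = i₀ then p x * u₁ x else 0)) ^ 2
        + (e * ((pd k u x).im + if k = i₀ then p x * u₂ x else 0)) ^ 2)
  have hx' : w x * (τ / (16 * K ^ 2) * G + τ ^ 3 / 8 * (e ^ 2 * (u₁ x ^ 2 + u₂ x ^ 2)))
      ≤ e ^ 2 * ((-(lap u x).re - A x * u₁ x + B x * u₂ x) ^ 2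
        + (-(lap u x).im - A x * u₂ x - B x * u₁ x) ^ 2) - g x := by
    refine le_trans (le_of_eq ?_) (hx.trans (le_of_eq ?_)) <;> ring
  refine le_trans ?_ hx'
  rw [hnu]
  change 1 / (32 * K ^ 2) * (w x * e ^ 2 * (τ ^ 3 * (u₁ x ^ 2 + u₂ x ^ 2)
    + τ * ∑ k, ‖pd k u x‖ ^ 2)) ≤ _
  rw [← Finset.mul_sum] at hgrad
  set N := e ^ 2 * (u₁ x ^ 2 + u₂ x ^ 2)
  have hN0 : 0 ≤ N := by positivity
  have h1 : 1 / (32 * K ^ 2) * (τ ^ 3 * N + τ * (e ^ 2 * ∑ k, ‖pd k u x‖ ^ 2))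
      ≤ τ / (16 * K ^ 2) * G + τ ^ 3 / 8 * N := by
    have a1 := mul_le_mul_of_nonneg_left hgrad hτ0
    have a2 : 1 / (32 * K ^ 2) * (τ ^ 3 * N + τ * (2 * G + 2 * (K ^ 2 * τ ^ 2) * N))
        = τ / (16 * K ^ 2) * G + (1 / (32 * K ^ 2) + 1 / 16) * (τ ^ 3 * N) := by
      field_simp
      ring
    have a3 : 1 / (32 * K ^ 2) ≤ 1 / 32 := by
      apply one_div_le_one_div_of_le (by norm_num)
      have := one_le_pow₀ hK (n := 2)
      linarith
    have a4 : 0 ≤ τ ^ 3 * N := by positivity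
    calc _ ≤ 1 / (32 * K ^ 2) * (τ ^ 3 * N + τ * (2 * G + 2 * (K ^ 2 * τ ^ 2) * N)) := by
          gcongr
      _ ≤ _ := by
          rw [a2]
          have := mul_le_mul_of_nonneg_right a3 a4
          linarith
  calc _ = w x * (1 / (32 * K ^ 2) * (τ ^ 3 * N + τ * (e ^ 2 * ∑ k, ‖pd k u x‖ ^ 2))) := by
        ring
    _ ≤ _ := mul_le_mul_of_nonneg_left h1 (hΨ.conv_pos x).le

end CarlemanIntegrated

/-! ### The weights -/

section Weights

variable {d : ℕ}

theorem pd_comp_coord (i₀ k : Fin d) {f : ℝ → ℝ} {f' : ℝ} (x : RSpace d)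
    (hf : HasDerivAt f f' (x i₀)) :
    pd k (fun x : RSpace d => f (x i₀)) x = if k = i₀ then f' else 0 := by
  have h1 : HasFDerivAt (fun x : RSpace d => x i₀) (EuclideanSpace.proj i₀ : RSpace d →L[ℝ] ℝ) x :=
    (EuclideanSpace.proj i₀ : RSpace d →L[ℝ] ℝ).hasFDerivAt
  have h2 := (hf.comp_hasFDerivAt x h1).fderiv
  have h3 : pd k (fun x : RSpace d => f (x i₀)) x
      = (f' • (EuclideanSpace.proj i₀ : RSpace d →L[ℝ] ℝ)) (EuclideanSpace.single k 1) := by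
    rw [← h2]; rfl
  rw [h3]
  by_cases hk : k = i₀
  · subst hk; simp
  · simp [hk, Ne.symm hk]

theorem contDiff_comp_coord (i₀ : Fin d) {f : ℝ → ℝ} (hf : ContDiff ℝ ∞ f) :
    ContDiff ℝ ∞ (fun x : RSpace d => f (x i₀)) :=
  hf.comp (EuclideanSpace.proj i₀ : RSpace d →L[ℝ] ℝ).contDiff

theorem contDiff_one_add_sq_rpow (a : ℝ) : ContDiff ℝ ∞ fun s : ℝ => (1 + s ^ 2) ^ (-a) :=
  ContDiff.rpow_const_of_ne (by fun_prop) fun s => by positivity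

theorem hasDerivAt_one_add_sq_rpow (a s : ℝ) :
    HasDerivAt (fun s : ℝ => (1 + s ^ 2) ^ (-a))
      (-a * (2 * s / (1 + s ^ 2)) * (1 + s ^ 2) ^ (-a)) s := by
  have h1 : HasDerivAt (fun s : ℝ => 1 + s ^ 2) (2 * s) s := by
    simpa using (hasDerivAt_pow 2 s).const_add 1
  have hpos : 0 < 1 + s ^ 2 := by positivity
  convert h1.rpow_const (p := -a) (Or.inl hpos.ne') using 1
  rw [Real.rpow_sub_one hpos.ne']
  ring

theorem abs_two_mul_div_le (s : ℝ) : |2 * s / (1 + s ^ 2)| ≤ 1 := by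
  rw [abs_div, abs_of_pos (by positivity : 0 < 1 + s ^ 2), div_le_one (by positivity), abs_le]
  constructor <;> nlinarith [sq_nonneg (s + 1), sq_nonneg (s - 1)]

theorem inv_one_add_sq_le_rpow {a : ℝ} (ha : a ≤ 1) (s : ℝ) :
    1 / (1 + s ^ 2) ≤ (1 + s ^ 2) ^ (-a) := by
  rw [one_div, ← Real.rpow_neg_one]
  exact Real.rpow_le_rpow_of_exponent_le (by nlinarith [sq_nonneg s]) (by linarith)

/-- Integrating the integrable function `w` twice gives a convex `h` whose slope stays bounded and
bounded below. The logarithm multiplies the weight by `(1 + s²)^{-b}` without spoiling convexity,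
since its second and third derivatives are `O(w)` and come without the factor `τ`. -/
theorem exists_convex_weight {a : ℝ} (ha : 1 / 2 < a) (ha1 : a ≤ 1) :
    ∃ (h : ℝ → ℝ) (K₀ : ℝ), 1 ≤ K₀ ∧ ContDiff ℝ ∞ h ∧ (∀ s t, |h s - h t| ≤ K₀ * |s - t|) ∧
      ∀ (d : ℕ) (i₀ : Fin d) (K τ b : ℝ), K₀ ≤ K → 4 ≤ τ → 0 ≤ b → b ≤ 1 →
        ∃ p q r w' : RSpace d → ℝ,
          CarlemanWeight i₀ K τ (fun x => τ * h (x i₀) - b * Real.log (1 + x i₀ ^ 2)) p q r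
            (fun x => (1 + x i₀ ^ 2) ^ (-a)) w' := by
  set w : ℝ → ℝ := fun s => (1 + s ^ 2) ^ (-a) with hw
  have hws : ContDiff ℝ ∞ w := contDiff_one_add_sq_rpow a
  have hwc : Continuous w := hws.continuous
  have hw0 : ∀ s, 0 < w s := fun s => Real.rpow_pos_of_pos (by positivity) _
  have hw1 : ∀ s, w s ≤ 1 := fun s =>
    Real.rpow_le_one_of_one_le_of_nonpos (by nlinarith [sq_nonneg s]) (by linarith)
  have hwint : Integrable w := by
    have := integrable_rpow_neg_one_add_norm_sq (E := ℝ) (μ := volume) (r := 2 * a)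
      (by simp; linarith)
    refine this.congr (Eventually.of_forall fun s => ?_)
    simp only [hw, Real.norm_eq_abs, sq_abs]
    congr 1; ring
  set M := ∫ s, w s with hM
  have hM0 : 0 ≤ M := integral_nonneg fun s => (hw0 s).le
  have hbd : ∀ s : ℝ, |∫ t in (0 : ℝ)..s, w t| ≤ M := by
    intro s
    have h1 := intervalIntegral.norm_integral_le_integral_norm_uIoc (f := w) (μ := volume)
      (a := 0) (b := s)
    rw [Real.norm_eq_abs] at h1
    refine h1.trans ?_
    have : ∀ t, ‖w t‖ = w t := fun t => Real.norm_of_nonneg (hw0 t).le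
    simp only [this]
    exact setIntegral_le_integral hwint (Eventually.of_forall fun t => (hw0 t).le)
  -- The constant `M + 1` outweighs the integral, which is at least `-M`, so the slope lies in `[1,
  -- 2M + 1]`.
  set h₁ : ℝ → ℝ := fun s => M + 1 + ∫ t in (0 : ℝ)..s, w t with hh₁
  have hd₁ : ∀ s, HasDerivAt h₁ (w s) s := fun s =>
    ((hwc.integral_hasStrictDerivAt 0 s).hasDerivAt).const_add (M + 1)
  have smooth_of : ∀ f g : ℝ → ℝ, (∀ s, HasDerivAt f (g s) s) → ContDiff ℝ ∞ g →
      ContDiff ℝ ∞ f := by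
    intro f g hfg hg
    rw [contDiff_infty_iff_deriv]
    refine ⟨fun s => (hfg s).differentiableAt, ?_⟩
    rwa [show deriv f = g from funext fun s => (hfg s).deriv]
  have hs₁ : ContDiff ℝ ∞ h₁ := smooth_of _ _ hd₁ hws
  have hlo : ∀ s, 1 ≤ h₁ s := fun s => by
    have := (abs_le.1 (hbd s)).1
    simp only [hh₁]; linarith
  have hup : ∀ s, h₁ s ≤ 2 * M + 1 := fun s => by
    have := (abs_le.1 (hbd s)).2
    simp only [hh₁]; linarith
  set h : ℝ → ℝ := fun s => ∫ t in (0 : ℝ)..s, h₁ t with hh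
  have hd : ∀ s, HasDerivAt h (h₁ s) s := fun s =>
    (hs₁.continuous.integral_hasStrictDerivAt 0 s).hasDerivAt
  have hs : ContDiff ℝ ∞ h := smooth_of _ _ hd hs₁
  -- The slope needs `2M + 1`, with room for the logarithmic correction; the `8` also covers the
  -- third derivative.
  refine ⟨h, 2 * M + 8, by linarith, hs, ?_, ?_⟩
  · intro s t
    have := Convex.norm_image_sub_le_of_norm_hasDerivWithin_le (f := h) (f' := h₁)
      (s := Set.univ) (C := 2 * M + 8) (fun x _ => (hd x).hasDerivWithinAt)
      (fun x _ => by
        rw [Real.norm_of_nonneg (by linarith [hlo x])]; linarith [hup x])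
      convex_univ (Set.mem_univ t) (Set.mem_univ s)
    simpa [Real.norm_eq_abs] using this
  intro d i₀ K τ b hK hτ hb hb1
  -- The first three derivatives of `log (1 + s²)`. The last two are at most `2 / (1 + s²)` and `6 /
  -- (1 + s²)`, hence `O(w)` because `a ≤ 1`.
  set l₁ : ℝ → ℝ := fun s => 2 * s / (1 + s ^ 2) with hl₁
  set l₂ : ℝ → ℝ := fun s => 2 * (1 - s ^ 2) / (1 + s ^ 2) ^ 2 with hl₂
  set l₃ : ℝ → ℝ := fun s => 4 * s * (s ^ 2 - 3) / (1 + s ^ 2) ^ 3 with hl₃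
  have hq' : ∀ s : ℝ, HasDerivAt (fun s : ℝ => 1 + s ^ 2) (2 * s) s := fun s => by
    simpa using (hasDerivAt_pow 2 s).const_add 1
  have hne : ∀ s : ℝ, (1 + s ^ 2) ≠ 0 := fun s => by positivity
  have dl : ∀ s, HasDerivAt (fun s : ℝ => Real.log (1 + s ^ 2)) (l₁ s) s := fun s =>
    (hq' s).log (hne s)
  have dl₁ : ∀ s, HasDerivAt l₁ (l₂ s) s := fun s => by
    have h := ((hasDerivAt_id s).const_mul 2).div (hq' s) (hne s)
    refine h.congr_deriv ?_
    simp only [hl₂, id]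
    congr 1; ring
  have dl₂ : ∀ s, HasDerivAt l₂ (l₃ s) s := fun s => by
    have h := ((((hasDerivAt_pow 2 s).const_sub 1).const_mul 2).div ((hq' s).pow 2)
      (pow_ne_zero 2 (hne s)))
    refine h.congr_deriv ?_
    simp only [hl₃]
    have := hne s
    simp only [Pi.pow_apply]
    field_simp
    push_cast
    ring
  have sl : ContDiff ℝ ∞ fun s : ℝ => Real.log (1 + s ^ 2) :=
    ContDiff.log (by fun_prop) hne
  have sl₁ : ContDiff ℝ ∞ l₁ := ContDiff.div (by fun_prop) (by fun_prop) hne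
  have sl₂ : ContDiff ℝ ∞ l₂ :=
    ContDiff.div (by fun_prop) (by fun_prop) fun s => pow_ne_zero 2 (hne s)
  have bl₁ : ∀ s, |l₁ s| ≤ 1 := abs_two_mul_div_le
  have hiw : ∀ s, 1 / (1 + s ^ 2) ≤ w s := fun s => inv_one_add_sq_le_rpow ha1 s
  have bl₂ : ∀ s, |l₂ s| ≤ 2 * w s := fun s => by
    have h1 : |l₂ s| ≤ 2 * (1 / (1 + s ^ 2)) := by
      simp only [hl₂]
      rw [abs_div, abs_of_pos (by positivity : 0 < (1 + s ^ 2) ^ 2), div_le_iff₀ (by positivity)]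
      have : 2 * (1 / (1 + s ^ 2)) * (1 + s ^ 2) ^ 2 = 2 * (1 + s ^ 2) := by
        have := hne s
        field_simp
      rw [this, abs_le]
      constructor <;> nlinarith [sq_nonneg s]
    linarith [hiw s]
  have bl₃ : ∀ s, |l₃ s| ≤ 6 * w s := fun s => by
    have h1 : |l₃ s| ≤ 6 * (1 / (1 + s ^ 2)) := by
      have e : l₃ s = (2 * s / (1 + s ^ 2)) * (2 * (s ^ 2 - 3) / (1 + s ^ 2)) * (1 / (1 + s ^ 2)) := by
        simp only [hl₃]
        have := hne s
        field_simp
        ring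
      rw [e, abs_mul, abs_mul, abs_of_pos (by positivity : 0 < 1 / (1 + s ^ 2))]
      have h2 : |2 * (s ^ 2 - 3) / (1 + s ^ 2)| ≤ 6 := by
        rw [abs_div, abs_of_pos (by positivity : 0 < 1 + s ^ 2), div_le_iff₀ (by positivity),
          abs_le]
        constructor <;> nlinarith [sq_nonneg s]
      have h3 := abs_two_mul_div_le s
      have : |2 * s / (1 + s ^ 2)| * |2 * (s ^ 2 - 3) / (1 + s ^ 2)| ≤ 1 * 6 := by gcongr
      have h4 : 0 ≤ 1 / (1 + s ^ 2) := by positivity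
      nlinarith
    linarith [hiw s]
  have hbl : ∀ {y c : ℝ}, |y| ≤ c → |b * y| ≤ c := by
    intro y c hy
    rw [abs_mul, abs_of_nonneg hb]
    nlinarith [abs_nonneg y]
  refine ⟨fun x => τ * h₁ (x i₀) - b * l₁ (x i₀), fun x => τ * w (x i₀) - b * l₂ (x i₀),
    fun x => τ * (-a * (2 * x i₀ / (1 + x i₀ ^ 2)) * w (x i₀)) - b * l₃ (x i₀),
    fun x => -a * (2 * x i₀ / (1 + x i₀ ^ 2)) * w (x i₀), ?_⟩
  have dw := hasDerivAt_one_add_sq_rpow a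
  have bdw : ∀ s, |-a * (2 * s / (1 + s ^ 2)) * w s| ≤ w s := fun s => by
    rw [abs_mul, abs_mul, abs_neg, abs_of_pos (by linarith : 0 < a), abs_of_pos (hw0 s)]
    have : a * |2 * s / (1 + s ^ 2)| ≤ 1 * 1 := by
      have := abs_two_mul_div_le s
      gcongr
    nlinarith [hw0 s]
  exact
    { smooth := contDiff_comp_coord i₀ ((contDiff_const.mul hs).sub (contDiff_const.mul sl))
      smooth_fst := contDiff_comp_coord i₀ ((contDiff_const.mul hs₁).sub (contDiff_const.mul sl₁))
      smooth_snd := contDiff_comp_coord i₀ ((contDiff_const.mul hws).sub (contDiff_const.mul sl₂))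
      smooth_conv := contDiff_comp_coord i₀ hws
      pd_eq := fun k x => pd_comp_coord i₀ k x (((hd _).const_mul τ).sub ((dl _).const_mul b))
      pd_fst := fun k x => pd_comp_coord i₀ k x (((hd₁ _).const_mul τ).sub ((dl₁ _).const_mul b))
      pd_snd := fun k x => pd_comp_coord i₀ k x (((dw _).const_mul τ).sub ((dl₂ _).const_mul b))
      pd_conv := fun k x => pd_comp_coord i₀ k x (dw _)
      conv_pos := fun x => hw0 _
      conv_le_one := fun x => hw1 _
      le_fst := fun x => by
        have h1 := (abs_le.1 (hbl (bl₁ (x i₀)))).2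
        have h2 := mul_le_mul_of_nonneg_left (hlo (x i₀)) (by linarith : 0 ≤ τ)
        simp only; linarith
      fst_le := fun x => by
        have h1 := (abs_le.1 (hbl (bl₁ (x i₀)))).1
        have h2 := mul_le_mul_of_nonneg_left (hup (x i₀)) (by linarith : 0 ≤ τ)
        have h3 := mul_le_mul_of_nonneg_right hK (by linarith : 0 ≤ τ)
        simp only; linarith
      le_snd := fun x => by
        have h1 := (abs_le.1 (hbl (bl₂ (x i₀)))).2
        have h2 := mul_le_mul_of_nonneg_right hτ (hw0 (x i₀)).le
        simp only [hw] at *; linarith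
      abs_third_le := fun x => by
        have h1 := hbl (bl₃ (x i₀))
        have h2 := mul_le_mul_of_nonneg_left (bdw (x i₀)) (by linarith : 0 ≤ τ)
        have h3 : 8 * τ * w (x i₀) ≤ K * τ * w (x i₀) := by
          have := hw0 (x i₀)
          gcongr; linarith
        have h4 := mul_le_mul_of_nonneg_right hτ (hw0 (x i₀)).le
        have h5 := hw0 (x i₀)
        refine (abs_sub _ _).trans ?_
        rw [abs_mul, abs_of_nonneg (by linarith : 0 ≤ τ)]
        simp only [hw] at *; linarith
      abs_pd_conv_le := fun x => by
        have h1 := bdw (x i₀)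
        have h5 := hw0 (x i₀)
        refine h1.trans ?_
        exact le_mul_of_one_le_left h5.le (by linarith) }

end Weights

/-! ### Carleman inequalities for the Laplacian and the bi-Laplacian -/

section CarlemanPowers

variable {d : ℕ}

/-- The negative Laplacian. -/
def negLap {F : Type*} [NormedAddCommGroup F] [NormedSpace ℝ F] (f : RSpace d → F)
    (x : RSpace d) : F := -lap f x

theorem carleman_estimate_complex {i₀ : Fin d} {K τ : ℝ} {Ψ p q r w w' : RSpace d → ℝ}
    {W : RSpace d → ℂ}
    (hK : 1 ≤ K) (hτ : 1000 * K ^ 3 + 10 * d * K ≤ τ) (hΨ : CarlemanWeight i₀ K τ Ψ p q r w w')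
    (hW : ContDiff ℝ ∞ W) (hWK : ∀ x, ‖W x‖ ≤ K) (hW' : ∀ k x, ‖pd k W x‖ ≤ K * w x)
    {u : RSpace d → ℂ} (hu : ContDiff ℝ ∞ u) (hc : HasCompactSupport u) :
    1 / (32 * K ^ 2) * ∫ x, w x * Real.exp (Ψ x) ^ 2 *
        (τ ^ 3 * ‖u x‖ ^ 2 + τ * ∑ k, ‖pd k u x‖ ^ 2)
      ≤ ∫ x, Real.exp (Ψ x) ^ 2 * ‖-lap u x - W x * u x‖ ^ 2 := by
  have hd : Differentiable ℝ W := hW.differentiable (by simp)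
  have h := carleman_estimate (A := fun x => (W x).re) (B := fun x => (W x).im) hK hτ hΨ
    (Complex.reCLM.contDiff.comp hW) (Complex.imCLM.contDiff.comp hW)
    (fun x => (Complex.abs_re_le_norm _).trans (hWK x))
    (fun k x => by
      rw [show pd k (fun x => (W x).re) x = (pd k W x).re from pd_clm_comp Complex.reCLM k (hd x)]
      exact (Complex.abs_re_le_norm _).trans (hW' k x))
    (fun k x => by
      rw [show pd k (fun x => (W x).im) x = (pd k W x).im from pd_clm_comp Complex.imCLM k (hd x)]
      exact (Complex.abs_im_le_norm _).trans (hW' k x)) hu hc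
  simpa only [Complex.re_add_im] using h

theorem lap_mul {f g : RSpace d → ℂ} (hf : ContDiff ℝ ∞ f) (hg : ContDiff ℝ ∞ g) (x : RSpace d) :
    lap (fun x => f x * g x) x = f x * lap g x + g x * lap f x + 2 * ∑ k, pd k f x * pd k g x := by
  have hf' : Differentiable ℝ f := hf.differentiable (by simp)
  have hg' : Differentiable ℝ g := hg.differentiable (by simp)
  have h : ∀ k, pd k (pd k fun x => f x * g x) x
      = f x * pd k (pd k g) x + g x * pd k (pd k f) x + 2 * (pd k f x * pd k g x) := by
    intro k
    have h1 : Differentiable ℝ (pd k f) := (hf.pd k).differentiable (by simp)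
    have h2 : Differentiable ℝ (pd k g) := (hg.pd k).differentiable (by simp)
    rw [show pd k (fun x => f x * g x) = _ from funext fun y => pd_mul k (hf' y) (hg' y), pd_add k (by fun_prop) (by fun_prop),
      pd_mul k (by fun_prop) (by fun_prop), pd_mul k (by fun_prop) (by fun_prop)]
    ring
  simp only [lap, h, Finset.sum_add_distrib, Finset.mul_sum]

theorem lap_add {F : Type*} [NormedAddCommGroup F] [NormedSpace ℝ F] {f g : RSpace d → F}
    (hf : ContDiff ℝ ∞ f) (hg : ContDiff ℝ ∞ g) (x : RSpace d) :
    lap (fun x => f x + g x) x = lap f x + lap g x := by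
  have hf' : Differentiable ℝ f := hf.differentiable (by simp)
  have hg' : Differentiable ℝ g := hg.differentiable (by simp)
  simp only [lap, ← Finset.sum_add_distrib]
  refine Finset.sum_congr rfl fun k _ => ?_
  rw [show pd k (fun x => f x + g x) = _ from funext fun y => pd_add k (hf' y) (hg' y),
    pd_add k ((hf.pd k).differentiable (by simp) x) ((hg.pd k).differentiable (by simp) x)]

theorem lap_neg {F : Type*} [NormedAddCommGroup F] [NormedSpace ℝ F] (f : RSpace d → F)
    (x : RSpace d) : lap (fun x => - f x) x = - lap f x := by
  simp only [lap, ← Finset.sum_neg_distrib]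
  refine Finset.sum_congr rfl fun k _ => ?_
  rw [show pd k (fun x => -f x) = _ from funext fun y => pd_neg (f := f) (x := y) k, pd_neg]

theorem ContDiff.negLap {F : Type*} [NormedAddCommGroup F] [NormedSpace ℝ F] {f : RSpace d → F}
    (hf : ContDiff ℝ ∞ f) : ContDiff ℝ ∞ (negLap f) := hf.lap.neg

theorem HasCompactSupport.negLap {F : Type*} [NormedAddCommGroup F] [NormedSpace ℝ F]
    {f : RSpace d → F} (hf : HasCompactSupport f) : HasCompactSupport (negLap f) := hf.lap.neg

/-- `(-Δ - W) (-Δ + W) = Δ² - W² - (ΔW) - 2 ∇W · ∇`. -/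
theorem negLap_factorization {W u : RSpace d → ℂ} (hW : ContDiff ℝ ∞ W) (hu : ContDiff ℝ ∞ u)
    (x : RSpace d) :
    -lap (fun x => -lap u x + W x * u x) x - W x * (-lap u x + W x * u x)
      = (lap (lap u) x - W x ^ 2 * u x)
        - (lap W x * u x + 2 * ∑ k, pd k W x * pd k u x) := by
  rw [lap_add hu.lap.neg (hW.mul hu), lap_neg, lap_mul hW hu]
  ring

/-- The weighted estimate for `(-Δ)^j - Z` on test functions. -/
def CarlemanInequality (j : ℕ) (C τ : ℝ) (m e : RSpace d → ℝ) (Z : RSpace d → ℂ) : Prop :=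
  ∀ u : RSpace d → ℂ, ContDiff ℝ ∞ u → HasCompactSupport u →
    τ * ∫ x, m x ^ j * e x ^ 2 * ‖u x‖ ^ 2
      ≤ C * ∫ x, e x ^ 2 * ‖(negLap^[j] u) x - Z x * u x‖ ^ 2

/-- The second-order estimate with the gradient term dropped and `τ³` weakened to `τ`, to match the
form shared with `j = 2`. -/
theorem carlemanInequality_one {a : ℝ} (i₀ : Fin d)
    {h : ℝ → ℝ} {K₀ : ℝ}
    (hh : ∀ K τ b : ℝ, K₀ ≤ K → 4 ≤ τ → 0 ≤ b → b ≤ 1 → ∃ p q r w' : RSpace d → ℝ,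
      CarlemanWeight i₀ K τ (fun x => τ * h (x i₀) - b * Real.log (1 + x i₀ ^ 2)) p q r
        (fun x => (1 + x i₀ ^ 2) ^ (-a)) w')
    {W : RSpace d → ℂ} (hW : ContDiff ℝ ∞ W) {K₁ : ℝ} (hWK : ∀ x, ‖W x‖ ≤ K₁)
    (hW' : ∀ k x, ‖pd k W x‖ ≤ K₁ * (1 + x i₀ ^ 2) ^ (-a)) :
    ∃ C τ₀ : ℝ, 0 ≤ C ∧ ∀ τ, τ₀ ≤ τ → CarlemanInequality 1 C τ (fun x => (1 + x i₀ ^ 2) ^ (-a))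
      (fun x => Real.exp (τ * h (x i₀))) W := by
  set K := max 1 (max K₀ K₁) with hKdef
  have hK : 1 ≤ K := le_max_left _ _
  have hK₀ : K₀ ≤ K := (le_max_left _ _).trans (le_max_right _ _)
  have hK₁ : K₁ ≤ K := (le_max_right _ _).trans (le_max_right _ _)
  have hw0 : ∀ x : RSpace d, 0 < (1 + x i₀ ^ 2) ^ (-a) := fun x =>
    Real.rpow_pos_of_pos (by positivity) _
  refine ⟨32 * K ^ 2, 1000 * K ^ 3 + 10 * d * K, by positivity, fun τ hτ u hu hc => ?_⟩
  have hτ1 : 1000 ≤ τ := by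
    have h1 := one_le_pow₀ hK (n := 3)
    have h2 : 0 ≤ 10 * d * K := by positivity
    linarith
  obtain ⟨p, q, r, w', hΨ⟩ := hh K τ 0 hK₀ (by linarith) le_rfl zero_le_one
  simp only [zero_mul, sub_zero] at hΨ
  have key := carleman_estimate_complex hK hτ hΨ hW (fun x => (hWK x).trans hK₁)
    (fun k x => (hW' k x).trans (mul_le_mul_of_nonneg_right hK₁ (hw0 x).le)) hu hc
  rw [← div_le_iff₀' (by positivity)]
  refine le_trans ?_ key
  rw [div_eq_inv_mul, ← one_div, ← integral_const_mul]
  refine mul_le_mul_of_nonneg_left ?_ (by positivity)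
  have hwc : Continuous fun x : RSpace d => (1 + x i₀ ^ 2) ^ (-a) := hΨ.smooth_conv.continuous
  have hΨc : Continuous fun x : RSpace d => τ * h (x i₀) := hΨ.smooth.continuous
  have huc := hu.continuous
  have hukc := fun k => (hu.pd k).continuous
  refine integral_mono_of_nonneg (Eventually.of_forall fun x => ?_) ?_
    (Eventually.of_forall fun x => ?_)
  · have := (hw0 x).le
    simp only [pow_one]
    positivity
  · refine Continuous.integrable_of_hasCompactSupport (by fun_prop) ?_
    refine hc.mono' fun x hx => ?_
    by_contra hn
    have hk : ∀ k, pd k u x = 0 := fun k =>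
      image_eq_zero_of_notMem_tsupport fun h' => hn (tsupport_fderiv_apply_subset ℝ _ h')
    exact hx (by simp [hk, image_eq_zero_of_notMem_tsupport hn])
  · have h0 := (hw0 x).le
    have h1 : τ ≤ τ ^ 3 := le_self_pow₀ (by linarith) three_ne_zero
    have h2 : 0 ≤ τ * ∑ k, ‖pd k u x‖ ^ 2 := by
      have : 0 ≤ τ := by linarith
      positivity
    have h3 : τ * ‖u x‖ ^ 2 ≤ τ ^ 3 * ‖u x‖ ^ 2 + τ * ∑ k, ‖pd k u x‖ ^ 2 := by
      have := mul_le_mul_of_nonneg_right h1 (sq_nonneg ‖u x‖)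
      linarith
    have h4 := mul_le_mul_of_nonneg_left h3
      (by positivity : 0 ≤ (1 + x i₀ ^ 2) ^ (-a) * Real.exp (τ * h (x i₀)) ^ 2)
    simp only [pow_one]
    linarith

/-- This bounds the remainder of the factorization. The factor `w²` is the essential point: it is
exactly the weight under which two successive Carleman estimates control `u` and `∇u`. -/
theorem norm_sq_error_le {K w : ℝ} {L z : ℂ} {W' y : Fin d → ℂ}
    (hL : ‖L‖ ≤ K * w) (hW' : ∀ k, ‖W' k‖ ≤ K * w) :
    ‖L * z + 2 * ∑ k, W' k * y k‖ ^ 2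
      ≤ 8 * (d + 1) * K ^ 2 * (w ^ 2 * (‖z‖ ^ 2 + ∑ k, ‖y k‖ ^ 2)) := by
  have h1 : ‖L * z + 2 * ∑ k, W' k * y k‖ ≤ K * w * (‖z‖ + 2 * ∑ k, ‖y k‖) := by
    refine (norm_add_le _ _).trans ?_
    rw [norm_mul, norm_mul, mul_add]
    refine add_le_add (mul_le_mul_of_nonneg_right hL (norm_nonneg _)) ?_
    rw [show K * w * (2 * ∑ k, ‖y k‖) = 2 * ∑ k, K * w * ‖y k‖ by rw [← Finset.mul_sum]; ring]
    simp only [Complex.norm_ofNat]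
    gcongr
    refine (norm_sum_le _ _).trans (Finset.sum_le_sum fun k _ => ?_)
    rw [norm_mul]
    exact mul_le_mul_of_nonneg_right (hW' k) (norm_nonneg _)
  have h2 : (∑ k, ‖y k‖) ^ 2 ≤ d * ∑ k, ‖y k‖ ^ 2 := by
    simpa using sq_sum_le_card_mul_sum_sq (s := Finset.univ) (f := fun k => ‖y k‖)
  have hS : 0 ≤ ∑ k, ‖y k‖ ^ 2 := by positivity
  have h3 : (‖z‖ + 2 * ∑ k, ‖y k‖) ^ 2 ≤ 8 * (d + 1) * (‖z‖ ^ 2 + ∑ k, ‖y k‖ ^ 2) := by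
    have hd0 : (0 : ℝ) ≤ d := Nat.cast_nonneg d
    have : (‖z‖ + 2 * ∑ k, ‖y k‖) ^ 2 ≤ 2 * ‖z‖ ^ 2 + 8 * (∑ k, ‖y k‖) ^ 2 := by
      nlinarith [sq_nonneg (‖z‖ - 2 * ∑ k, ‖y k‖)]
    nlinarith [mul_nonneg hd0 (sq_nonneg ‖z‖), sq_nonneg ‖z‖]
  calc _ ≤ (K * w * (‖z‖ + 2 * ∑ k, ‖y k‖)) ^ 2 := by gcongr
    _ = K ^ 2 * w ^ 2 * (‖z‖ + 2 * ∑ k, ‖y k‖) ^ 2 := by ring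
    _ ≤ K ^ 2 * w ^ 2 * (8 * (d + 1) * (‖z‖ ^ 2 + ∑ k, ‖y k‖ ^ 2)) := by gcongr
    _ = _ := by ring

/-- The estimate for `-Δ - W` is applied to `g = (-Δ + W) u`, and the estimate for `-Δ + W` to `u`
with the weight multiplied by `w^{1/2}`, so that its right side is the left side of the first.
Together they gain `τ⁴` in front of the `w²`-weighted norm of `u` and `∇u`, which absorbs the
factorization error. -/
theorem carlemanInequality_two {a : ℝ} (ha : 1 / 2 < a) (ha1 : a ≤ 1) (i₀ : Fin d)
    {h : ℝ → ℝ} {K₀ : ℝ}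
    (hh : ∀ K τ b : ℝ, K₀ ≤ K → 4 ≤ τ → 0 ≤ b → b ≤ 1 → ∃ p q r w' : RSpace d → ℝ,
      CarlemanWeight i₀ K τ (fun x => τ * h (x i₀) - b * Real.log (1 + x i₀ ^ 2)) p q r
        (fun x => (1 + x i₀ ^ 2) ^ (-a)) w')
    {W : RSpace d → ℂ} (hW : ContDiff ℝ ∞ W) {K₁ : ℝ} (hWK : ∀ x, ‖W x‖ ≤ K₁)
    (hW' : ∀ k x, ‖pd k W x‖ ≤ K₁ * (1 + x i₀ ^ 2) ^ (-a))
    (hW'' : ∀ x, ‖lap W x‖ ≤ K₁ * (1 + x i₀ ^ 2) ^ (-a)) :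
    ∃ C τ₀ : ℝ, 0 ≤ C ∧ ∀ τ, τ₀ ≤ τ → CarlemanInequality 2 C τ (fun x => (1 + x i₀ ^ 2) ^ (-a))
      (fun x => Real.exp (τ * h (x i₀))) (fun x => W x ^ 2) := by
  set K := max 1 (max K₀ K₁) with hKdef
  have hK : 1 ≤ K := le_max_left _ _
  have hK₀ : K₀ ≤ K := (le_max_left _ _).trans (le_max_right _ _)
  have hK₁ : K₁ ≤ K := (le_max_right _ _).trans (le_max_right _ _)
  set w : RSpace d → ℝ := fun x => (1 + x i₀ ^ 2) ^ (-a) with hw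
  have hw0 : ∀ x : RSpace d, 0 < w x := fun x => Real.rpow_pos_of_pos (by positivity) _
  set c := 1 / (32 * K ^ 2) with hc_def
  have hc0 : 0 < c := by positivity
  -- The last summand of the threshold lets the error `16(d+1)K² J` take at most half of `c²τ⁴ J`.
  refine ⟨4 / c ^ 2, 1000 * K ^ 3 + 10 * d * K + 32 * (d + 1) * K ^ 2 / c ^ 2, by positivity,
    fun τ hτ u hu hcs => ?_⟩
  have hpos1 : 0 ≤ 32 * (d + 1) * K ^ 2 / c ^ 2 := by positivity
  have hpos2 : 0 ≤ 10 * d * K := by positivity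
  have hτ1 : 1000 ≤ τ := by
    have h1 := one_le_pow₀ hK (n := 3)
    linarith
  have hτ2 : 1000 * K ^ 3 + 10 * d * K ≤ τ := by linarith
  have hτ3 : 32 * (d + 1) * K ^ 2 ≤ c ^ 2 * τ := by
    rw [← div_le_iff₀' (by positivity)]
    have : 0 ≤ 1000 * K ^ 3 + 10 * d * K := by positivity
    linarith
  obtain ⟨p, q, r, w', hΨ⟩ := hh K τ 0 hK₀ (by linarith) le_rfl zero_le_one
  simp only [zero_mul, sub_zero] at hΨ
  -- `b = a/2` multiplies the weight by `w^{1/2}`, hence its square by `w`.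
  obtain ⟨p₂, q₂, r₂, w₂', hΨ₂⟩ := hh K τ (a / 2) hK₀ (by linarith) (by linarith) (by linarith)
  have hWK' : ∀ x, ‖W x‖ ≤ K := fun x => (hWK x).trans hK₁
  have hWd' : ∀ k x, ‖pd k W x‖ ≤ K * w x := fun k x =>
    (hW' k x).trans (mul_le_mul_of_nonneg_right hK₁ (hw0 x).le)
  set g : RSpace d → ℂ := fun x => -lap u x + W x * u x with hg
  have hgs : ContDiff ℝ ∞ g := hu.lap.neg.add (hW.mul hu)
  have hgc : HasCompactSupport g := hcs.lap.neg.add hcs.mul_left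
  have key₁ := carleman_estimate_complex hK hτ2 hΨ hW hWK' hWd' hgs hgc
  have key₂ := carleman_estimate_complex (W := fun x => -W x) hK hτ2 hΨ₂ hW.neg
    (fun x => by simpa using hWK' x) (fun k x => by rw [pd_neg, norm_neg]; exact hWd' k x) hu hcs
  set e : RSpace d → ℝ := fun x => Real.exp (τ * h (x i₀)) with he
  have hexp : ∀ x : RSpace d,
      Real.exp (τ * h (x i₀) - a / 2 * Real.log (1 + x i₀ ^ 2)) ^ 2 = w x * e x ^ 2 := by
    intro x
    simp only [hw, he]
    rw [Real.rpow_def_of_pos (by positivity), ← Real.exp_nat_mul, ← Real.exp_nat_mul,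
      ← Real.exp_add]
    congr 1
    push_cast
    ring
  simp only [hexp] at key₂
  have hwc : Continuous w := hΨ.smooth_conv.continuous
  have hτhc : Continuous fun x : RSpace d => τ * h (x i₀) := hΨ.smooth.continuous
  have hec : Continuous e := Real.continuous_exp.comp hτhc
  have huc := hu.continuous
  have hukc := fun k => (hu.pd k).continuous
  have hgcont := hgs.continuous
  have hWc := hW.continuous
  have hllc := hu.lap.lap.continuous
  have hint : ∀ f : RSpace d → ℝ, Continuous f →
      (∀ x, x ∉ tsupport u → f x = 0) → Integrable f := by
    intro f hf hf0
    refine hf.integrable_of_hasCompactSupport (hcs.mono' fun x hx => ?_)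
    by_contra hn
    exact hx (hf0 x hn)
  have hk0 : ∀ x, x ∉ tsupport u → ∀ k, pd k u x = 0 := fun x hx k =>
    image_eq_zero_of_notMem_tsupport fun h' => hx (tsupport_fderiv_apply_subset ℝ _ h')
  have hu0 : ∀ x, x ∉ tsupport u → u x = 0 := fun x hx => image_eq_zero_of_notMem_tsupport hx
  have hkk0 : ∀ x, x ∉ tsupport u → lap u x = 0 := fun x hx =>
    Finset.sum_eq_zero fun k _ => image_eq_zero_of_notMem_tsupport fun h' => hx
      (tsupport_fderiv_apply_subset ℝ _ (tsupport_fderiv_apply_subset ℝ _ h'))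
  have hlapsub : tsupport (lap u) ⊆ tsupport u :=
    closure_minimal (fun x hx => by by_contra hn; exact hx (hkk0 x hn)) (isClosed_tsupport u)
  have hll0 : ∀ x, x ∉ tsupport u → lap (lap u) x = 0 := fun x hx =>
    Finset.sum_eq_zero fun k _ => image_eq_zero_of_notMem_tsupport fun h' => hx
      (hlapsub (tsupport_fderiv_apply_subset ℝ _ (tsupport_fderiv_apply_subset ℝ _ h')))
  set J := ∫ x, w x ^ 2 * e x ^ 2 * (‖u x‖ ^ 2 + ∑ k, ‖pd k u x‖ ^ 2) with hJ
  set R := ∫ x, e x ^ 2 * ‖lap (lap u) x - W x ^ 2 * u x‖ ^ 2 with hR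
  set I := ∫ x, w x * e x ^ 2 * ‖g x‖ ^ 2 with hI
  have hintJ : Integrable fun x => w x ^ 2 * e x ^ 2 * (‖u x‖ ^ 2 + ∑ k, ‖pd k u x‖ ^ 2) :=
    hint _ (by fun_prop) fun x hx => by simp [hk0 x hx, hu0 x hx]
  have hintR : Integrable fun x => e x ^ 2 * ‖lap (lap u) x - W x ^ 2 * u x‖ ^ 2 :=
    hint _ (by fun_prop) fun x hx => by simp [hll0 x hx, hu0 x hx]
  have hτ0 : 0 ≤ τ := by linarith
  have s₂ : c * τ * J ≤ I := by
    refine le_trans ?_ (key₂.trans (le_of_eq ?_))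
    · rw [mul_assoc, hJ, ← integral_const_mul]
      refine mul_le_mul_of_nonneg_left ?_ hc0.le
      refine integral_mono (hintJ.const_mul τ) (hint _ (by fun_prop) fun x hx => by
        simp [hk0 x hx, hu0 x hx]) fun x => ?_
      have h1 : τ ≤ τ ^ 3 := le_self_pow₀ (by linarith) three_ne_zero
      have h3 : τ * (‖u x‖ ^ 2 + ∑ k, ‖pd k u x‖ ^ 2)
          ≤ τ ^ 3 * ‖u x‖ ^ 2 + τ * ∑ k, ‖pd k u x‖ ^ 2 := by
        have := mul_le_mul_of_nonneg_right h1 (sq_nonneg ‖u x‖)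
        linarith
      have h4 := mul_le_mul_of_nonneg_left h3 (by positivity : 0 ≤ w x ^ 2 * e x ^ 2)
      simp only
      linarith
    · refine integral_congr_ae (Eventually.of_forall fun x => ?_)
      simp [hg]
  have s₁ : c * τ ^ 3 * I ≤ 2 * R + 16 * (d + 1) * K ^ 2 * J := by
    have hl : c * τ ^ 3 * I ≤ ∫ x, e x ^ 2 * ‖-lap g x - W x * g x‖ ^ 2 := by
      refine le_trans ?_ key₁
      rw [mul_assoc, hI, ← integral_const_mul]
      refine mul_le_mul_of_nonneg_left ?_ hc0.le
      have hgk := fun k => (hgs.pd k).continuous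
      have hgt : tsupport g ⊆ tsupport u :=
        closure_minimal (fun x hx => by
          by_contra hn
          exact hx (by simp [hg, hkk0 x hn, hu0 x hn])) (isClosed_tsupport u)
      have hg0 : ∀ x, x ∉ tsupport u → g x = 0 := fun x hx =>
        image_eq_zero_of_notMem_tsupport fun h' => hx (hgt h')
      have hgk0 : ∀ x, x ∉ tsupport u → ∀ k, pd k g x = 0 := fun x hx k =>
        image_eq_zero_of_notMem_tsupport fun h' =>
          hx (hgt (tsupport_fderiv_apply_subset ℝ _ h'))
      refine integral_mono ((hint _ (by fun_prop) fun x hx => by simp [hg0 x hx]).const_mul _)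
        (hint _ (by fun_prop) fun x hx => by simp [hgk0 x hx, hg0 x hx]) fun x => ?_
      have h4 : 0 ≤ w x * e x ^ 2 * (τ * ∑ k, ‖pd k g x‖ ^ 2) := by
        have := (hw0 x).le
        positivity
      simp only [he] at h4 ⊢
      linarith
    refine hl.trans ?_
    rw [hR, hJ, ← integral_const_mul, ← integral_const_mul,
      ← integral_add (hintR.const_mul _) (hintJ.const_mul _)]
    refine integral_mono_of_nonneg (Eventually.of_forall fun x => by positivity)
      ((hintR.const_mul _).add (hintJ.const_mul _)) (Eventually.of_forall fun x => ?_)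
    simp only
    rw [hg, negLap_factorization hW hu x]
    have h1 := norm_sq_error_le (d := d) (z := u x)
      (y := fun k => pd k u x) ((hW'' x).trans (mul_le_mul_of_nonneg_right hK₁ (hw0 x).le))
      (fun k => hWd' k x)
    set P := lap (lap u) x - W x ^ 2 * u x
    set E := lap W x * u x + 2 * ∑ k, pd k W x * pd k u x
    have h2 : ‖P - E‖ ^ 2 ≤ 2 * ‖P‖ ^ 2 + 2 * ‖E‖ ^ 2 := by
      have := norm_sub_le P E
      have : ‖P - E‖ ^ 2 ≤ (‖P‖ + ‖E‖) ^ 2 := by gcongr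
      nlinarith [sq_nonneg (‖P‖ - ‖E‖)]
    have h3 := mul_le_mul_of_nonneg_left h2 (sq_nonneg (e x))
    have h4 := mul_le_mul_of_nonneg_left h1 (sq_nonneg (e x))
    linarith
  have hJ0 : 0 ≤ J := integral_nonneg fun x => by positivity
  have final : τ * J ≤ 4 / c ^ 2 * R := by
    have h1 : c * τ ^ 3 * (c * τ * J) ≤ 2 * R + 16 * (d + 1) * K ^ 2 * J :=
      (mul_le_mul_of_nonneg_left s₂ (by positivity)).trans s₁
    have h2 := mul_le_mul_of_nonneg_right hτ3 hJ0
    have h3 : τ ≤ τ ^ 4 := le_self_pow₀ (by linarith) four_ne_zero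
    have h4 : c ^ 2 * τ * J ≤ c ^ 2 * τ ^ 4 * J := by gcongr
    have h5 : c ^ 2 * (τ * J) ≤ 4 * R := by
      have : c * τ ^ 3 * (c * τ * J) = c ^ 2 * τ ^ 4 * J := by ring
      linarith
    rw [div_mul_eq_mul_div, le_div_iff₀ (by positivity)]
    linarith
  have hRR : ∫ x, e x ^ 2 * ‖(negLap^[2] u) x - W x ^ 2 * u x‖ ^ 2 = R := by
    refine integral_congr_ae (Eventually.of_forall fun x => ?_)
    have : (negLap^[2] u) x = lap (lap u) x := by
      change -lap (fun x => -lap u x) x = _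
      rw [lap_neg, neg_neg]
    simp only [this]
  rw [hRR]
  refine le_trans (mul_le_mul_of_nonneg_left ?_ hτ0) final
  refine integral_mono_of_nonneg (Eventually.of_forall fun x => by positivity) hintJ
    (Eventually.of_forall fun x => ?_)
  simp only
  gcongr
  have : 0 ≤ ∑ k, ‖pd k u x‖ ^ 2 := by positivity
  linarith

end CarlemanPowers

/-! ### Decay bounds and the square root of the long-range part -/

section Decay

variable {d : ℕ}

theorem one_le_one_add_norm_sq (x : RSpace d) : 1 ≤ 1 + ‖x‖ ^ 2 := by
  nlinarith [sq_nonneg ‖x‖]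

/-- Near infinity `1 + |x|² ≤ 2|x|²` converts the decay; on the remaining ball the bracket is
bounded below and local boundedness suffices. -/
theorem exists_forall_norm_le_of_isBigO {G : Type*} [NormedAddCommGroup G] {f : RSpace d → G}
    {s : ℝ} (hs : 0 ≤ s) (hb : ∀ R : ℝ, ∃ C : ℝ, ∀ x, ‖x‖ ≤ R → ‖f x‖ ≤ C)
    (hf : f =O[cobounded (RSpace d)] fun x => ‖x‖ ^ (-s)) :
    ∃ C : ℝ, 0 ≤ C ∧ ∀ x, ‖f x‖ ≤ C * (1 + ‖x‖ ^ 2) ^ (-(s / 2)) := by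
  obtain ⟨c, hc0, hc⟩ := hf.exists_nonneg
  have hc' := hc.bound
  rw [← comap_norm_atTop, eventually_comap, eventually_atTop] at hc'
  obtain ⟨R₀, hR₀⟩ := hc'
  set R := max R₀ 1 with hR
  have hR1 : 1 ≤ R := le_max_right _ _
  obtain ⟨C₀, hC₀⟩ := hb R
  refine ⟨c * 2 ^ (s / 2) + |C₀| * (1 + R ^ 2) ^ (s / 2), by positivity, fun x => ?_⟩
  have ht : 0 < 1 + ‖x‖ ^ 2 := by positivity
  have hp1 : 0 ≤ c * 2 ^ (s / 2) * (1 + ‖x‖ ^ 2) ^ (-(s / 2)) := by positivity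
  have hp2 : 0 ≤ |C₀| * (1 + R ^ 2) ^ (s / 2) * (1 + ‖x‖ ^ 2) ^ (-(s / 2)) := by positivity
  rw [add_mul]
  rcases le_total ‖x‖ R with h | h
  · have h1 : (1 + R ^ 2) ^ (-(s / 2)) ≤ (1 + ‖x‖ ^ 2) ^ (-(s / 2)) :=
      Real.rpow_le_rpow_of_nonpos ht (by gcongr) (by linarith)
    have h2 : (1 + R ^ 2) ^ (s / 2) * (1 + R ^ 2) ^ (-(s / 2)) = 1 := by
      rw [← Real.rpow_add (by positivity)]; simp
    calc ‖f x‖ ≤ |C₀| := (hC₀ x h).trans (le_abs_self _)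
      _ = |C₀| * (1 + R ^ 2) ^ (s / 2) * (1 + R ^ 2) ^ (-(s / 2)) := by rw [mul_assoc, h2, mul_one]
      _ ≤ |C₀| * (1 + R ^ 2) ^ (s / 2) * (1 + ‖x‖ ^ 2) ^ (-(s / 2)) := by gcongr
      _ ≤ _ := by linarith
  · have hx0 : 0 < ‖x‖ := by linarith
    have h1 := hR₀ ‖x‖ ((le_max_left _ _).trans h) x rfl
    rw [Real.norm_of_nonneg (by positivity)] at h1
    have h2 : ‖x‖ ^ (-s) ≤ 2 ^ (s / 2) * (1 + ‖x‖ ^ 2) ^ (-(s / 2)) := by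
      have e : ‖x‖ ^ (-s) = 2 ^ (s / 2) * (2 * ‖x‖ ^ 2) ^ (-(s / 2)) := by
        rw [Real.mul_rpow (by norm_num) (by positivity), ← mul_assoc,
          ← Real.rpow_add (by norm_num), ← Real.rpow_natCast ‖x‖ 2, ← Real.rpow_mul hx0.le]
        simp; congr 1; ring
      rw [e]
      refine mul_le_mul_of_nonneg_left ?_ (by positivity)
      refine Real.rpow_le_rpow_of_nonpos ht ?_ (by linarith)
      nlinarith
    calc ‖f x‖ ≤ c * ‖x‖ ^ (-s) := h1
      _ ≤ c * (2 ^ (s / 2) * (1 + ‖x‖ ^ 2) ^ (-(s / 2))) := by gcongr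
      _ ≤ _ := by linarith

theorem one_add_norm_sq_rpow_le {b c : ℝ} (hbc : c ≤ b) (x : RSpace d) :
    (1 + ‖x‖ ^ 2) ^ (-b) ≤ (1 + ‖x‖ ^ 2) ^ (-c) :=
  Real.rpow_le_rpow_of_exponent_le (one_le_one_add_norm_sq x) (by linarith)

theorem one_add_norm_sq_rpow_le_coord {a : ℝ} (ha : 0 ≤ a) (i₀ : Fin d) (x : RSpace d) :
    (1 + ‖x‖ ^ 2) ^ (-a) ≤ (1 + x i₀ ^ 2) ^ (-a) := by
  refine Real.rpow_le_rpow_of_nonpos (by positivity) ?_ (by linarith)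
  have := PiLp.norm_apply_le x i₀
  rw [Real.norm_eq_abs] at this
  have h2 := pow_le_pow_left₀ (abs_nonneg _) this 2
  rw [sq_abs] at h2
  linarith

theorem bounded_on_balls_of_continuous {G : Type*} [NormedAddCommGroup G] {f : RSpace d → G}
    (hf : Continuous f) (R : ℝ) : ∃ C : ℝ, ∀ x, ‖x‖ ≤ R → ‖f x‖ ≤ C := by
  obtain ⟨C, hC⟩ := (isCompact_closedBall (0 : RSpace d) R).exists_bound_of_continuousOn
    hf.continuousOn
  exact ⟨C, fun x hx => hC x (by simpa using hx)⟩

theorem pd_pd_eq {F : Type*} [NormedAddCommGroup F] [NormedSpace ℝ F] {f : RSpace d → F}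
    (hf : ContDiff ℝ ∞ f) (k l : Fin d) (x : RSpace d) :
    pd k (pd l f) x
      = fderiv ℝ (fderiv ℝ f) x (EuclideanSpace.single k 1) (EuclideanSpace.single l 1) :=
  pd_clm_comp (ContinuousLinearMap.apply ℝ F (EuclideanSpace.single l (1 : ℝ)))
      (f := fderiv ℝ f) k (((hf.fderiv_right (m := ∞) (by simp)).differentiable (by simp)) x)

theorem iteratedPartial_one (V : RSpace d → ℝ) (k : Fin d) :
    iteratedPartial (fun _ : Fin 1 => k) V = pd k V := by
  ext x
  simp [iteratedPartial, pd, iteratedFDeriv_one_apply]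

theorem iteratedPartial_two {V : RSpace d → ℝ} (hV : ContDiff ℝ ∞ V) (k : Fin d) :
    iteratedPartial (fun _ : Fin 2 => k) V = pd k (pd k V) := by
  ext x
  rw [pd_pd_eq hV, iteratedPartial, iteratedFDeriv_two_apply]

theorem pd_one_add_norm_sq_rpow (b : ℝ) (k : Fin d) (x : RSpace d) :
    pd k (fun x : RSpace d => (1 + ‖x‖ ^ 2) ^ b) x
      = 2 * b * (x k * (1 + ‖x‖ ^ 2) ^ (b - 1)) := by
  have ht : (0 : ℝ) < 1 + ‖x‖ ^ 2 := by positivity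
  have h1 : HasFDerivAt (fun x : RSpace d => 1 + ‖x‖ ^ 2) (2 • innerSL ℝ x) x := by
    simpa using ((hasStrictFDerivAt_norm_sq x).hasFDerivAt).const_add 1
  have h2 := (h1.rpow_const (p := b) (Or.inl ht.ne')).fderiv
  rw [pd, h2]
  simp [EuclideanSpace.inner_single_right]
  ring

theorem pd_coord (k : Fin d) (x : RSpace d) : pd k (fun x : RSpace d => x k) x = 1 := by
  simpa using pd_comp_coord k k (f := id) x (hasDerivAt_id _)

theorem contDiff_one_add_norm_sq_rpow (b : ℝ) :
    ContDiff ℝ ∞ fun x : RSpace d => (1 + ‖x‖ ^ 2) ^ b :=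
  ContDiff.rpow_const_of_ne (contDiff_const.add (contDiff_norm_sq ℝ)) fun s => by positivity

theorem abs_coord_le (k : Fin d) (x : RSpace d) : |x k| ≤ (1 + ‖x‖ ^ 2) ^ (1 / 2 : ℝ) := by
  rw [← Real.sqrt_eq_rpow]
  refine Real.le_sqrt_of_sq_le ?_
  have := PiLp.norm_apply_le x k
  rw [Real.norm_eq_abs] at this
  have h2 := pow_le_pow_left₀ (abs_nonneg _) this 2
  linarith

/-- Differentiation gains half a power of `1 + |x|²`, and `a + 1/2 ≥ 3a/2` for `a ≤ 1`. The exponent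
`3a/2` is what `sqrt_bounds` requires. -/
theorem abs_pd_rpow_le {a : ℝ} (ha : 0 ≤ a) (ha1 : a ≤ 1) (k : Fin d) (x : RSpace d) :
    |pd k (fun x : RSpace d => (1 + ‖x‖ ^ 2) ^ (-a)) x| ≤ 10 * (1 + ‖x‖ ^ 2) ^ (-(3 * a / 2)) := by
  have ht : (0 : ℝ) < 1 + ‖x‖ ^ 2 := by positivity
  rw [pd_one_add_norm_sq_rpow, abs_mul, abs_mul (x k), abs_of_pos (Real.rpow_pos_of_pos ht _)]
  have h1 : |x k| * (1 + ‖x‖ ^ 2) ^ (-a - 1) ≤ (1 + ‖x‖ ^ 2) ^ (-(3 * a / 2)) := by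
    calc _ ≤ (1 + ‖x‖ ^ 2) ^ (1 / 2 : ℝ) * (1 + ‖x‖ ^ 2) ^ (-a - 1) := by
          gcongr; exact abs_coord_le k x
      _ = (1 + ‖x‖ ^ 2) ^ (-(a + 1 / 2)) := by rw [← Real.rpow_add ht]; congr 1; ring
      _ ≤ _ := one_add_norm_sq_rpow_le (by linarith) x
  have h2 : |2 * -a| ≤ 10 := by rw [abs_le]; constructor <;> linarith
  gcongr

theorem abs_pd_pd_rpow_le {a : ℝ} (ha : 0 ≤ a) (ha1 : a ≤ 1) (k : Fin d) (x : RSpace d) :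
    |pd k (pd k (fun x : RSpace d => (1 + ‖x‖ ^ 2) ^ (-a))) x|
      ≤ 10 * (1 + ‖x‖ ^ 2) ^ (-(3 * a / 2)) := by
  have ht : (0 : ℝ) < 1 + ‖x‖ ^ 2 := by positivity
  have hd1 : Differentiable ℝ fun x : RSpace d => (1 + ‖x‖ ^ 2) ^ (-a - 1) :=
    (contDiff_one_add_norm_sq_rpow _).differentiable (by simp)
  have hd2 : Differentiable ℝ fun x : RSpace d => x k := by fun_prop
  rw [show pd k (fun x : RSpace d => (1 + ‖x‖ ^ 2) ^ (-a)) = _ from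
      funext fun y => pd_one_add_norm_sq_rpow (-a) k y,
    pd_const_mul k _ ((hd2 x).fun_mul (hd1 x)), pd_mul k (hd2 x) (hd1 x), pd_one_add_norm_sq_rpow,
    pd_coord]
  have h1 : |x k * (2 * (-a - 1) * (x k * (1 + ‖x‖ ^ 2) ^ (-a - 1 - 1)))
      + (1 + ‖x‖ ^ 2) ^ (-a - 1) * 1| ≤ 5 * (1 + ‖x‖ ^ 2) ^ (-(3 * a / 2)) := by
    have e : x k * (2 * (-a - 1) * (x k * (1 + ‖x‖ ^ 2) ^ (-a - 1 - 1)))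
        + (1 + ‖x‖ ^ 2) ^ (-a - 1) * 1
        = (1 + ‖x‖ ^ 2) ^ (-a - 1) * (2 * (-a - 1) * (x k ^ 2 / (1 + ‖x‖ ^ 2)) + 1) := by
      rw [Real.rpow_sub_one ht.ne' (-a - 1)]; field_simp
    have h2 : x k ^ 2 / (1 + ‖x‖ ^ 2) ≤ 1 := by
      rw [div_le_one ht]
      have := PiLp.norm_apply_le x k
      rw [Real.norm_eq_abs] at this
      have h2 := pow_le_pow_left₀ (abs_nonneg _) this 2
      rw [sq_abs] at h2
      linarith
    have h3 : 0 ≤ x k ^ 2 / (1 + ‖x‖ ^ 2) := by positivity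
    have h4 : |2 * (-a - 1) * (x k ^ 2 / (1 + ‖x‖ ^ 2)) + 1| ≤ 5 := by
      rw [abs_le]; constructor <;> nlinarith
    rw [e, abs_mul, abs_of_pos (Real.rpow_pos_of_pos ht _), mul_comm]
    have h5 : (1 + ‖x‖ ^ 2) ^ (-a - 1) ≤ (1 + ‖x‖ ^ 2) ^ (-(3 * a / 2)) :=
      Real.rpow_le_rpow_of_exponent_le (one_le_one_add_norm_sq x) (by linarith)
    gcongr
  rw [abs_mul]
  have h2 : |2 * -a| ≤ 2 := by rw [abs_le]; constructor <;> linarith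
  calc _ ≤ 2 * (5 * (1 + ‖x‖ ^ 2) ^ (-(3 * a / 2))) := by gcongr
    _ = _ := by ring

/-- A smooth square root of a function with positive imaginary part. -/
theorem exists_smooth_sqrt {z : RSpace d → ℂ} (hz : ContDiff ℝ ∞ z) (him : ∀ x, 0 < (z x).im) :
    ∃ W : RSpace d → ℂ, ContDiff ℝ ∞ W ∧ ∀ x, W x ^ 2 = z x := by
  have hslit : ∀ x, z x ∈ Complex.slitPlane := fun x => Or.inr (him x).ne'
  refine ⟨fun x => Complex.exp ((1 / 2 : ℂ) * Complex.log (z x)), ?_, fun x => ?_⟩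
  · have hlog : ContDiff ℝ ∞ fun x => Complex.log (z x) := by
      rw [contDiff_iff_contDiffAt]
      intro x
      have h1 : ContDiffAt ℂ ∞ Complex.log (z x) := Complex.contDiffAt_log (hslit x)
      exact (h1.restrict_scalars ℝ).comp x hz.contDiffAt
    exact (contDiff_const.mul hlog).cexp
  · rw [← Complex.exp_nat_mul]
    push_cast
    rw [← mul_assoc]
    norm_num
    exact Complex.exp_log (Complex.slitPlane_ne_zero (hslit x))

/-- From `W² = z` one gets `2W ∂W = ∂z` and `2W ∂²W = ∂²z - 2(∂W)²`, while `|W|² ≥ Im z` gives `|W|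
≥ (1 + |x|²)^{-a/2}`. Dividing by `W` thus loses `a/2` in the exponent, so decay `3a/2` of the
derivatives of `z` becomes decay `a` for those of `W`. -/
theorem sqrt_bounds {a C : ℝ} (ha : 0 ≤ a) {z W : RSpace d → ℂ}
    (hW : ContDiff ℝ ∞ W) (hWz : ∀ x, W x ^ 2 = z x)
    (him : ∀ x, (1 + ‖x‖ ^ 2) ^ (-a) ≤ (z x).im) (hzC : ∀ x, ‖z x‖ ≤ C)
    (hz1 : ∀ k x, ‖pd k z x‖ ≤ C * (1 + ‖x‖ ^ 2) ^ (-(3 * a / 2)))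
    (hz2 : ∀ k x, ‖pd k (pd k z) x‖ ≤ C * (1 + ‖x‖ ^ 2) ^ (-(3 * a / 2))) :
    ∃ K : ℝ, (∀ x, ‖W x‖ ≤ K) ∧ (∀ k x, ‖pd k W x‖ ≤ K * (1 + ‖x‖ ^ 2) ^ (-a)) ∧
      ∀ x, ‖lap W x‖ ≤ K * (1 + ‖x‖ ^ 2) ^ (-a) := by
  have hC : 0 ≤ C := (norm_nonneg _).trans (hzC 0)
  have hWd : Differentiable ℝ W := hW.differentiable (by simp)
  have hpW : ∀ k, Differentiable ℝ (pd k W) := fun k => (hW.pd k).differentiable (by simp)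
  have hzeq : z = fun x => W x * W x := funext fun x => by rw [← hWz]; ring
  have e1 : ∀ k, pd k z = fun x => 2 * (W x * pd k W x) := fun k => funext fun x => by
    rw [hzeq, pd_mul k (hWd x) (hWd x)]; ring
  have e2 : ∀ k x, pd k (pd k z) x = 2 * (W x * pd k (pd k W) x + pd k W x ^ 2) := fun k x => by
    rw [e1, pd_const_mul k _ ((hWd x).fun_mul (hpW k x)), pd_mul k (hWd x) (hpW k x)]; ring
  have hlow : ∀ x, (1 + ‖x‖ ^ 2) ^ (-(a / 2)) ≤ ‖W x‖ := fun x => by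
    refine le_of_sq_le_sq ?_ (norm_nonneg _)
    have ht : (0 : ℝ) < 1 + ‖x‖ ^ 2 := by positivity
    rw [← norm_pow, hWz, ← Real.rpow_natCast, ← Real.rpow_mul ht.le]
    refine le_trans (le_of_eq ?_) ((him x).trans (Complex.im_le_norm _))
    congr 1; push_cast; ring
  have hdiv : ∀ (x : RSpace d) (y : ℂ) (M : ℝ),
      ‖W x * y‖ ≤ M * (1 + ‖x‖ ^ 2) ^ (-(3 * a / 2)) → ‖y‖ ≤ M * (1 + ‖x‖ ^ 2) ^ (-a) := by
    intro x y M h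
    have ht : (0 : ℝ) < 1 + ‖x‖ ^ 2 := by positivity
    have hpos : 0 < (1 + ‖x‖ ^ 2) ^ (-(a / 2)) := Real.rpow_pos_of_pos ht _
    rw [norm_mul] at h
    have h1 : (1 + ‖x‖ ^ 2) ^ (-(a / 2)) * ‖y‖ ≤ M * (1 + ‖x‖ ^ 2) ^ (-(3 * a / 2)) :=
      (mul_le_mul_of_nonneg_right (hlow x) (norm_nonneg _)).trans h
    have h2 : (1 + ‖x‖ ^ 2) ^ (-(3 * a / 2))
        = (1 + ‖x‖ ^ 2) ^ (-(a / 2)) * (1 + ‖x‖ ^ 2) ^ (-a) := by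
      rw [← Real.rpow_add ht]; congr 1; ring
    rw [h2] at h1
    refine le_of_mul_le_mul_left (h1.trans (le_of_eq ?_)) hpos
    ring
  have b1 : ∀ k x, ‖pd k W x‖ ≤ C * (1 + ‖x‖ ^ 2) ^ (-a) := fun k x => by
    refine hdiv x _ C ?_
    have := hz1 k x
    rw [e1, norm_mul] at this
    simp only [Complex.norm_ofNat] at this
    linarith [norm_nonneg (W x * pd k W x)]
  have b2 : ∀ k x, ‖pd k (pd k W) x‖ ≤ (C + C ^ 2) * (1 + ‖x‖ ^ 2) ^ (-a) := fun k x => by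
    refine hdiv x _ (C + C ^ 2) ?_
    have ht : (0 : ℝ) < 1 + ‖x‖ ^ 2 := by positivity
    have h1 := hz2 k x
    rw [e2, norm_mul] at h1
    simp only [Complex.norm_ofNat] at h1
    have h2 : W x * pd k (pd k W) x
        = (W x * pd k (pd k W) x + pd k W x ^ 2) - pd k W x ^ 2 := by ring
    have h3 : ‖pd k W x ^ 2‖ ≤ C ^ 2 * (1 + ‖x‖ ^ 2) ^ (-(3 * a / 2)) := by
      rw [norm_pow]
      calc ‖pd k W x‖ ^ 2 ≤ (C * (1 + ‖x‖ ^ 2) ^ (-a)) ^ 2 := by gcongr; exact b1 k x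
        _ = C ^ 2 * (1 + ‖x‖ ^ 2) ^ (-(2 * a)) := by
          rw [mul_pow, ← Real.rpow_natCast ((1 + ‖x‖ ^ 2) ^ (-a)), ← Real.rpow_mul ht.le]
          congr 2; push_cast; ring
        _ ≤ _ := by gcongr C ^ 2 * ?_; exact one_add_norm_sq_rpow_le (by linarith) x
    rw [h2]
    have h4 := norm_sub_le (W x * pd k (pd k W) x + pd k W x ^ 2) (pd k W x ^ 2)
    have h5 := norm_nonneg (W x * pd k (pd k W) x + pd k W x ^ 2)
    linarith
  refine ⟨(1 + C) + C + d * (C + C ^ 2), fun x => ?_, fun k x => ?_, fun x => ?_⟩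
  · have h1 : ‖W x‖ ^ 2 ≤ C := by rw [← norm_pow, hWz]; exact hzC x
    have h2 : ‖W x‖ ≤ 1 + C := by nlinarith [sq_nonneg (‖W x‖ - 1)]
    have : 0 ≤ C + d * (C + C ^ 2) := by positivity
    linarith
  · refine (b1 k x).trans ?_
    gcongr
    have : 0 ≤ 1 + C + d * (C + C ^ 2) := by positivity
    linarith
  · calc ‖lap W x‖ ≤ ∑ k : Fin d, ‖pd k (pd k W) x‖ := norm_sum_le _ _
      _ ≤ ∑ _k : Fin d, (C + C ^ 2) * (1 + ‖x‖ ^ 2) ^ (-a) := Finset.sum_le_sum fun k _ => b2 k x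
      _ = d * (C + C ^ 2) * (1 + ‖x‖ ^ 2) ^ (-a) := by simp; ring
      _ ≤ _ := by
        gcongr
        linarith

theorem norm_fderiv_le_of_pd {F : Type*} [NormedAddCommGroup F] [NormedSpace ℝ F]
    {f : RSpace d → F} {C : ℝ} (x : RSpace d) (hf : ∀ k, ‖pd k f x‖ ≤ C) :
    ‖fderiv ℝ f x‖ ≤ d * C := by
  rcases Nat.eq_zero_or_pos d with rfl | hd
  · have : fderiv ℝ f x = 0 := by
      ext y
      rw [Subsingleton.elim y 0]; simp
    simp [this]
  have hC : 0 ≤ C := (norm_nonneg _).trans (hf ⟨0, hd⟩)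
  refine ContinuousLinearMap.opNorm_le_bound _ (by positivity) fun y => ?_
  have hy : y = ∑ k, y k • EuclideanSpace.single k (1 : ℝ) := by
    ext i; simp [Finset.sum_apply, Pi.single_apply]
  calc ‖fderiv ℝ f x y‖ = ‖∑ k, y k • pd k f x‖ := by
        conv_lhs => rw [hy]
        simp [pd, map_sum]
    _ ≤ ∑ k, ‖y k • pd k f x‖ := norm_sum_le _ _
    _ ≤ ∑ _k : Fin d, ‖y‖ * C := by
        refine Finset.sum_le_sum fun k _ => ?_
        rw [norm_smul]
        exact mul_le_mul (PiLp.norm_apply_le y k) (hf k) (norm_nonneg _) (norm_nonneg _)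
    _ = d * C * ‖y‖ := by simp; ring

theorem norm_sub_le_of_pd {F : Type*} [NormedAddCommGroup F] [NormedSpace ℝ F]
    {f : RSpace d → F} {C : ℝ} (hf : ContDiff ℝ ∞ f) (hC : ∀ k x, ‖pd k f x‖ ≤ C)
    (x y : RSpace d) : ‖f x - f y‖ ≤ d * C * ‖x - y‖ :=
  Convex.norm_image_sub_le_of_norm_fderiv_le (𝕜 := ℝ) (s := Set.univ)
    (fun z _ => hf.differentiable (by simp) z)
    (fun z _ => norm_fderiv_le_of_pd z fun k => hC k z) convex_univ (Set.mem_univ y)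
    (Set.mem_univ x)

end Decay

/-! ### Choice of the weight and of the approximating potential -/

section Potential

variable {d : ℕ}

/-- This is where the decay hypotheses enter. The derivatives of `V₁` must be dominated by the
convexity `w`, and the rest of the potential, squared, by `w^j`. Bounds in `|x|` pass to the single
coordinate because `(1 + |x|²)^{-a} ≤ (1 + x_{i₀}²)^{-a}`. -/
theorem exists_carleman_potential (hd : 1 ≤ d) (j : ℕ) (hj : j = 1 ∨ j = 2)
    (V₁ V₂ : RSpace d → ℝ)
    (hV₁_smooth : ContDiff ℝ ∞ V₁) (hV₁_bdd : ∃ C : ℝ, ∀ x, |V₁ x| ≤ C)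
    (hV₂_bdd : ∃ C : ℝ, ∀ x, |V₂ x| ≤ C)
    (δ : ℝ) (hδ : 0 < δ)
    (hV₂_decay : V₂ =O[cobounded (RSpace d)] fun x => ‖x‖ ^ (-δ - (j : ℝ) / 2))
    (hV₁_decay : ∀ k : ℕ, 1 ≤ k → k ≤ j → ∀ J : Fin k → Fin d,
      iteratedPartial J V₁ =O[cobounded (RSpace d)] fun x => ‖x‖ ^ (-(δ + j + k) / 2))
    (lam : ℝ) :
    ∃ (m g : RSpace d → ℝ) (Z : RSpace d → ℂ) (L C τ₀ : ℝ),
      (Continuous m ∧ (∀ x, 0 < m x) ∧ ∀ x, m x ≤ 1) ∧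
      (Continuous g ∧ 0 ≤ L ∧ ∀ x y, |g x - g y| ≤ L * ‖x - y‖) ∧
      (Continuous Z ∧ (∀ x y, ‖Z x - Z y‖ ≤ L * ‖x - y‖) ∧ ∃ B, ∀ x, ‖Z x‖ ≤ B) ∧
      (0 ≤ C ∧ ∀ x, ‖((lam - (V₁ x + V₂ x) : ℝ) : ℂ) - Z x‖ ^ 2 ≤ C * m x ^ j) ∧
      ∀ τ, τ₀ ≤ τ → CarlemanInequality j C τ m (fun x => Real.exp (τ * g x)) Z := by
  -- Above `1/2` for integrability of `w`, and at most `1/2 + δ/8` so that the hypotheses provide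
  -- the required powers. The tightest case is `j = 2`, where `3a/2 ≤ (δ + 3)/4` is needed for
  -- `∇V₁`.
  set a : ℝ := 1 / 2 + min δ 1 / 8 with ha_def
  have hm1 : min δ 1 ≤ δ := min_le_left _ _
  have hm2 : min δ 1 ≤ 1 := min_le_right _ _
  have hm3 : 0 < min δ 1 := lt_min hδ one_pos
  have ha : 1 / 2 < a := by rw [ha_def]; linarith
  have ha1 : a ≤ 5 / 8 := by rw [ha_def]; linarith
  have haδ : a ≤ 1 / 2 + δ / 8 := by rw [ha_def]; linarith
  clear_value a
  obtain ⟨h, K₀, hK₀, hhs, hhL, hh⟩ := exists_convex_weight ha (by linarith)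
  set i₀ : Fin d := ⟨0, hd⟩
  have hh' := hh d i₀
  obtain ⟨C₁, hC₁⟩ := hV₁_bdd
  obtain ⟨C₂, hC₂⟩ := hV₂_bdd
  have hC₁0 : 0 ≤ C₁ := (abs_nonneg _).trans (hC₁ 0)
  have hw0 : ∀ x : RSpace d, 0 < (1 + x i₀ ^ 2) ^ (-a) := fun x =>
    Real.rpow_pos_of_pos (by positivity) _
  have hw1 : ∀ x : RSpace d, (1 + x i₀ ^ 2) ^ (-a) ≤ 1 := fun x =>
    Real.rpow_le_one_of_one_le_of_nonpos (by nlinarith [sq_nonneg (x i₀)]) (by linarith)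
  have hwc : Continuous fun x : RSpace d => (1 + x i₀ ^ 2) ^ (-a) :=
    (contDiff_comp_coord i₀ (contDiff_one_add_sq_rpow a)).continuous
  have hgc : Continuous fun x : RSpace d => h (x i₀) := (contDiff_comp_coord i₀ hhs).continuous
  have hgL : ∀ x y : RSpace d, |h (x i₀) - h (y i₀)| ≤ K₀ * ‖x - y‖ := fun x y => by
    refine (hhL _ _).trans ?_
    gcongr
    have := PiLp.norm_apply_le (x - y) i₀
    simpa [Real.norm_eq_abs] using this
  have hcoord : ∀ x : RSpace d, (1 + ‖x‖ ^ 2) ^ (-a) ≤ (1 + x i₀ ^ 2) ^ (-a) :=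
    one_add_norm_sq_rpow_le_coord (by linarith) i₀
  have hle1 : ∀ {b : ℝ} (x : RSpace d), 0 ≤ b → (1 + ‖x‖ ^ 2) ^ (-b) ≤ 1 := fun x hb =>
    Real.rpow_le_one_of_one_le_of_nonpos (one_le_one_add_norm_sq x) (by linarith)
  have hV₁' : ∃ D : ℝ, 0 ≤ D ∧ ∀ k x,
      |pd k V₁ x| ≤ D * (1 + ‖x‖ ^ 2) ^ (-((δ + j + 1) / 4)) := by
    have h1 : ∀ k, ∃ D : ℝ, 0 ≤ D ∧ ∀ x,
        ‖pd k V₁ x‖ ≤ D * (1 + ‖x‖ ^ 2) ^ (-((δ + j + 1) / 2 / 2)) := fun k => by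
      refine exists_forall_norm_le_of_isBigO (by positivity)
        (bounded_on_balls_of_continuous (hV₁_smooth.pd k).continuous) ?_
      have := hV₁_decay 1 le_rfl (by rcases hj with rfl | rfl <;> norm_num) (fun _ => k)
      rw [iteratedPartial_one] at this
      refine this.congr_right fun x => ?_
      congr 1; push_cast; ring
    choose D hD0 hD using h1
    refine ⟨∑ k, D k, Finset.sum_nonneg fun k _ => hD0 k, fun k x => ?_⟩
    have h2 : D k ≤ ∑ k, D k :=
      Finset.single_le_sum (f := D) (fun i _ => hD0 i) (Finset.mem_univ k)
    refine (hD k x).trans ?_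
    rw [show (δ + j + 1) / 2 / 2 = (δ + j + 1) / 4 by ring]
    gcongr
  obtain ⟨D₁, hD₁0, hD₁⟩ := hV₁'
  have hV₂' : ∃ D : ℝ, 0 ≤ D ∧ ∀ x, ‖V₂ x‖ ≤ D * (1 + ‖x‖ ^ 2) ^ (-((δ + j / 2) / 2)) := by
    refine exists_forall_norm_le_of_isBigO (by positivity) (fun R => ⟨C₂, fun x _ => hC₂ x⟩) ?_
    refine hV₂_decay.congr_right fun x => ?_
    congr 1; ring
  obtain ⟨D₂, hD₂0, hD₂⟩ := hV₂'
  have hofReal : ∀ {f : RSpace d → ℝ}, ContDiff ℝ ∞ f → ∀ k,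
      pd k (fun x => (f x : ℂ)) = fun x => ((pd k f x : ℝ) : ℂ) := fun {f} hf k =>
    funext fun x => pd_clm_comp Complex.ofRealCLM k (hf.differentiable (by simp) x)
  have hlV : ContDiff ℝ ∞ fun x => lam - V₁ x := contDiff_const.sub hV₁_smooth
  have hpdlV : ∀ k, pd k (fun x => lam - V₁ x) = fun x => - pd k V₁ x := fun k => funext fun x => by
    rw [pd_sub k (by fun_prop) (hV₁_smooth.differentiable (by simp) x), pd_const]
    simp
  rcases hj with rfl | rfl
  · set W : RSpace d → ℂ := fun x => ((lam - V₁ x : ℝ) : ℂ) with hW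
    have hWs : ContDiff ℝ ∞ W := Complex.ofRealCLM.contDiff.comp hlV
    have hWn : ∀ k x, ‖pd k W x‖ ≤ D₁ * (1 + ‖x‖ ^ 2) ^ (-a) := fun k x => by
      rw [hW, hofReal hlV, hpdlV]
      simp only [Complex.norm_real, norm_neg, Real.norm_eq_abs]
      refine (hD₁ k x).trans ?_
      gcongr D₁ * ?_
      exact one_add_norm_sq_rpow_le (by push_cast; linarith) x
    obtain ⟨C, τ₀, hC, hCar⟩ := carlemanInequality_one i₀ hh' hWs (K₁ := |lam| + C₁ + D₁)
      (fun x => by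
        rw [hW, Complex.norm_real, Real.norm_eq_abs]
        have := abs_sub lam (V₁ x)
        linarith [hC₁ x])
      (fun k x => (hWn k x).trans (by
        have := hw0 x
        calc D₁ * (1 + ‖x‖ ^ 2) ^ (-a) ≤ D₁ * (1 + x i₀ ^ 2) ^ (-a) := by
              gcongr D₁ * ?_; exact hcoord x
          _ ≤ _ := by
              gcongr
              linarith [abs_nonneg lam]))
    refine ⟨_, fun x => h (x i₀), W, max K₀ (d * D₁), max C (D₂ ^ 2), τ₀, ⟨hwc, hw0, hw1⟩,
      ⟨hgc, by positivity, fun x y => (hgL x y).trans (by gcongr; exact le_max_left _ _)⟩,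
      ⟨hWs.continuous, fun x y => ?_, |lam| + C₁, fun x => ?_⟩, ⟨by positivity, fun x => ?_⟩,
      fun τ hτ u hu hc => (hCar τ hτ u hu hc).trans ?_⟩
    · refine (norm_sub_le_of_pd hWs (C := D₁) (fun k x => (hWn k x).trans ?_) x y).trans ?_
      · exact mul_le_of_le_one_right hD₁0 (hle1 x (by linarith))
      · gcongr; exact le_max_right _ _
    · rw [hW, Complex.norm_real, Real.norm_eq_abs]
      have := abs_sub lam (V₁ x)
      linarith [hC₁ x]
    -- For `j = 1` only `V₂` remains, and its square decays like `(1 + |x|²)^{-(δ + 1/2)}`, faster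
    -- than `w` requires.
    · have e : ((lam - (V₁ x + V₂ x) : ℝ) : ℂ) - W x = ((-V₂ x : ℝ) : ℂ) := by
        rw [hW]; push_cast; ring
      rw [e, Complex.norm_real, norm_neg, pow_one]
      have ht : (0 : ℝ) < 1 + ‖x‖ ^ 2 := by positivity
      calc ‖V₂ x‖ ^ 2 ≤ (D₂ * (1 + ‖x‖ ^ 2) ^ (-((δ + (1 : ℕ) / 2) / 2))) ^ 2 := by
            gcongr; exact hD₂ x
        _ = D₂ ^ 2 * (1 + ‖x‖ ^ 2) ^ (-(δ + 1 / 2)) := by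
            rw [mul_pow, ← Real.rpow_natCast ((1 + ‖x‖ ^ 2) ^ _), ← Real.rpow_mul ht.le]
            congr 2; push_cast; ring
        _ ≤ D₂ ^ 2 * (1 + ‖x‖ ^ 2) ^ (-a) := by
            gcongr D₂ ^ 2 * ?_; exact one_add_norm_sq_rpow_le (by linarith) x
        _ ≤ _ := by
            exact mul_le_mul (le_max_right _ _) (hcoord x) (by positivity) (by positivity)
    · gcongr
      exact le_max_left _ _
  · have hV₁'' : ∃ D : ℝ, 0 ≤ D ∧ ∀ k x,
        |pd k (pd k V₁) x| ≤ D * (1 + ‖x‖ ^ 2) ^ (-((δ + 4) / 4)) := by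
      have h1 : ∀ k, ∃ D : ℝ, 0 ≤ D ∧ ∀ x,
          ‖pd k (pd k V₁) x‖ ≤ D * (1 + ‖x‖ ^ 2) ^ (-((δ + 4) / 2 / 2)) := fun k => by
        refine exists_forall_norm_le_of_isBigO (by positivity)
          (bounded_on_balls_of_continuous ((hV₁_smooth.pd k).pd k).continuous) ?_
        have := hV₁_decay 2 (by norm_num) le_rfl (fun _ => k)
        rw [iteratedPartial_two hV₁_smooth] at this
        refine this.congr_right fun x => ?_
        congr 1; push_cast; ring
      choose D hD0 hD using h1
      refine ⟨∑ k, D k, Finset.sum_nonneg fun k _ => hD0 k, fun k x => ?_⟩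
      have h2 : D k ≤ ∑ k, D k :=
        Finset.single_le_sum (f := D) (fun i _ => hD0 i) (Finset.mem_univ k)
      refine (hD k x).trans ?_
      rw [show (δ + 4) / 2 / 2 = (δ + 4) / 4 by ring]
      gcongr
    obtain ⟨D₃, hD₃0, hD₃⟩ := hV₁''
    set θ : RSpace d → ℝ := fun x => (1 + ‖x‖ ^ 2) ^ (-a) with hθ
    have hθs : ContDiff ℝ ∞ θ := contDiff_one_add_norm_sq_rpow (-a)
    have hθ0 : ∀ x, 0 < θ x := fun x => Real.rpow_pos_of_pos (by positivity) _
    -- The shift by `iθ` moves `λ - V₁` off the branch cut and away from zero. It is small enough,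
    -- `θ ≤ w`, to be treated like `V₂` in the final comparison.
    set z : RSpace d → ℂ := fun x => ((lam - V₁ x : ℝ) : ℂ) + (θ x : ℂ) * Complex.I with hz
    have hz₁ : ContDiff ℝ ∞ fun x => ((lam - V₁ x : ℝ) : ℂ) := Complex.ofRealCLM.contDiff.comp hlV
    have hz₂ : ContDiff ℝ ∞ fun x => (θ x : ℂ) := Complex.ofRealCLM.contDiff.comp hθs
    have hzs : ContDiff ℝ ∞ z := hz₁.add (hz₂.mul contDiff_const)
    have hzim : ∀ x, (z x).im = θ x := fun x => by simp [hz]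
    obtain ⟨W, hWs, hWz⟩ := exists_smooth_sqrt hzs fun x => by rw [hzim]; exact hθ0 x
    have hz' : ∀ k, pd k z = fun x => ((-pd k V₁ x : ℝ) : ℂ) + Complex.I * ((pd k θ x : ℝ) : ℂ) :=
      fun k => funext fun x => by
        have e : z = fun x => ((lam - V₁ x : ℝ) : ℂ) + Complex.I * (θ x : ℂ) := by
          rw [hz]; funext x; ring
        have hd1 := hz₁.differentiable (by simp) x
        have hd2 := hz₂.differentiable (by simp) x
        rw [e, pd_add k hd1 (hd2.const_mul _), pd_const_mul k _ hd2, hofReal hlV, hofReal hθs,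
          hpdlV]
    have hz'' : ∀ k x, pd k (pd k z) x
        = ((-pd k (pd k V₁) x : ℝ) : ℂ) + Complex.I * ((pd k (pd k θ) x : ℝ) : ℂ) := fun k x => by
      have h1 : ContDiff ℝ ∞ fun x => -pd k V₁ x := (hV₁_smooth.pd k).neg
      have hd1 : DifferentiableAt ℝ (fun x => ((-pd k V₁ x : ℝ) : ℂ)) x :=
        (Complex.ofRealCLM.contDiff.comp h1).differentiable (n := ∞) (by simp) x
      have hd2 : DifferentiableAt ℝ (fun x => ((pd k θ x : ℝ) : ℂ)) x :=
        (Complex.ofRealCLM.contDiff.comp (hθs.pd k)).differentiable (n := ∞) (by simp) x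
      rw [hz', pd_add k hd1 (hd2.const_mul _), pd_const_mul k _ hd2, hofReal h1,
        hofReal (hθs.pd k)]
      simp only [pd_neg]
    have hsplit : ∀ s t : ℝ, ‖(s : ℂ) + Complex.I * (t : ℂ)‖ ≤ |s| + |t| := fun s t => by
      refine (norm_add_le _ _).trans ?_
      simp
    have hzC : ∀ x, ‖z x‖ ≤ |lam| + C₁ + 1 + D₁ + D₃ + 10 := fun x => by
      have e : z x = ((lam - V₁ x : ℝ) : ℂ) + Complex.I * (θ x : ℂ) := by simp only [hz]; ring
      rw [e]
      refine (hsplit _ _).trans ?_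
      have h1 := abs_sub lam (V₁ x)
      have h2 : |θ x| ≤ 1 := by rw [abs_of_pos (hθ0 x)]; exact hle1 x (by linarith)
      linarith [hC₁ x]
    have hz1 : ∀ k x, ‖pd k z x‖
        ≤ (|lam| + C₁ + 1 + D₁ + D₃ + 10) * (1 + ‖x‖ ^ 2) ^ (-(3 * a / 2)) := fun k x => by
      rw [hz']
      refine (hsplit _ _).trans ?_
      rw [abs_neg]
      have h1 : |pd k V₁ x| ≤ D₁ * (1 + ‖x‖ ^ 2) ^ (-(3 * a / 2)) := by
        refine (hD₁ k x).trans ?_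
        gcongr D₁ * ?_
        exact one_add_norm_sq_rpow_le (by push_cast; linarith) x
      have h2 := abs_pd_rpow_le (by linarith) (by linarith : a ≤ 1) k x
      have h3 : 0 ≤ (|lam| + C₁ + 1 + D₃) * (1 + ‖x‖ ^ 2) ^ (-(3 * a / 2)) := by positivity
      linarith
    have hz2 : ∀ k x, ‖pd k (pd k z) x‖
        ≤ (|lam| + C₁ + 1 + D₁ + D₃ + 10) * (1 + ‖x‖ ^ 2) ^ (-(3 * a / 2)) := fun k x => by
      rw [hz'']
      refine (hsplit _ _).trans ?_
      rw [abs_neg]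
      have h1 : |pd k (pd k V₁) x| ≤ D₃ * (1 + ‖x‖ ^ 2) ^ (-(3 * a / 2)) := by
        refine (hD₃ k x).trans ?_
        gcongr D₃ * ?_
        exact one_add_norm_sq_rpow_le (by linarith) x
      have h2 := abs_pd_pd_rpow_le (by linarith) (by linarith : a ≤ 1) k x
      have h3 : 0 ≤ (|lam| + C₁ + 1 + D₁) * (1 + ‖x‖ ^ 2) ^ (-(3 * a / 2)) := by positivity
      linarith
    obtain ⟨K, hWK, hWK', hWK''⟩ := sqrt_bounds (by linarith) hWs hWz
      (fun x => (hzim x).ge) hzC hz1 hz2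
    have hK0 : 0 ≤ K := (norm_nonneg _).trans (hWK 0)
    obtain ⟨C, τ₀, hC, hCar⟩ := carlemanInequality_two ha (by linarith) i₀ hh' hWs (K₁ := K) hWK
      (fun k x => (hWK' k x).trans (by gcongr K * ?_; exact hcoord x))
      (fun x => (hWK'' x).trans (by gcongr K * ?_; exact hcoord x))
    set C₃ := |lam| + C₁ + 1 + D₁ + D₃ + 10 with hC₃
    have hC₃0 : 0 ≤ C₃ := by positivity
    have hWz' : (fun x => W x ^ 2) = z := funext hWz
    rw [hWz'] at hCar
    refine ⟨_, fun x => h (x i₀), z, max K₀ (d * C₃), max C ((D₂ + 1) ^ 2), τ₀, ⟨hwc, hw0, hw1⟩,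
      ⟨hgc, by positivity, fun x y => (hgL x y).trans (by gcongr; exact le_max_left _ _)⟩,
      ⟨hzs.continuous, fun x y => ?_, C₃, hzC⟩, ⟨by positivity, fun x => ?_⟩,
      fun τ hτ u hu hc => (hCar τ hτ u hu hc).trans ?_⟩
    · refine (norm_sub_le_of_pd hzs (C := C₃) (fun k x => (hz1 k x).trans ?_) x y).trans ?_
      · exact mul_le_of_le_one_right hC₃0 (hle1 x (by linarith))
      · gcongr; exact le_max_right _ _
    · have e : ((lam - (V₁ x + V₂ x) : ℝ) : ℂ) - z x
          = ((-V₂ x : ℝ) : ℂ) + Complex.I * ((-θ x : ℝ) : ℂ) := by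
        simp only [hz]; push_cast; ring
      have h1 : ‖((lam - (V₁ x + V₂ x) : ℝ) : ℂ) - z x‖ ≤ (D₂ + 1) * (1 + x i₀ ^ 2) ^ (-a) := by
        rw [e]
        refine (hsplit _ _).trans ?_
        rw [abs_neg, abs_neg, abs_of_pos (hθ0 x)]
        have h2 : |V₂ x| ≤ D₂ * (1 + x i₀ ^ 2) ^ (-a) := by
          refine (hD₂ x).trans ?_
          gcongr D₂ * ?_
          refine le_trans (one_add_norm_sq_rpow_le ?_ x) (hcoord x)
          push_cast; linarith
        have h3 : θ x ≤ (1 + x i₀ ^ 2) ^ (-a) := hcoord x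
        linarith
      calc _ ≤ ((D₂ + 1) * (1 + x i₀ ^ 2) ^ (-a)) ^ 2 := by gcongr
        _ = (D₂ + 1) ^ 2 * ((1 + x i₀ ^ 2) ^ (-a)) ^ 2 := by ring
        _ ≤ _ := by gcongr; exact le_max_right _ _
    · gcongr
      exact le_max_left _ _

end Potential

/-! ### Extension to rapidly decaying functions -/

section Cutoff

variable {d : ℕ}

/-- Iterated partial derivatives along a list of coordinates. -/
def iterPd {F : Type*} [NormedAddCommGroup F] [NormedSpace ℝ F] :
    List (Fin d) → (RSpace d → F) → RSpace d → F
  | [], f => f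
  | k :: l, f => iterPd l (pd k f)

theorem ContDiff.iterate_negLap {f : RSpace d → ℂ} (hf : ContDiff ℝ ∞ f) (j : ℕ) :
    ContDiff ℝ ∞ (_root_.negLap^[j] f) := by
  induction j with
  | zero => exact hf
  | succ j ih =>
    simp only [Function.iterate_succ', Function.comp]
    exact ih.negLap

/-- A family of smooth functions all of whose derivatives are `O (e ^ (-σ |x|))`, uniformly. -/
structure DecayFamily {ι : Type*} (σ : ℝ) (f : ι → RSpace d → ℂ) : Prop where
  smooth : ∀ i, ContDiff ℝ ∞ (f i)
  bound : ∀ l : List (Fin d), ∃ C : ℝ, ∀ i x, ‖iterPd l (f i) x‖ ≤ C * Real.exp (-(σ * ‖x‖))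

variable {ι : Type*}

theorem iterPd_add (l : List (Fin d)) {f g : RSpace d → ℂ} (hf : ContDiff ℝ ∞ f)
    (hg : ContDiff ℝ ∞ g) :
    iterPd l (fun x => f x + g x) = fun x => iterPd l f x + iterPd l g x := by
  induction l generalizing f g with
  | nil => rfl
  | cons k l ih =>
    simp only [iterPd]
    rw [show pd k (fun x => f x + g x) = _ from funext fun x =>
      pd_add k (hf.differentiable (by simp) x) (hg.differentiable (by simp) x)]
    exact ih (hf.pd k) (hg.pd k)

theorem iterPd_neg (l : List (Fin d)) (f : RSpace d → ℂ) :
    iterPd l (fun x => - f x) = fun x => - iterPd l f x := by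
  induction l generalizing f with
  | nil => rfl
  | cons k l ih =>
    simp only [iterPd]
    rw [show pd k (fun x => - f x) = _ from funext fun x => pd_neg k]
    exact ih _

theorem iterPd_zero (l : List (Fin d)) : iterPd l (fun _ => (0 : ℂ)) = fun _ => 0 := by
  induction l with
  | nil => rfl
  | cons k l ih =>
    simp only [iterPd, pd_const]
    exact ih

theorem iterPd_comp_smul (l : List (Fin d)) (f : RSpace d → ℂ) (a c : ℝ) :
    iterPd l (fun x => a • f (c • x)) = fun x => (a * c ^ l.length) • iterPd l f (c • x) := by
  induction l generalizing f a with
  | nil => simp [iterPd]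
  | cons k l ih =>
    have : pd k (fun x => a • f (c • x)) = fun x => (a * c) • pd k f (c • x) := by
      funext x
      simp only [pd]
      rw [show (fun x => a • f (c • x)) = a • fun x => f (c • x) from rfl,
        fderiv_const_smul_field, Pi.smul_apply, fderiv_comp_smul]
      simp [mul_smul]
    simp only [iterPd]
    rw [this, ih]
    simp only [List.length_cons]
    funext x
    congr 1
    ring

theorem DecayFamily.pd {σ : ℝ} {f : ι → RSpace d → ℂ} (hf : DecayFamily σ f) (k : Fin d) :
    DecayFamily σ fun i => pd k (f i) :=
  ⟨fun i => (hf.smooth i).pd k, fun l => hf.bound (k :: l)⟩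

theorem DecayFamily.neg {σ : ℝ} {f : ι → RSpace d → ℂ} (hf : DecayFamily σ f) :
    DecayFamily σ fun i x => - f i x :=
  ⟨fun i => (hf.smooth i).neg, fun l => by
    obtain ⟨C, hC⟩ := hf.bound l
    exact ⟨C, fun i x => by rw [iterPd_neg, norm_neg]; exact hC i x⟩⟩

theorem DecayFamily.add {σ : ℝ} {f g : ι → RSpace d → ℂ} (hf : DecayFamily σ f)
    (hg : DecayFamily σ g) : DecayFamily σ fun i x => f i x + g i x :=
  ⟨fun i => (hf.smooth i).add (hg.smooth i), fun l => by
    obtain ⟨C, hC⟩ := hf.bound l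
    obtain ⟨C', hC'⟩ := hg.bound l
    refine ⟨C + C', fun i x => ?_⟩
    rw [iterPd_add l (hf.smooth i) (hg.smooth i), add_mul]
    exact (norm_add_le _ _).trans (add_le_add (hC i x) (hC' i x))⟩

theorem decayFamily_zero (σ : ℝ) : DecayFamily σ fun (_ : ι) (_ : RSpace d) => (0 : ℂ) :=
  ⟨fun _ => contDiff_const, fun l => ⟨0, fun i x => by rw [iterPd_zero]; simp⟩⟩

theorem DecayFamily.sum {κ : Type*} (s : Finset κ) {σ : ℝ} {f : κ → ι → RSpace d → ℂ}
    (hf : ∀ k ∈ s, DecayFamily σ (f k)) : DecayFamily σ fun i x => ∑ k ∈ s, f k i x := by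
  classical
  induction s using Finset.induction_on with
  | empty => simpa using decayFamily_zero σ
  | insert a s ha ih =>
    simp only [Finset.sum_insert ha]
    exact (hf a (Finset.mem_insert_self a s)).add
      (ih fun k hk => hf k (Finset.mem_insert_of_mem hk))

theorem DecayFamily.negLap {σ : ℝ} {f : ι → RSpace d → ℂ} (hf : DecayFamily σ f) :
    DecayFamily σ fun i => negLap (f i) :=
  (DecayFamily.sum Finset.univ fun k _ => (hf.pd k).pd k).neg

theorem DecayFamily.iterate_negLap {σ : ℝ} {f : ι → RSpace d → ℂ} (hf : DecayFamily σ f)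
    (j : ℕ) : DecayFamily σ fun i => (_root_.negLap^[j] (f i)) := by
  induction j with
  | zero => exact hf
  | succ j ih =>
    simp only [Function.iterate_succ', Function.comp]
    exact ih.negLap

/-- Leibniz' rule by induction on the list of derivatives; both factors must vary in the induction
because one derivative falls on either of them. -/
theorem DecayFamily.mul {s t : ℝ} {f g : ι → RSpace d → ℂ} (hf : DecayFamily s f)
    (hg : DecayFamily t g) : DecayFamily (s + t) fun i x => f i x * g i x := by
  refine ⟨fun i => (hf.smooth i).mul (hg.smooth i), fun l => ?_⟩
  induction l generalizing f g with
  | nil =>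
    obtain ⟨C, hC⟩ := hf.bound []
    obtain ⟨C', hC'⟩ := hg.bound []
    refine ⟨C * C', fun i x => ?_⟩
    have h1 := mul_le_mul (hC i x) (hC' i x) (norm_nonneg _) ((norm_nonneg _).trans (hC i x))
    simp only [iterPd] at h1 ⊢
    rw [norm_mul]
    refine h1.trans (le_of_eq ?_)
    rw [show -((s + t) * ‖x‖) = -(s * ‖x‖) + -(t * ‖x‖) by ring, Real.exp_add]
    ring
  | cons k l ih =>
    obtain ⟨C, hC⟩ := ih hf (hg.pd k)
    obtain ⟨C', hC'⟩ := ih (hf.pd k) hg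
    refine ⟨C + C', fun i x => ?_⟩
    have hfd := (hf.smooth i).differentiable (by simp)
    have hgd := (hg.smooth i).differentiable (by simp)
    simp only [iterPd]
    rw [show _root_.pd k (fun x => f i x * g i x) = fun x => f i x * _root_.pd k (g i) x
        + _root_.pd k (f i) x * g i x from funext fun y => by
        rw [pd_mul k (hfd y) (hgd y)]; ring,
      iterPd_add l ((hf.smooth i).mul ((hg.smooth i).pd k))
        (((hf.smooth i).pd k).mul (hg.smooth i)), add_mul]
    exact (norm_add_le _ _).trans (add_le_add (hC i x) (hC' i x))

theorem contDiff_iterPd (l : List (Fin d)) {f : RSpace d → ℂ} (hf : ContDiff ℝ ∞ f) :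
    ContDiff ℝ ∞ (iterPd l f) := by
  induction l generalizing f with
  | nil => exact hf
  | cons k l ih => exact ih (hf.pd k)

theorem hasCompactSupport_iterPd (l : List (Fin d)) {f : RSpace d → ℂ}
    (hf : HasCompactSupport f) : HasCompactSupport (iterPd l f) := by
  induction l generalizing f with
  | nil => exact hf
  | cons k l ih => exact ih (hf.pd k)

/-- Each derivative of `χ(x / (n + 1))` brings a factor `1 / (n + 1) ≤ 1`, so the bounds are uniform
in `n`. Rate `0` expresses boundedness without decay. -/
theorem decayFamily_dilation {χ : RSpace d → ℂ} (hχ : ContDiff ℝ ∞ χ)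
    (hc : HasCompactSupport χ) :
    DecayFamily 0 fun (n : ℕ) (x : RSpace d) => χ (((n : ℝ) + 1)⁻¹ • x) := by
  refine ⟨fun n => hχ.comp (contDiff_const_smul _), fun l => ?_⟩
  obtain ⟨C, hC⟩ := (hasCompactSupport_iterPd l hc).exists_bound_of_continuous
    (contDiff_iterPd l hχ).continuous
  refine ⟨C, fun n x => ?_⟩
  have h := iterPd_comp_smul l χ 1 ((n : ℝ) + 1)⁻¹
  simp only [one_smul, one_mul] at h
  rw [h, norm_smul]
  simp only [zero_mul, neg_zero, Real.exp_zero, mul_one]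
  have h1 : ‖((n : ℝ) + 1)⁻¹ ^ l.length‖ ≤ 1 := by
    rw [norm_pow, Real.norm_of_nonneg (by positivity)]
    refine pow_le_one₀ (by positivity) (inv_le_one_of_one_le₀ ?_)
    linarith [(Nat.cast_nonneg n : (0 : ℝ) ≤ n)]
  calc _ ≤ 1 * ‖iterPd l χ (((n : ℝ) + 1)⁻¹ • x)‖ := by gcongr
    _ ≤ C := by rw [one_mul]; exact hC _

theorem Filter.EventuallyEq.pd {f g : RSpace d → ℂ} {x : RSpace d} (h : f =ᶠ[nhds x] g)
    (k : Fin d) : pd k f =ᶠ[nhds x] pd k g := by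
  filter_upwards [h.fderiv (𝕜 := ℝ)] with y hy
  simp only [_root_.pd, hy]

theorem Filter.EventuallyEq.negLap {f g : RSpace d → ℂ} {x : RSpace d} (h : f =ᶠ[nhds x] g) :
    negLap f =ᶠ[nhds x] negLap g := by
  have h1 : ∀ᶠ y in nhds x, ∀ k, _root_.pd k (_root_.pd k f) y = _root_.pd k (_root_.pd k g) y :=
    eventually_all.2 fun k => (h.pd k).pd k
  filter_upwards [h1] with y hy
  simp only [_root_.negLap, lap, hy]

theorem Filter.EventuallyEq.iterate_negLap {f g : RSpace d → ℂ} {x : RSpace d}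
    (h : f =ᶠ[nhds x] g) (j : ℕ) :
    _root_.negLap^[j] f =ᶠ[nhds x] _root_.negLap^[j] g := by
  induction j with
  | zero => exact h
  | succ j ih =>
    simp only [Function.iterate_succ', Function.comp]
    exact ih.negLap

theorem integrable_exp_neg_norm : Integrable fun x : RSpace d => Real.exp (-‖x‖) := by
  have h1 := integrable_one_add_norm (E := RSpace d) (μ := volume) (r := (d : ℝ) + 1)
    (by simp)
  refine (h1.const_mul (Real.exp 1 * (d + 1).factorial)).mono'
    (by fun_prop) (Eventually.of_forall fun x => ?_)
  rw [Real.norm_of_nonneg (Real.exp_pos _).le]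
  have hx : 0 < 1 + ‖x‖ := by positivity
  have h2 := Real.pow_div_factorial_le_exp (1 + ‖x‖) hx.le (d + 1)
  have h3 : (1 + ‖x‖) ^ (-((d : ℝ) + 1)) = ((1 + ‖x‖) ^ (d + 1))⁻¹ := by
    rw [Real.rpow_neg hx.le, ← Nat.cast_succ, Real.rpow_natCast]
  rw [h3, ← div_eq_mul_inv, le_div_iff₀ (by positivity)]
  rw [div_le_iff₀ (by positivity)] at h2
  calc Real.exp (-‖x‖) * (1 + ‖x‖) ^ (d + 1)
      ≤ Real.exp (-‖x‖) * (Real.exp (1 + ‖x‖) * (d + 1).factorial) := by gcongr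
    _ = Real.exp 1 * (d + 1).factorial := by
      rw [← mul_assoc, ← Real.exp_add]; congr 2; ring

/-- The inequality holds for `χ(x / (n + 1)) f`. The weight grows at most like `e^{τL|x|}`, so the
uniform decay of the truncated functions and their derivatives gives an integrable majorant, and
dominated convergence applies on both sides. -/
theorem CarlemanInequality.of_decay {j : ℕ} {C τ L B : ℝ} {m g : RSpace d → ℝ}
    {Z : RSpace d → ℂ} (hτ : 0 ≤ τ)
    (h : CarlemanInequality j C τ m (fun x => Real.exp (τ * g x)) Z)
    (hm : Continuous m) (hm0 : ∀ x, 0 < m x) (hm1 : ∀ x, m x ≤ 1)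
    (hg : Continuous g) (hL : 0 ≤ L) (hgL : ∀ x y, |g x - g y| ≤ L * ‖x - y‖)
    (hZ : Continuous Z) (hB : ∀ x, ‖Z x‖ ≤ B)
    {f : RSpace d → ℂ} (hf : ∀ σ : ℝ, 0 ≤ σ → DecayFamily σ fun _ : ℕ => f) :
    τ * ∫ x, m x ^ j * Real.exp (τ * g x) ^ 2 * ‖f x‖ ^ 2
      ≤ C * ∫ x, Real.exp (τ * g x) ^ 2 * ‖(negLap^[j] f) x - Z x * f x‖ ^ 2 := by
  let bump : ContDiffBump (0 : RSpace d) := ⟨1, 2, one_pos, one_lt_two⟩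
  set χ : RSpace d → ℂ := fun x => (bump x : ℂ) with hχ
  have hχs : ContDiff ℝ ∞ χ := Complex.ofRealCLM.contDiff.comp bump.contDiff
  have hχc : HasCompactSupport χ := bump.hasCompactSupport.comp_left (g := Complex.ofReal) rfl
  set u : ℕ → RSpace d → ℂ := fun n x => χ (((n : ℝ) + 1)⁻¹ • x) * f x with hu
  -- The decay rate beats the growth `τL` of the weight by `1`, leaving the integrable majorant
  -- `e^{-|x|}`.
  set σ := τ * L + 1 with hσ
  have hudec : DecayFamily σ u := by
    have := (decayFamily_dilation hχs hχc).mul (hf σ (by positivity))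
    rwa [zero_add] at this
  have huc : ∀ n, HasCompactSupport (u n) := fun n =>
    (hχc.comp_smul (inv_ne_zero (by positivity : ((n : ℝ) + 1) ≠ 0))).mul_right
  obtain ⟨C₀, hC₀⟩ := hudec.bound []
  obtain ⟨C₁, hC₁⟩ := (hudec.iterate_negLap j).bound []
  simp only [iterPd] at hC₀ hC₁
  have hB0 : 0 ≤ B := (norm_nonneg _).trans (hB 0)
  have hC₀0 : 0 ≤ C₀ := by have := (norm_nonneg _).trans (hC₀ 0 0); simpa using this
  have hexp : ∀ x, Real.exp (τ * g x) * Real.exp (-(σ * ‖x‖))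
      ≤ Real.exp (τ * g 0) * Real.exp (-‖x‖) := fun x => by
    rw [← Real.exp_add, ← Real.exp_add, Real.exp_le_exp]
    have h1 := (abs_le.1 (hgL x 0)).2
    rw [sub_zero] at h1
    have h2 := mul_le_mul_of_nonneg_left h1 hτ
    rw [hσ]; linarith
  have hsq : ∀ (x : RSpace d) (y : ℂ) (M : ℝ), ‖y‖ ≤ M * Real.exp (-(σ * ‖x‖)) →
      Real.exp (τ * g x) ^ 2 * ‖y‖ ^ 2 ≤ (M * Real.exp (τ * g 0)) ^ 2 * Real.exp (-‖x‖) := by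
    intro x y M hy
    have hM : 0 ≤ M := by
      by_contra hneg
      have := (norm_nonneg y).trans hy
      nlinarith [Real.exp_pos (-(σ * ‖x‖))]
    have h1 : Real.exp (τ * g x) * ‖y‖ ≤ M * Real.exp (τ * g 0) * Real.exp (-‖x‖) := by
      calc _ ≤ Real.exp (τ * g x) * (M * Real.exp (-(σ * ‖x‖))) := by gcongr
        _ = M * (Real.exp (τ * g x) * Real.exp (-(σ * ‖x‖))) := by ring
        _ ≤ M * (Real.exp (τ * g 0) * Real.exp (-‖x‖)) := mul_le_mul_of_nonneg_left (hexp x) hM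
        _ = _ := by ring
    have h2 : Real.exp (-‖x‖) ^ 2 ≤ Real.exp (-‖x‖) :=
      pow_le_of_le_one (Real.exp_pos _).le (Real.exp_le_one_iff.2 (by simp)) two_ne_zero
    calc _ = (Real.exp (τ * g x) * ‖y‖) ^ 2 := by ring
      _ ≤ (M * Real.exp (τ * g 0) * Real.exp (-‖x‖)) ^ 2 := by gcongr
      _ = (M * Real.exp (τ * g 0)) ^ 2 * Real.exp (-‖x‖) ^ 2 := by ring
      _ ≤ _ := by gcongr
  -- Equality on a neighbourhood, not just at the point, so that the iterated Laplacians agree there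
  -- too.
  have hev : ∀ x, ∀ᶠ n : ℕ in atTop, u n =ᶠ[nhds x] f := by
    intro x
    filter_upwards [eventually_gt_atTop ⌈‖x‖⌉₊] with n hn
    have hn' : ‖x‖ < n := (Nat.le_ceil _).trans_lt (by exact_mod_cast hn)
    have : ∀ᶠ y in nhds x, ‖y‖ < n :=
      continuous_norm.continuousAt.eventually (gt_mem_nhds hn')
    filter_upwards [this] with y hy
    have h1 : bump (((n : ℝ) + 1)⁻¹ • y) = 1 := by
      refine bump.one_of_mem_closedBall ?_
      rw [mem_closedBall_zero_iff, norm_smul, Real.norm_of_nonneg (by positivity),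
        inv_mul_le_iff₀ (by positivity)]
      change ‖y‖ ≤ ((n : ℝ) + 1) * 1
      linarith
    simp [hu, hχ, h1]
  have hfs := (hf 0 le_rfl).smooth 0
  have hjs : ∀ {v : RSpace d → ℂ}, ContDiff ℝ ∞ v → Continuous (negLap^[j] v) := by
    intro v hv
    exact (hv.iterate_negLap j).continuous
  have t₁ : Tendsto (fun n => ∫ x, m x ^ j * Real.exp (τ * g x) ^ 2 * ‖u n x‖ ^ 2) atTop
      (nhds (∫ x, m x ^ j * Real.exp (τ * g x) ^ 2 * ‖f x‖ ^ 2)) := by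
    refine tendsto_integral_of_dominated_convergence
      (fun x => (C₀ * Real.exp (τ * g 0)) ^ 2 * Real.exp (-‖x‖)) (fun n => ?_)
      (integrable_exp_neg_norm.const_mul _) (fun n => Eventually.of_forall fun x => ?_)
      (Eventually.of_forall fun x => ?_)
    · have := (hudec.smooth n).continuous
      exact Continuous.aestronglyMeasurable (by fun_prop)
    · have h0 := (hm0 x).le
      rw [Real.norm_of_nonneg (by positivity), mul_assoc]
      refine le_trans ?_ (hsq x _ C₀ (hC₀ n x))
      exact mul_le_of_le_one_left (by positivity) (pow_le_one₀ h0 (hm1 x))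
    · refine tendsto_const_nhds.congr' ?_
      filter_upwards [hev x] with n hn
      rw [hn.eq_of_nhds]
  have t₂ : Tendsto (fun n => ∫ x, Real.exp (τ * g x) ^ 2
        * ‖(negLap^[j] (u n)) x - Z x * u n x‖ ^ 2) atTop
      (nhds (∫ x, Real.exp (τ * g x) ^ 2 * ‖(negLap^[j] f) x - Z x * f x‖ ^ 2)) := by
    refine tendsto_integral_of_dominated_convergence
      (fun x => ((C₁ + B * C₀) * Real.exp (τ * g 0)) ^ 2 * Real.exp (-‖x‖)) (fun n => ?_)
      (integrable_exp_neg_norm.const_mul _) (fun n => Eventually.of_forall fun x => ?_)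
      (Eventually.of_forall fun x => ?_)
    · have := (hudec.smooth n).continuous
      have := hjs (hudec.smooth n)
      exact Continuous.aestronglyMeasurable (by fun_prop)
    · rw [Real.norm_of_nonneg (by positivity)]
      refine hsq x _ _ ((norm_sub_le _ _).trans ?_)
      rw [norm_mul, add_mul, mul_assoc]
      exact add_le_add (hC₁ n x) (mul_le_mul (hB x) (hC₀ n x) (norm_nonneg _) hB0)
    · refine tendsto_const_nhds.congr' ?_
      filter_upwards [hev x] with n hn
      rw [hn.eq_of_nhds, (hn.iterate_negLap j).eq_of_nhds]
  exact le_of_tendsto_of_tendsto' (t₁.const_mul τ) (t₂.const_mul C) fun n =>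
    h (u n) (hudec.smooth n) (huc n)

end Cutoff

/-! ### The weak form of the eigenvalue equation -/

section WeakForm

variable {d : ℕ}

open LineDeriv in
theorem fourier_toSchwartzMap_negLap {η : RSpace d → ℂ} (hη : ContDiff ℝ ∞ η)
    (hc : HasCompactSupport η) (ξ : RSpace d) :
    𝓕 (hc.negLap.toSchwartzMap hη.negLap) ξ
      = ((‖(2 * Real.pi) • ξ‖ ^ 2 : ℝ) : ℂ) * 𝓕 (hc.toSchwartzMap hη) ξ := by
  set f := hc.toSchwartzMap hη with hf
  have h1 : hc.negLap.toSchwartzMap hη.negLap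
      = -∑ k : Fin d, ∂_{EuclideanSpace.single k (1 : ℝ)}
          (∂_{EuclideanSpace.single k (1 : ℝ)} f) := by
    ext x
    simp only [neg_apply, sum_apply]
    rfl
  have h2 : ∀ k : Fin d, ∀ g : SchwartzMap (RSpace d) ℂ,
      𝓕 (∂_{EuclideanSpace.single k (1 : ℝ)} g) ξ = 2 * Real.pi * Complex.I * (ξ k) * 𝓕 g ξ := by
    intro k g
    rw [SchwartzMap.fourier_lineDerivOp_eq]
    have : (fun x : RSpace d => inner ℝ x (EuclideanSpace.single k (1 : ℝ))).HasTemperateGrowth :=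
      by fun_prop
    rw [smul_apply, SchwartzMap.smulLeftCLM_apply_apply this]
    simp [EuclideanSpace.inner_single_right]
    ring
  rw [h1, FourierTransform.fourier_neg, FourierTransform.fourier_sum]
  simp only [neg_apply, sum_apply, h2]
  rw [norm_smul, mul_pow, EuclideanSpace.norm_sq_eq]
  push_cast
  rw [Finset.mul_sum, Finset.sum_mul, ← Finset.sum_neg_distrib]
  refine Finset.sum_congr rfl fun k _ => ?_
  have : ((‖ξ k‖ : ℝ) : ℂ) ^ 2 = (ξ k : ℂ) ^ 2 := by
    norm_cast; rw [Real.norm_eq_abs, sq_abs]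
  rw [this, Real.norm_of_nonneg (by positivity)]
  push_cast
  ring_nf
  rw [Complex.I_sq]
  ring

theorem HasCompactSupport.iterate_negLap {f : RSpace d → ℂ} (hf : HasCompactSupport f) (j : ℕ) :
    HasCompactSupport (_root_.negLap^[j] f) := by
  induction j with
  | zero => exact hf
  | succ j ih =>
    simp only [Function.iterate_succ', Function.comp]
    exact ih.negLap

theorem fourier_toSchwartzMap_iterate_negLap {η : RSpace d → ℂ} (hη : ContDiff ℝ ∞ η)
    (hc : HasCompactSupport η) (j : ℕ) (ξ : RSpace d) :
    𝓕 ((hc.iterate_negLap j).toSchwartzMap (hη.iterate_negLap j)) ξ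
      = ((‖(2 * Real.pi) • ξ‖ ^ (2 * j) : ℝ) : ℂ) * 𝓕 (hc.toSchwartzMap hη) ξ := by
  induction j with
  | zero => simp
  | succ j ih =>
    have h := fourier_toSchwartzMap_negLap (hη.iterate_negLap j) (hc.iterate_negLap j) ξ
    rw [ih] at h
    have e : (hc.iterate_negLap (j + 1)).toSchwartzMap (hη.iterate_negLap (j + 1))
        = (hc.iterate_negLap j).negLap.toSchwartzMap (hη.iterate_negLap j).negLap := by
      ext x
      change (negLap^[j + 1] η) x = negLap (negLap^[j] η) x
      rw [Function.iterate_succ', Function.comp]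
    rw [e, h]
    push_cast
    ring

set_option maxHeartbeats 2000000 in
-- By Parseval the real symbol `|2πξ|^{2j}` moves from the transform of `φ` to that of the test
-- function, where it represents `(-Δ)^j`.
theorem weak_eigenvalue_equation {j : ℕ} {V : RSpace d → ℝ} {lam : ℝ} {φ : L2 d}
    (hφ : IsEigensolution (fun ξ => ‖ξ‖ ^ (2 * j)) V lam φ) {η : RSpace d → ℂ}
    (hη : ContDiff ℝ ∞ η) (hc : HasCompactSupport η) :
    ∫ x, (starRingEnd ℂ) ((negLap^[j] η) x) * φ x
      = ∫ x, (starRingEnd ℂ) (η x) * (((lam - V x : ℝ) : ℂ) * φ x) := by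
  obtain ⟨hdom, heq⟩ := hφ
  set Q : RSpace d → ℝ := fun ξ => ‖ξ‖ ^ (2 * j) with hQ
  set F : L2 d := symbolOp Q ⟨φ, hdom⟩ with hF
  set s := hc.toSchwartzMap hη with hs
  set t := (hc.iterate_negLap j).toSchwartzMap (hη.iterate_negLap j) with ht
  have hFF : 𝓕 F = symbolMulLp Q ⟨φ, hdom⟩ := by
    rw [hF]
    exact FourierTransform.fourier_fourierInv_eq _
  have h1 : inner ℂ (s.toLp 2) F = inner ℂ (t.toLp 2 : L2 d) φ := by
    have a1 : inner ℂ (𝓕 (s.toLp 2 : L2 d)) (𝓕 F) = inner ℂ (s.toLp 2 : L2 d) F :=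
      Lp.inner_fourier_eq _ _
    have a2 : inner ℂ (𝓕 (t.toLp 2 : L2 d)) (𝓕 φ) = inner ℂ (t.toLp 2 : L2 d) φ :=
      Lp.inner_fourier_eq _ _
    rw [← a1, ← a2, SchwartzMap.toLp_fourier_eq, SchwartzMap.toLp_fourier_eq, hFF, L2.inner_def, L2.inner_def]
    refine integral_congr_ae ?_
    filter_upwards [(𝓕 s).coeFn_toLp 2 volume, (𝓕 t).coeFn_toLp 2 volume,
      MemLp.coeFn_toLp (μ := volume) (f := symbolMul Q φ) hdom] with ξ e1 e2 e3
    have e3' : (symbolMulLp Q ⟨φ, hdom⟩ : L2 d) ξ = symbolMul Q φ ξ := e3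
    rw [e1, e2, e3', fourier_toSchwartzMap_iterate_negLap hη hc j ξ, symbolMul]
    simp only [hQ, RCLike.inner_apply, map_mul, Complex.conj_ofReal]
    ring
  rw [L2.inner_def, L2.inner_def] at h1
  have h2 : ∫ x, inner ℂ ((s.toLp 2 : L2 d) x) (F x)
      = ∫ x, (starRingEnd ℂ) (η x) * (((lam - V x : ℝ) : ℂ) * φ x) := by
    refine integral_congr_ae ?_
    filter_upwards [s.coeFn_toLp 2 volume, heq] with x e1 e2
    rw [e1, RCLike.inner_apply]
    have : F x = ((lam - V x : ℝ) : ℂ) * φ x := by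
      push_cast
      rw [sub_mul, ← e2]; ring
    rw [this, mul_comm]
    rfl
  have h3 : ∫ x, inner ℂ ((t.toLp 2 : L2 d) x) (φ x)
      = ∫ x, (starRingEnd ℂ) ((negLap^[j] η) x) * φ x := by
    refine integral_congr_ae ?_
    filter_upwards [t.coeFn_toLp 2 volume] with x e1
    rw [e1, RCLike.inner_apply, mul_comm]
    rfl
  rw [← h2, ← h3, h1]

end WeakForm

/-! ### Mollification -/

section Mollification

variable {d : ℕ}

/-- The convolution of a real kernel with a complex function. -/
def moll (η : RSpace d → ℝ) (φ : RSpace d → ℂ) (x : RSpace d) : ℂ :=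
  ∫ y, η (x - y) • φ y

theorem moll_eq_convolution (η : RSpace d → ℝ) (φ : RSpace d → ℂ) :
    moll η φ = convolution η φ (ContinuousLinearMap.lsmul ℝ ℝ) volume := by
  ext x
  exact (convolution_lsmul_swap (𝕜 := ℝ)).symm

theorem exists_abs_le_of_hasCompactSupport {η : RSpace d → ℝ} (hη : Continuous η)
    (hc : HasCompactSupport η) : ∃ M : ℝ, ∀ x, |η x| ≤ M :=
  hc.exists_bound_of_continuous hη

theorem integrable_kernel_smul {F : Type*} [NormedAddCommGroup F] [NormedSpace ℝ F]
    {η : RSpace d → ℝ} (hη : Continuous η)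
    (hc : HasCompactSupport η) {φ : RSpace d → F} (hφ : Integrable φ) (x : RSpace d) :
    Integrable fun y => η (x - y) • φ y := by
  obtain ⟨M, hM⟩ := exists_abs_le_of_hasCompactSupport hη hc
  exact hφ.bdd_smul (φ := fun y => η (x - y)) M
    (Continuous.aestronglyMeasurable (by fun_prop)) (Eventually.of_forall fun y => hM _)

theorem contDiff_moll {η : RSpace d → ℝ} (hη : ContDiff ℝ ∞ η) (hc : HasCompactSupport η)
    {φ : RSpace d → ℂ} (hφ : Integrable φ) : ContDiff ℝ ∞ (moll η φ) := by
  rw [moll_eq_convolution]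
  exact hc.contDiff_convolution_left _ hη hφ.locallyIntegrable

theorem pd_moll {η : RSpace d → ℝ} (hη : ContDiff ℝ ∞ η) (hc : HasCompactSupport η)
    {φ : RSpace d → ℂ} (hφ : Integrable φ) (k : Fin d) :
    pd k (moll η φ) = moll (pd k η) φ := by
  ext x
  have h := hc.hasFDerivAt_convolution_left (ContinuousLinearMap.lsmul ℝ ℝ)
    (μ := (volume : Measure (RSpace d))) (hη.of_le (by simp)) hφ.locallyIntegrable x
  rw [moll_eq_convolution, moll_eq_convolution, pd, h.fderiv]
  have hex := (hc.fderiv (𝕜 := ℝ)).convolutionExists_left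
    ((ContinuousLinearMap.lsmul ℝ ℝ : ℝ →L[ℝ] ℂ →L[ℝ] ℂ).precompL (RSpace d))
    (μ := (volume : Measure (RSpace d)))
    (hη.fderiv_right (m := ∞) (by simp)).continuous hφ.locallyIntegrable x
  rw [convolution_def, convolution_def, ContinuousLinearMap.integral_apply hex]
  rfl

theorem iterPd_moll (l : List (Fin d)) {η : RSpace d → ℝ} (hη : ContDiff ℝ ∞ η)
    (hc : HasCompactSupport η) {φ : RSpace d → ℂ} (hφ : Integrable φ) :
    iterPd l (moll η φ) = moll (iterPd l η) φ := by
  induction l generalizing η with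
  | nil => rfl
  | cons k l ih =>
    simp only [iterPd]
    rw [pd_moll hη hc hφ, ih (hη.pd k) (hc.pd k)]

theorem negLap_moll {η : RSpace d → ℝ} (hη : ContDiff ℝ ∞ η) (hc : HasCompactSupport η)
    {φ : RSpace d → ℂ} (hφ : Integrable φ) :
    negLap (moll η φ) = moll (negLap η) φ := by
  ext x
  have h : ∀ k, pd k (pd k (moll η φ)) x = moll (pd k (pd k η)) φ x := fun k => by
    rw [pd_moll hη hc hφ, pd_moll (hη.pd k) (hc.pd k) hφ]
  simp only [negLap, lap, h, moll, neg_smul, Finset.sum_smul]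
  rw [integral_neg, integral_finsetSum _ fun k _ =>
    integrable_kernel_smul ((hη.pd k).pd k).continuous ((hc.pd k).pd k) hφ x]

theorem iterate_negLap_moll (j : ℕ) {η : RSpace d → ℝ} (hη : ContDiff ℝ ∞ η)
    (hc : HasCompactSupport η) {φ : RSpace d → ℂ} (hφ : Integrable φ) :
    negLap^[j] (moll η φ) = moll (negLap^[j] η) φ := by
  induction j generalizing η with
  | zero => rfl
  | succ j ih =>
    simp only [Function.iterate_succ, Function.comp]
    rw [negLap_moll hη hc hφ, ih hη.negLap hc.negLap]

/-- All derivatives fall on the kernel. If its support lies in the ball of radius `r`, only `|x| ≤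
|y| + r` contributes, so the decay of `φ` transfers at the price of `e^{σr}`. -/
theorem decayFamily_moll {η : RSpace d → ℝ} (hη : ContDiff ℝ ∞ η) (hc : HasCompactSupport η)
    {φ : RSpace d → ℂ} {σ : ℝ} (hσ : 0 ≤ σ) (hφ : Integrable φ)
    (hφσ : Integrable fun y => Real.exp (σ * ‖y‖) * ‖φ y‖) :
    DecayFamily σ fun _ : ℕ => moll η φ := by
  refine ⟨fun _ => contDiff_moll hη hc hφ, fun l => ?_⟩
  have hs : ∀ (l : List (Fin d)) {η : RSpace d → ℝ}, ContDiff ℝ ∞ η → HasCompactSupport η →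
      Continuous (iterPd l η) ∧ HasCompactSupport (iterPd l η) := by
    intro l
    induction l with
    | nil => exact fun h1 h2 => ⟨h1.continuous, h2⟩
    | cons k l ih => exact fun h1 h2 => ih (h1.pd k) (h2.pd k)
  obtain ⟨h1, h2⟩ := hs l hη hc
  obtain ⟨M, hM⟩ := exists_abs_le_of_hasCompactSupport h1 h2
  obtain ⟨r, hr⟩ := h2.isCompact.isBounded.subset_closedBall 0
  have hM0 : 0 ≤ M := (abs_nonneg _).trans (hM 0)
  refine ⟨M * Real.exp (σ * r) * ∫ y, Real.exp (σ * ‖y‖) * ‖φ y‖, fun _ x => ?_⟩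
  rw [iterPd_moll l hη hc hφ, moll]
  refine (norm_integral_le_integral_norm _).trans ?_
  rw [mul_right_comm, ← integral_const_mul]
  refine integral_mono_of_nonneg (Eventually.of_forall fun y => norm_nonneg _)
    (hφσ.const_mul _) (Eventually.of_forall fun y => ?_)
  simp only
  rw [norm_smul, Real.norm_eq_abs, ← mul_assoc]
  refine mul_le_mul_of_nonneg_right ?_ (norm_nonneg _)
  by_cases hxy : x - y ∈ tsupport (iterPd l η)
  · have h3 : ‖x - y‖ ≤ r := by simpa using hr hxy
    have h4 : ‖x‖ ≤ r + ‖y‖ := by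
      calc ‖x‖ = ‖(x - y) + y‖ := by simp
        _ ≤ _ := (norm_add_le _ _).trans (by linarith)
    rw [mul_assoc, mul_assoc, ← Real.exp_add, ← Real.exp_add]
    have h5 : 1 ≤ Real.exp (σ * r + (-(σ * ‖x‖) + σ * ‖y‖)) := by
      rw [Real.one_le_exp_iff]
      have := mul_le_mul_of_nonneg_left h4 hσ
      linarith
    exact (hM _).trans (le_mul_of_one_le_right hM0 h5)
  · rw [image_eq_zero_of_notMem_tsupport hxy, abs_zero]
    positivity

theorem pd_comp_sub {η : RSpace d → ℝ} (k : Fin d) (x y : RSpace d) :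
    pd k (fun y => η (x - y)) y = -pd k η (x - y) := by
  have h : (fun y => η (x - y)) = fun y => (fun z => η (x + z)) ((-1 : ℝ) • y) := by
    funext y; simp [sub_eq_add_neg]
  simp only [pd]
  rw [h, fderiv_comp_smul (f := fun z => η (x + z)), fderiv_comp_add_left]
  simp [sub_eq_add_neg]

theorem negLap_comp_sub (η : RSpace d → ℝ) (x : RSpace d) :
    negLap (fun y => η (x - y)) = fun y => negLap η (x - y) := by
  ext y
  simp only [negLap, lap]
  congr 1
  refine Finset.sum_congr rfl fun k _ => ?_
  rw [show pd k (fun y => η (x - y)) = _ from funext fun y => pd_comp_sub k x y, pd_neg,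
    pd_comp_sub, neg_neg]

theorem iterate_negLap_comp_sub (j : ℕ) (η : RSpace d → ℝ) (x : RSpace d) :
    negLap^[j] (fun y => η (x - y)) = fun y => (negLap^[j] η) (x - y) := by
  induction j generalizing η with
  | zero => rfl
  | succ j ih =>
    simp only [Function.iterate_succ, Function.comp]
    rw [negLap_comp_sub, ih]

theorem iterate_negLap_ofReal (j : ℕ) {η : RSpace d → ℝ} (hη : ContDiff ℝ ∞ η) :
    negLap^[j] (fun y => (η y : ℂ)) = fun y => (((negLap^[j] η) y : ℝ) : ℂ) := by
  induction j generalizing η with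
  | zero => rfl
  | succ j ih =>
    simp only [Function.iterate_succ, Function.comp]
    rw [← ih hη.negLap]
    congr 1
    have h1 : ∀ {f : RSpace d → ℝ}, ContDiff ℝ ∞ f → ∀ k,
        pd k (fun x => (f x : ℂ)) = fun x => ((pd k f x : ℝ) : ℂ) := fun {f} hf k =>
      funext fun x => pd_clm_comp Complex.ofRealCLM k (hf.differentiable (by simp) x)
    ext y
    simp only [negLap, lap, h1 hη, h1 (hη.pd _)]
    push_cast
    rfl

/-- This is the weak equation tested with `y ↦ η (x - y)`; the reflection does not affect the
Laplacian. -/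
theorem iterate_negLap_moll_eq {j : ℕ} {V : RSpace d → ℝ} {lam : ℝ} {φ : L2 d}
    (hφ : IsEigensolution (fun ξ => ‖ξ‖ ^ (2 * j)) V lam φ) (hint : Integrable φ)
    {η : RSpace d → ℝ} (hη : ContDiff ℝ ∞ η) (hc : HasCompactSupport η) (x : RSpace d) :
    (negLap^[j] (moll η φ)) x = moll η (fun y => ((lam - V y : ℝ) : ℂ) * φ y) x := by
  have hηx : ContDiff ℝ ∞ fun y => η (x - y) := hη.comp (contDiff_const.sub contDiff_id)
  have hcx : HasCompactSupport fun y => η (x - y) :=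
    hc.comp_homeomorph (Homeomorph.subLeft x)
  have h := weak_eigenvalue_equation hφ (η := fun y => ((η (x - y) : ℝ) : ℂ))
    (Complex.ofRealCLM.contDiff.comp hηx) (hcx.comp_left (g := Complex.ofReal) rfl)
  rw [iterate_negLap_ofReal j hηx, iterate_negLap_comp_sub] at h
  simp only [Complex.conj_ofReal] at h
  rw [iterate_negLap_moll j hη hc hint]
  simpa only [moll, Complex.real_smul] using h

end Mollification

/-! ### Vanishing of superexponentially decaying eigenfunctions -/

section Vanishing

variable {d : ℕ}

/-- Jensen's inequality for the probability density `ρ (x - ·)`, obtained from the nonnegativity of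
the variance. -/
theorem sq_integral_kernel_le {ρ h : RSpace d → ℝ} (hρ : Continuous ρ) (hc : HasCompactSupport ρ)
    (hρ0 : ∀ x, 0 ≤ ρ x) (hρ1 : ∫ x, ρ x = 1) (hh : Integrable h)
    (hh2 : Integrable fun y => h y ^ 2) (x : RSpace d) :
    (∫ y, ρ (x - y) * h y) ^ 2 ≤ ∫ y, ρ (x - y) * h y ^ 2 := by
  set c := ∫ y, ρ (x - y) * h y with hc_def
  have i0 : Integrable fun y => ρ (x - y) :=
    (hρ.integrable_of_hasCompactSupport (μ := volume) hc).comp_sub_left x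
  have i1 : Integrable fun y => ρ (x - y) * h y := integrable_kernel_smul hρ hc hh x
  have i2 : Integrable fun y => ρ (x - y) * h y ^ 2 := integrable_kernel_smul hρ hc hh2 x
  have h1 : ∫ y, ρ (x - y) = 1 := by rw [integral_sub_left_eq_self ρ volume x, hρ1]
  have h2 : 0 ≤ ∫ y, ρ (x - y) * (h y - c) ^ 2 :=
    integral_nonneg fun y => mul_nonneg (hρ0 _) (sq_nonneg _)
  have h3 : ∫ y, ρ (x - y) * (h y - c) ^ 2
      = (∫ y, ρ (x - y) * h y ^ 2) - 2 * c * c + c ^ 2 * 1 := by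
    have e : ∀ y, ρ (x - y) * (h y - c) ^ 2
        = (ρ (x - y) * h y ^ 2 - 2 * c * (ρ (x - y) * h y)) + c ^ 2 * ρ (x - y) := fun y => by ring
    simp only [e]
    have i12 : Integrable fun y => ρ (x - y) * h y ^ 2 - 2 * c * (ρ (x - y) * h y) :=
      i2.sub (i1.const_mul _)
    rw [integral_add i12 (i0.const_mul _),
      integral_sub i2 (i1.const_mul _), integral_const_mul, integral_const_mul, h1]
  rw [h3] at h2
  linarith

/-- The weight varies by a factor at most `E` across the support of the kernel, so it can be moved
inside the average before Jensen's inequality is used. -/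
theorem weighted_sq_integral_kernel_le {ρ h e : RSpace d → ℝ} {E : ℝ} (hρ : Continuous ρ)
    (hc : HasCompactSupport ρ) (hρ0 : ∀ x, 0 ≤ ρ x) (hρ1 : ∫ x, ρ x = 1)
    (hh0 : ∀ y, 0 ≤ h y) (he0 : ∀ y, 0 ≤ e y)
    (heh : Integrable fun y => e y * h y)
    (heh2 : Integrable fun y => (e y * h y) ^ 2)
    (hE : ∀ x y, ρ (x - y) ≠ 0 → e x ≤ E * e y) (x : RSpace d) :
    e x ^ 2 * (∫ y, ρ (x - y) * h y) ^ 2 ≤ E ^ 2 * ∫ y, ρ (x - y) * (e y * h y) ^ 2 := by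
  have h1 : e x * ∫ y, ρ (x - y) * h y ≤ E * ∫ y, ρ (x - y) * (e y * h y) := by
    rw [← integral_const_mul, ← integral_const_mul]
    refine integral_mono_of_nonneg (Eventually.of_forall fun y =>
      mul_nonneg (he0 x) (mul_nonneg (hρ0 _) (hh0 y)))
      ((integrable_kernel_smul hρ hc heh x).const_mul E) (Eventually.of_forall fun y => ?_)
    simp only
    by_cases hz : ρ (x - y) = 0
    · simp [hz]
    · have := mul_le_mul_of_nonneg_right (hE x y hz) (mul_nonneg (hρ0 (x - y)) (hh0 y))
      linarith
  have h0 : 0 ≤ e x * ∫ y, ρ (x - y) * h y :=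
    mul_nonneg (he0 x) (integral_nonneg fun y => mul_nonneg (hρ0 _) (hh0 y))
  have h2 := pow_le_pow_left₀ h0 h1 2
  rw [mul_pow, mul_pow] at h2
  exact h2.trans (mul_le_mul_of_nonneg_left (sq_integral_kernel_le hρ hc hρ0 hρ1 heh heh2 x)
    (sq_nonneg E))

theorem integrable_and_integral_kernel {ρ k : RSpace d → ℝ} (hρ : Integrable ρ)
    (hρ1 : ∫ x, ρ x = 1) (hk : Integrable k) :
    Integrable (fun x => ∫ y, ρ (x - y) * k y) ∧ ∫ x, ∫ y, ρ (x - y) * k y = ∫ y, k y := by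
  have e : (fun x => ∫ y, ρ (x - y) * k y)
      = convolution ρ k (ContinuousLinearMap.lsmul ℝ ℝ) volume := by
    ext x
    exact (convolution_lsmul_swap (𝕜 := ℝ)).symm
  refine ⟨by rw [e]; exact hρ.integrable_convolution _ hk, ?_⟩
  rw [e, integral_convolution _ hρ hk, hρ1]
  simp

theorem integral_le_of_ae_tendsto {α : Type*} [MeasurableSpace α] {μ : Measure α}
    {f : ℕ → α → ℝ} {g : α → ℝ} (hf : ∀ n, Integrable (f n) μ) (hf0 : ∀ n x, 0 ≤ f n x)
    (hg : Integrable g μ) (hg0 : ∀ x, 0 ≤ g x)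
    (hlim : ∀ᵐ x ∂μ, Tendsto (fun n => f n x) atTop (nhds (g x))) {b : ℕ → ℝ} {B : ℝ}
    (hb : ∀ n, ∫ x, f n x ∂μ ≤ b n) (hB : Tendsto b atTop (nhds B)) : ∫ x, g x ∂μ ≤ B := by
  have hB0 : 0 ≤ B := ge_of_tendsto' hB fun n => (integral_nonneg (hf0 n)).trans (hb n)
  rw [← ENNReal.ofReal_le_ofReal_iff hB0,
    ofReal_integral_eq_lintegral_ofReal hg (Eventually.of_forall hg0)]
  calc ∫⁻ x, ENNReal.ofReal (g x) ∂μ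
      = ∫⁻ x, liminf (fun n => ENNReal.ofReal (f n x)) atTop ∂μ := by
        refine lintegral_congr_ae ?_
        filter_upwards [hlim] with x hx
        exact ((ENNReal.continuous_ofReal.tendsto _).comp hx).liminf_eq.symm
    _ ≤ liminf (fun n => ∫⁻ x, ENNReal.ofReal (f n x) ∂μ) atTop :=
        lintegral_liminf_le' fun n => (hf n).aemeasurable.ennreal_ofReal
    _ ≤ liminf (fun n => ENNReal.ofReal (b n)) atTop := by
        refine liminf_le_liminf (Eventually.of_forall fun n => ?_)
        rw [← ofReal_integral_eq_lintegral_ofReal (hf n) (Eventually.of_forall (hf0 n))]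
        exact ENNReal.ofReal_le_ofReal (hb n)
    _ = ENNReal.ofReal B := ((ENNReal.continuous_ofReal.tendsto _).comp hB).liminf_eq

/-- Square integrability follows by comparison with an admissible larger rate. Integrability follows
by giving up one unit of the rate: `ab ≤ a + b²` with `a = e^{-|x|} ≤ 1`. -/
theorem memLp_exp_of_criticalDecayRate_eq_top {φ : L2 d} (h : criticalDecayRate φ = ⊤)
    {σ : ℝ} (hσ : 0 ≤ σ) :
    Integrable (fun x => Real.exp (σ * ‖x‖) * ‖φ x‖) ∧
      Integrable (fun x => (Real.exp (σ * ‖x‖) * ‖φ x‖) ^ 2) := by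
  have hφm : AEStronglyMeasurable φ (volume : Measure (RSpace d)) := Lp.aestronglyMeasurable φ
  have key : ∀ σ : ℝ, 0 ≤ σ → Integrable (fun x => (Real.exp (σ * ‖x‖) * ‖φ x‖) ^ 2) := by
    intro σ hσ
    have h1 : ((σ.toNNReal : ℝ≥0) : ℝ≥0∞) < criticalDecayRate φ := by
      rw [h]; exact ENNReal.coe_lt_top
    obtain ⟨s, ⟨σ', rfl, hmem⟩, hlt⟩ := lt_sSup_iff.1 h1
    have hle : σ ≤ σ' := by
      have := ENNReal.coe_lt_coe.1 hlt
      rw [← Real.coe_toNNReal σ hσ]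
      exact_mod_cast this.le
    have h2 := hmem.integrable_norm_pow two_ne_zero
    refine h2.mono' ?_ (Eventually.of_forall fun x => ?_)
    · exact ((Continuous.aestronglyMeasurable (by fun_prop)).mul hφm.norm).pow 2
    · rw [Real.norm_of_nonneg (by positivity), norm_mul, Complex.norm_real,
        Real.norm_of_nonneg (Real.exp_pos _).le]
      gcongr
  refine ⟨?_, key σ hσ⟩
  refine (integrable_exp_neg_norm.add (key (σ + 1) (by linarith))).mono'
    ((Continuous.aestronglyMeasurable (by fun_prop)).mul hφm.norm) (Eventually.of_forall fun x => ?_)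
  rw [Real.norm_of_nonneg (by positivity)]
  set a := Real.exp (-‖x‖) with ha
  set b := Real.exp ((σ + 1) * ‖x‖) * ‖φ x‖ with hb
  have e : Real.exp (σ * ‖x‖) * ‖φ x‖ = a * b := by
    rw [ha, hb, ← mul_assoc, ← Real.exp_add]; congr 2; ring
  have ha1 : a ≤ 1 := Real.exp_le_one_iff.2 (by simp)
  have ha0 : 0 < a := Real.exp_pos _
  rw [e]
  change a * b ≤ a + b ^ 2
  nlinarith [sq_nonneg (b - a / 2), sq_nonneg b]

/-- The Carleman inequality is applied to `ρ_n * φ`. There `(-Δ)^j - Z` gives `ρ_n * ((λ - V - Z)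
φ)` plus the commutator of the convolution with `Z`, which is `O(r_n)` because `Z` is Lipschitz. In
the limit `τ I ≤ 2C² I`. -/
theorem eq_zero_of_superexponential_decay {j : ℕ} {V : RSpace d → ℝ} {lam : ℝ} {φ : L2 d}
    {m g : RSpace d → ℝ} {Z : RSpace d → ℂ} {L C B τ₀ : ℝ}
    (hVm : Measurable V)
    (hm : Continuous m) (hm0 : ∀ x, 0 < m x) (hm1 : ∀ x, m x ≤ 1)
    (hg : Continuous g) (hL : 0 ≤ L) (hgL : ∀ x y, |g x - g y| ≤ L * ‖x - y‖)
    (hZ : Continuous Z) (hZL : ∀ x y, ‖Z x - Z y‖ ≤ L * ‖x - y‖) (hB : ∀ x, ‖Z x‖ ≤ B)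
    (hC : 0 ≤ C) (hVZ : ∀ x, ‖((lam - V x : ℝ) : ℂ) - Z x‖ ^ 2 ≤ C * m x ^ j)
    (hCar : ∀ τ, τ₀ ≤ τ → CarlemanInequality j C τ m (fun x => Real.exp (τ * g x)) Z)
    (hφ : IsEigensolution (fun ξ => ‖ξ‖ ^ (2 * j)) V lam φ)
    (hdecay : ∀ σ : ℝ, 0 ≤ σ → Integrable (fun x => Real.exp (σ * ‖x‖) * ‖φ x‖) ∧
      Integrable (fun x => (Real.exp (σ * ‖x‖) * ‖φ x‖) ^ 2)) : φ = 0 := by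
  have hφm : AEStronglyMeasurable φ (volume : Measure (RSpace d)) := Lp.aestronglyMeasurable φ
  have hφi : Integrable φ := by
    refine (integrable_norm_iff hφm).1 ?_
    simpa using (hdecay 0 le_rfl).1
  -- One `C` comes from the Carleman inequality, one from `|λ - V - Z|² ≤ C m^j`, and the `2` from
  -- splitting off the commutator. The extra `1` makes the final inequality strict unless `I = 0`.
  set τ := max τ₀ (2 * C ^ 2 + 1) with hτ
  have hτ0 : 0 ≤ τ := le_trans (by positivity) (le_max_right _ _)
  set e : RSpace d → ℝ := fun x => Real.exp (τ * g x) with he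
  have he0 : ∀ x, 0 < e x := fun x => Real.exp_pos _
  have hec : Continuous e := by fun_prop
  have heL : ∀ x y, e x ≤ Real.exp (τ * (L * ‖x - y‖)) * e y := fun x y => by
    simp only [he]
    rw [← Real.exp_add, Real.exp_le_exp]
    have := mul_le_mul_of_nonneg_left (abs_le.1 (hgL x y)).2 hτ0
    linarith
  have hexp : ∀ x, e x ≤ e 0 * Real.exp (τ * L * ‖x‖) := fun x => by
    have := heL x 0
    rw [sub_zero, ← mul_assoc] at this
    linarith
  have hτL : 0 ≤ τ * L := by positivity
  have i1 : Integrable fun x => e x * ‖φ x‖ := by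
    refine ((hdecay _ hτL).1.const_mul (e 0)).mono' (hec.aestronglyMeasurable.mul hφm.norm)
      (Eventually.of_forall fun x => ?_)
    rw [Real.norm_of_nonneg (mul_nonneg (he0 x).le (norm_nonneg _)), ← mul_assoc]
    exact mul_le_mul_of_nonneg_right (hexp x) (norm_nonneg _)
  have i2 : Integrable fun x => (e x * ‖φ x‖) ^ 2 := by
    refine ((hdecay _ hτL).2.const_mul (e 0 ^ 2)).mono'
      ((hec.aestronglyMeasurable.mul hφm.norm).pow 2) (Eventually.of_forall fun x => ?_)
    rw [Real.norm_of_nonneg (sq_nonneg _), ← mul_pow, ← mul_assoc]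
    exact pow_le_pow_left₀ (mul_nonneg (he0 x).le (norm_nonneg _))
      (mul_le_mul_of_nonneg_right (hexp x) (norm_nonneg _)) 2
  have i3 : Integrable fun x => m x ^ j * e x ^ 2 * ‖φ x‖ ^ 2 := by
    refine i2.mono' (((hm.pow j).mul (hec.pow 2)).aestronglyMeasurable.mul (hφm.norm.pow 2))
      (Eventually.of_forall fun x => ?_)
    have := (hm0 x).le
    rw [Real.norm_of_nonneg (by positivity), mul_pow, mul_assoc]
    exact mul_le_of_le_one_left (by positivity) (pow_le_one₀ this (hm1 x))
  set I := ∫ x, m x ^ j * e x ^ 2 * ‖φ x‖ ^ 2 with hI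
  set J := ∫ x, (e x * ‖φ x‖) ^ 2 with hJ
  -- The outer radius is twice the inner one; a bounded ratio is what almost everywhere convergence
  -- of the mollifications requires.
  set r : ℕ → ℝ := fun n => 2 / ((n : ℝ) + 1) with hr
  have hr0 : ∀ n, 0 < r n := fun n => by positivity
  let bump : ℕ → ContDiffBump (0 : RSpace d) := fun n =>
    ⟨1 / ((n : ℝ) + 1), r n, by positivity, by
      simp only [hr]; gcongr; norm_num⟩
  have hrlim : Tendsto r atTop (nhds 0) :=
    tendsto_const_nhds.div_atTop (tendsto_natCast_atTop_atTop.atTop_add tendsto_const_nhds)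
  set ρ : ℕ → RSpace d → ℝ := fun n => (bump n).normed volume with hρ
  have hρs : ∀ n, ContDiff ℝ ∞ (ρ n) := fun n => (bump n).contDiff_normed
  have hρcont : ∀ n, Continuous (ρ n) := fun n => (hρs n).continuous
  have hρc : ∀ n, HasCompactSupport (ρ n) := fun n => (bump n).hasCompactSupport_normed
  have hρ0 : ∀ n x, 0 ≤ ρ n x := fun n x => (bump n).nonneg_normed x
  have hρ1 : ∀ n, ∫ x, ρ n x = 1 := fun n => (bump n).integral_normed
  have hρi : ∀ n, Integrable (ρ n) := fun n => (bump n).integrable_normed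
  have hρr : ∀ n x y, ρ n (x - y) ≠ 0 → ‖x - y‖ ≤ r n := fun n x y hne => by
    have : x - y ∈ Function.support (ρ n) := hne
    rw [hρ, (bump n).support_normed_eq, mem_ball_zero_iff] at this
    exact this.le
  set E : ℕ → ℝ := fun n => Real.exp (τ * (L * r n)) with hE
  have hEe : ∀ n x y, ρ n (x - y) ≠ 0 → e x ≤ E n * e y := fun n x y hne => by
    refine (heL x y).trans (mul_le_mul_of_nonneg_right ?_ (he0 y).le)
    simp only [hE]
    rw [Real.exp_le_exp]
    have := hρr n x y hne
    gcongr
  set G : RSpace d → ℂ := fun y => (((lam - V y : ℝ) : ℂ) - Z y) * φ y with hG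
  have hGm : AEStronglyMeasurable G (volume : Measure (RSpace d)) := by
    refine AEStronglyMeasurable.mul ?_ hφm
    exact ((Complex.measurable_ofReal.comp (measurable_const.sub hVm)).sub
      hZ.measurable).aestronglyMeasurable
  have hcoef : ∀ y, ‖((lam - V y : ℝ) : ℂ) - Z y‖ ≤ C + 1 := fun y => by
    have h1 : C * m y ^ j ≤ C := mul_le_of_le_one_right hC (pow_le_one₀ (hm0 y).le (hm1 y))
    nlinarith [hVZ y, sq_nonneg (‖((lam - V y : ℝ) : ℂ) - Z y‖ - 1)]
  have hGle : ∀ y, ‖G y‖ ≤ (C + 1) * ‖φ y‖ := fun y => by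
    simp only [hG]
    rw [norm_mul]
    exact mul_le_mul_of_nonneg_right (hcoef y) (norm_nonneg _)
  have hGsq : ∀ y, ‖G y‖ ^ 2 ≤ C * m y ^ j * ‖φ y‖ ^ 2 := fun y => by
    simp only [hG]
    rw [norm_mul, mul_pow]
    exact mul_le_mul_of_nonneg_right (hVZ y) (sq_nonneg _)
  have hGi : Integrable G := by
    refine (hφi.norm.const_mul (C + 1)).mono' hGm (Eventually.of_forall hGle)
  -- A majorant for the integrand after mollification: the potential error `G` and the commutator
  -- with `Z`.
  set k : ℕ → RSpace d → ℝ := fun n y => ‖G y‖ + L * r n * ‖φ y‖ with hk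
  have hk0 : ∀ n y, 0 ≤ k n y := fun n y => by
    have := (hr0 n).le
    simp only [hk]
    positivity
  have hki : ∀ n, Integrable (k n) := fun n => hGi.norm.add (hφi.norm.const_mul _)
  have hkle : ∀ n y, k n y ≤ (C + 1 + L * r n) * ‖φ y‖ := fun n y => by
    have := hGle y
    simp only [hk]
    linarith
  have hkm : ∀ n, AEStronglyMeasurable (fun y => e y * k n y) (volume : Measure (RSpace d)) :=
    fun n => hec.aestronglyMeasurable.mul (hki n).aestronglyMeasurable
  have hek : ∀ n, Integrable fun y => e y * k n y := fun n => by
    refine (i1.const_mul (C + 1 + L * r n)).mono' (hkm n) (Eventually.of_forall fun y => ?_)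
    rw [Real.norm_of_nonneg (mul_nonneg (he0 y).le (hk0 n y))]
    have := mul_le_mul_of_nonneg_left (hkle n y) (he0 y).le
    linarith
  have hek2le : ∀ n y, (e y * k n y) ^ 2 ≤ 2 * C * (m y ^ j * e y ^ 2 * ‖φ y‖ ^ 2)
      + 2 * (L * r n) ^ 2 * (e y * ‖φ y‖) ^ 2 := fun n y => by
    have h1 : k n y ^ 2 ≤ 2 * ‖G y‖ ^ 2 + 2 * (L * r n * ‖φ y‖) ^ 2 := by
      simp only [hk]
      nlinarith [sq_nonneg (‖G y‖ - L * r n * ‖φ y‖)]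
    have h2 := mul_le_mul_of_nonneg_left (h1.trans (add_le_add_left
      (mul_le_mul_of_nonneg_left (hGsq y) zero_le_two) _)) (sq_nonneg (e y))
    rw [mul_pow]
    linarith
  have hdom : ∀ n, Integrable fun y => 2 * C * (m y ^ j * e y ^ 2 * ‖φ y‖ ^ 2)
      + 2 * (L * r n) ^ 2 * (e y * ‖φ y‖) ^ 2 := fun n => (i3.const_mul _).add (i2.const_mul _)
  have hek2 : ∀ n, Integrable fun y => (e y * k n y) ^ 2 := fun n =>
    (hdom n).mono' ((hkm n).pow 2) (Eventually.of_forall fun y => by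
      rw [Real.norm_of_nonneg (sq_nonneg _)]
      exact hek2le n y)
  have hek2int : ∀ n, ∫ y, (e y * k n y) ^ 2 ≤ 2 * C * I + 2 * (L * r n) ^ 2 * J := fun n => by
    rw [hI, hJ, ← integral_const_mul, ← integral_const_mul,
      ← integral_add (i3.const_mul _) (i2.const_mul _)]
    exact integral_mono (hek2 n) (hdom n) (hek2le n)
  have hcar : ∀ n, τ * ∫ x, m x ^ j * e x ^ 2 * ‖moll (ρ n) φ x‖ ^ 2
      ≤ C * (E n ^ 2 * (2 * C * I + 2 * (L * r n) ^ 2 * J)) := by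
    intro n
    refine ((hCar τ (le_max_left _ _)).of_decay hτ0 hm hm0 hm1 hg hL hgL hZ hB
      (fun σ hσ => decayFamily_moll (hρs n) (hρc n) hσ hφi (hdecay σ hσ).1)).trans ?_
    refine mul_le_mul_of_nonneg_left ?_ hC
    have hpt : ∀ x, ‖(negLap^[j] (moll (ρ n) φ)) x - Z x * moll (ρ n) φ x‖
        ≤ ∫ y, ρ n (x - y) * k n y := by
      intro x
      have hFi : Integrable fun y => ((lam - V y : ℝ) : ℂ) * φ y := by
        have h1 : Integrable fun y => Z y * φ y :=
          hφi.bdd_mul (c := B) hZ.aestronglyMeasurable (Eventually.of_forall hB)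
        refine (hGi.add h1).congr (Eventually.of_forall fun y => ?_)
        simp only [hG, Pi.add_apply]
        ring
      rw [iterate_negLap_moll_eq hφ hφi (hρs n) (hρc n) x, moll, moll, ← integral_const_mul,
        ← integral_sub (integrable_kernel_smul (hρcont n) (hρc n) hFi x)
          ((integrable_kernel_smul (hρcont n) (hρc n) hφi x).const_mul _)]
      refine norm_integral_le_of_norm_le (integrable_kernel_smul (hρcont n) (hρc n) (hki n) x)
        (Eventually.of_forall fun y => ?_)
      have e1 : ρ n (x - y) • (((lam - V y : ℝ) : ℂ) * φ y) - Z x * ρ n (x - y) • φ y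
          = ρ n (x - y) • (G y + (Z y - Z x) * φ y) := by
        simp only [hG, Complex.real_smul]
        ring
      rw [e1, norm_smul, Real.norm_of_nonneg (hρ0 n _)]
      by_cases hz : ρ n (x - y) = 0
      · simp [hz]
      refine mul_le_mul_of_nonneg_left ((norm_add_le _ _).trans (add_le_add_right ?_ _)) (hρ0 n _)
      rw [norm_mul]
      refine mul_le_mul_of_nonneg_right ?_ (norm_nonneg _)
      refine (hZL y x).trans (mul_le_mul_of_nonneg_left ?_ hL)
      rw [norm_sub_rev]
      exact hρr n x y hz
    obtain ⟨hci, hceq⟩ := integrable_and_integral_kernel (hρi n) (hρ1 n) (hek2 n)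
    calc ∫ x, e x ^ 2 * ‖(negLap^[j] (moll (ρ n) φ)) x - Z x * moll (ρ n) φ x‖ ^ 2
        ≤ ∫ x, E n ^ 2 * ∫ y, ρ n (x - y) * (e y * k n y) ^ 2 := by
          refine integral_mono_of_nonneg (Eventually.of_forall fun x => by positivity)
            (hci.const_mul _) (Eventually.of_forall fun x => ?_)
          refine le_trans ?_ (weighted_sq_integral_kernel_le (hρcont n) (hρc n) (hρ0 n) (hρ1 n)
            (hk0 n) (fun y => (he0 y).le) (hek n) (hek2 n) (hEe n) x)
          exact mul_le_mul_of_nonneg_left (pow_le_pow_left₀ (norm_nonneg _) (hpt x) 2)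
            (sq_nonneg _)
      _ = E n ^ 2 * ∫ y, (e y * k n y) ^ 2 := by rw [integral_const_mul, hceq]
      _ ≤ _ := mul_le_mul_of_nonneg_left (hek2int n) (sq_nonneg _)
  have hfi : ∀ n, Integrable fun x => m x ^ j * e x ^ 2 * ‖moll (ρ n) φ x‖ ^ 2 := by
    intro n
    obtain ⟨hci, -⟩ := integrable_and_integral_kernel (hρi n) (hρ1 n) i2
    have hcm := (contDiff_moll (hρs n) (hρc n) hφi).continuous
    refine (hci.const_mul (E n ^ 2)).mono' (Continuous.aestronglyMeasurable (by fun_prop))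
      (Eventually.of_forall fun x => ?_)
    have hmx := (hm0 x).le
    rw [Real.norm_of_nonneg (by positivity)]
    refine le_trans ?_ (weighted_sq_integral_kernel_le (hρcont n) (hρc n) (hρ0 n) (hρ1 n)
      (fun y => norm_nonneg (φ y)) (fun y => (he0 y).le) i1 i2 (hEe n) x)
    rw [mul_assoc]
    refine (mul_le_of_le_one_left (by positivity) (pow_le_one₀ hmx (hm1 x))).trans ?_
    refine mul_le_mul_of_nonneg_left (pow_le_pow_left₀ (norm_nonneg _) ?_ 2) (sq_nonneg _)
    refine norm_integral_le_of_norm_le (integrable_kernel_smul (hρcont n) (hρc n) hφi.norm x)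
      (Eventually.of_forall fun y => ?_)
    rw [norm_smul, Real.norm_of_nonneg (hρ0 n _)]
  have hae : ∀ᵐ x, Tendsto (fun n => moll (ρ n) φ x) atTop (nhds (φ x)) := by
    have := ContDiffBump.ae_convolution_tendsto_right_of_locallyIntegrable
      (μ := (volume : Measure (RSpace d))) (φ := bump) (l := atTop) (K := 2) (g := φ) hrlim
      (Eventually.of_forall fun n => by
        change 2 / ((n : ℝ) + 1) ≤ 2 * (1 / ((n : ℝ) + 1))
        rw [mul_one_div])
      hφi.locallyIntegrable
    filter_upwards [this] with x hx
    simpa only [moll_eq_convolution] using hx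
  -- Fatou's lemma on the left. The right side is left in the form of the limit, with `E n → 1` and
  -- `r n → 0`; the commutator contribution disappears because `J` is finite.
  have hfinal : τ * I ≤ C * (1 ^ 2 * (2 * C * I + 2 * (L * 0) ^ 2 * J)) := by
    rw [hI, ← integral_const_mul, ← hI]
    refine integral_le_of_ae_tendsto (f := fun n x => τ * (m x ^ j * e x ^ 2
      * ‖moll (ρ n) φ x‖ ^ 2)) (b := fun n => C * (E n ^ 2 * (2 * C * I + 2 * (L * r n) ^ 2 * J)))
      (fun n => (hfi n).const_mul τ) (fun n x => ?_) (i3.const_mul τ) (fun x => ?_) ?_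
      (fun n => by rw [integral_const_mul]; exact hcar n) ?_
    · have := (hm0 x).le
      positivity
    · have := (hm0 x).le
      positivity
    · filter_upwards [hae] with x hx
      exact ((hx.norm.pow 2).const_mul _).const_mul τ
    · have hEl : Tendsto E atTop (nhds 1) := by
        have : Tendsto (fun n => τ * (L * r n)) atTop (nhds (τ * (L * 0))) :=
          (hrlim.const_mul L).const_mul τ
        have h2 := (Real.continuous_exp.tendsto _).comp this
        rw [mul_zero, mul_zero, Real.exp_zero] at h2
        exact h2
      exact ((hEl.pow 2).mul (tendsto_const_nhds.add
        ((((hrlim.const_mul L).pow 2).const_mul 2).mul_const J))).const_mul C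
  have hI0 : 0 ≤ I := integral_nonneg fun x => by
    have := (hm0 x).le
    positivity
  have hIz : I = 0 := by
    have h1 : (2 * C ^ 2 + 1) * I ≤ τ * I := mul_le_mul_of_nonneg_right (le_max_right _ _) hI0
    have h2 : C * (1 ^ 2 * (2 * C * I + 2 * (L * 0) ^ 2 * J)) = 2 * C ^ 2 * I := by ring
    rw [h2] at hfinal
    linarith
  have hzero := (integral_eq_zero_iff_of_nonneg (fun x => by
    have := (hm0 x).le
    positivity) i3).1 hIz
  rw [Lp.eq_zero_iff_ae_eq_zero]
  filter_upwards [hzero] with x hx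
  have h1 : m x ^ j * e x ^ 2 ≠ 0 := mul_ne_zero (pow_ne_zero _ (hm0 x).ne')
    (pow_ne_zero _ (he0 x).ne')
  simpa [h1] using hx

end Vanishing

theorem theorem5 (d : ℕ) (hd : 1 ≤ d) (j : ℕ) (hj : j = 1 ∨ j = 2)
    (V₁ V₂ : RSpace d → ℝ)
    (hV₁_smooth : ContDiff ℝ ∞ V₁) (hV₁_bdd : ∃ C : ℝ, ∀ x, |V₁ x| ≤ C)
    (hV₂_meas : Measurable V₂) (hV₂_bdd : ∃ C : ℝ, ∀ x, |V₂ x| ≤ C)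
    (hV_lim : Tendsto (fun x => V₁ x + V₂ x) (cobounded (RSpace d)) (nhds 0))
    (δ : ℝ) (hδ : 0 < δ)
    (hV₂_decay : V₂ =O[cobounded (RSpace d)] fun x => ‖x‖ ^ (-δ - (j : ℝ) / 2))
    (hV₁_decay : ∀ k : ℕ, 1 ≤ k → k ≤ j → ∀ J : Fin k → Fin d,
      iteratedPartial J V₁ =O[cobounded (RSpace d)] fun x => ‖x‖ ^ (-(δ + j + k) / 2))
    (lam : ℝ) (φ : L2 d)
    (hφ : IsEigensolution (fun ξ => ‖ξ‖ ^ (2 * j)) (fun x => V₁ x + V₂ x) lam φ)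
    (hφ_ne : φ ≠ 0) :
    criticalDecayRate φ < ⊤ := by
  have hV₁m : Measurable V₁ := hV₁_smooth.continuous.measurable
  obtain ⟨m, g, Z, L, C, τ₀, ⟨hm, hm0, hm1⟩, ⟨hg, hL, hgL⟩, ⟨hZ, hZL, B, hB⟩, ⟨hC, hVZ⟩, hCar⟩ :=
    exists_carleman_potential hd j hj V₁ V₂ hV₁_smooth hV₁_bdd hV₂_bdd δ hδ hV₂_decay hV₁_decay lam
  by_contra htop
  exact hφ_ne (eq_zero_of_superexponential_decay (hV₁m.add hV₂_meas) hm hm0 hm1 hg hL hgL hZ hZL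
    hB hC hVZ hCar hφ fun σ hσ =>
      memLp_exp_of_criticalDecayRate_eq_top (not_lt_top_iff.1 htop) hσ)

end
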